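/- **Conventions.** Let $(V,Y,\mathbf 1,\omega)$ be a vertex operator algebra over $\mathbb C$, $V=\coprod_{n\in\mathbb Z}V_{(n)}$, with $Y(v,x)=\sum_{n\in\mathbb Z}Y_n(v)x^{-n-1}$ and $L(n)=Y_{n+1}(\omega)$. An automorphism of $V$ is a linear isomorphism $g$ with $g(Y(v_1,x)v_2)=Y(g(v_1),x)g(v_2)$, $g(\mathbf 1)=\mathbf 1$, $g(\omega)=\omega$. Write $g=e^{2\pi i\mathcal L_g}$ with $\mathcal L_g=\mathcal S_g+\mathcal N_g$, where $\mathcal S_g$ acts as $\alpha$ (with $0\le\Re\alpha<1$) on the generalized eigenspace of $g$ with eigenvalue $e^{2\pi i\alpha}$, and $2\pi i\,\mathcal N_g$ is the logarithm of the locally unipotent part of $g$. If a space is the direct sum of the generalized eigenspaces of an operator $T$, with semisimple part $T_S$ and locally nilpotent part $T_N$, then $e^T=e^{T_S}e^{T_N}$ and $x^T=x^{T_S}e^{T_N\log x}$. A *$\mathbb C/\mathbb Z$-graded generalized $g$-twisted $V$-module* is a vector space $W=\coprod_{n\in\mathbb C,\,\alpha\in\mathbb C/\mathbb Z}W_{[n]}^{[\alpha]}$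 with an action of $g$ by a linear automorphism of $W$, and a linear map $Y_W^g:V\otimes W\to W\{x\}[\log x]$ such that $g\,Y_W^g(v,x)w=Y_W^g(gv,x)gw$ for all $v\in V$, $w\in W$, and such that the following hold. 1. (Equivariance) $Y_W^{g;p+1}(gv,z)w=Y_W^{g;p}(v,z)w$ for $p\in\mathbb Z$, $z\in\mathbb C^\times$, where $Y_W^{g;p}(v,z)w=Y_W^g(v,x)w|_{x^n=e^{nl_p(z)},\,\log x=l_p(z)}$ and $l_p(z)=\log|z|+i\arg z+2\pi ip$, $0\le\arg z<2\pi$. 2. (Identity) $Y_W^g(\mathbf 1,x)w=w$. 3. (Lower truncation) For all $v,w$, the coefficients of $x^n(\log x)^k$ in $Y_W^g(v,x)w$ vanish when $\Re(n)$ is sufficiently negative. 4. (Jacobi identity) $$x_0^{-1}\delta\left(\tfrac{x_1-x_2}{x_0}\right)Y_W^g(v_1,x_1)Y_W^g(v_2,x_2)-x_0^{-1}\delta\left(\tfrac{-x_2+x_1}{x_0}\right)Y_W^g(v_2,x_2)Y_W^g(v_1,x_1)=x_1^{-1}\delta\left(\tfrac{x_2+x_0}{x_1}\right)Y_W^g\left(Y\left(\left(\tfrac{x_2+x_0}{x_1}\right)^{\mathcal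 L_g}v_1,x_0\right)v_2,x_2\right).$$ 5. (Gradings) With $L_W^g(0)=\mathrm{Res}_x\,xY_W^g(\omega,x)$, every $w\in W_{[n]}=\coprod_\alpha W_{[n]}^{[\alpha]}$ is annihilated by a power of $L_W^g(0)-n$, and every $w\in W^{[\alpha]}=\coprod_nW_{[n]}^{[\alpha]}$ is annihilated by a power of $g-e^{2\pi i\alpha}$. 6. ($L(-1)$-derivative) $\frac{d}{dx}Y_W^g(v,x)=Y_W^g(L(-1)v,x)$. Write $(Y_W^g)_0(v)$ for the coefficient of $x^{-1}(\log x)^0$ in $Y_W^g(v,x)$. For $u\in V_{(1)}$ put $g_u=e^{2\pi iY_0(u)}$ and $$\Delta_V^{(u)}(x)=x^{-Y_0(u)}\exp\Big(\sum_{m\ge1}\frac{(-1)^m}{m}Y_m(u)x^{-m}\Big).$$ **Theorem.** Let $V$ be a vertex operator algebra with $V_{(0)}=\mathbb C\mathbf 1$ and $V_{(n)}=0$ for $n<0$, let $g$ be an automorphism of $V$, and let $u\in V_{(1)}$ satisfy $L(1)u=0$ and $g(u)=u$. Let $(W,Y_W^g)$ be a $\mathbb C/\mathbb Z$-graded generalized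 $g$-twisted $V$-module, and assume that $W$ is the direct sum of the generalized eigenspaces of $(Y_W^g)_0(u)$. Then $gg_u$ is an automorphism of $V$, there is $\mu\in\mathbb C$ with $Y_1(u)u=\mu\mathbf 1$, and $W$ is a $\mathbb C/\mathbb Z$-graded generalized $gg_u$-twisted $V$-module with the vertex operator map $$Y_W^{gg_u}(v,x)w=Y_W^g(\Delta_V^{(u)}(x)v,x)w,$$ the action of $gg_u$ on $W$ by $g\,e^{2\pi i(Y_W^g)_0(u)}$, and the grading $W=\coprod_{n\in\mathbb C,\,\gamma\in\mathbb C/\mathbb Z}W_{\langle n\rangle}^{\langle\gamma\rangle}$, $$W_{\langle n\rangle}^{\langle\gamma\rangle}=\sum_{\substack{\alpha\in\mathbb C/\mathbb Z,\ \beta\in\mathbb C\\ \alpha+\beta\equiv\gamma \bmod \mathbb Z}}W_{[n+\beta-\frac12\mu]}^{[\alpha],[\beta]},$$ where $W_{[m]}^{[\alpha],[\beta]}$ is the intersection of $W_{[m]}^{[\alpha]}$ with the generalized eigenspace of $(Y_W^g)_0(u)$ with eigenvalue $\beta$. Moreover $$L_W^{gg_u}(0)=L_W^g(0)-(Y_W^g)_0(u)+\tfrac12\mu,$$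 and for every $n\in\mathbb C$ the space $\sum_\gamma W_{\langle n\rangle}^{\langle\gamma\rangle}$ is the generalized eigenspace of this operator with eigenvalue $n$. -/

import Mathlib

noncomputable section

namespace TwistedVOA

/-! ### Functional calculus for locally finite operators -/

section Operators

variable {V : Type*} [AddCommGroup V] [Module ℂ V]

/-- A family of operators `f i` such that, for every `v`, only finitely many `f i v` are nonzero,
regarded as a linear map `v ↦ (f i v)_i` (zero if the family is not of this kind). -/
def locFamily {ι : Type*} (f : ι → Module.End ℂ V) : V →ₗ[ℂ] (ι →₀ V) :=
  open Classical in
  if h : ∀ v, (Function.support fun i => f i v).Finite then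
    { toFun := fun v => Finsupp.ofSupportFinite (fun i => f i v) (h v)
      map_add' := fun v w => by ext i; simp [Finsupp.ofSupportFinite_coe]
      map_smul' := fun c v => by ext i; simp [Finsupp.ofSupportFinite_coe] }
  else 0

/-- The sum `∑ i, f i` of a family of operators that is finite on every vector. -/
def locSum {ι : Type*} (f : ι → Module.End ℂ V) : Module.End ℂ V :=
  (Finsupp.lsum ℂ fun _ : ι => (LinearMap.id : V →ₗ[ℂ] V)) ∘ₗ locFamily f

/-- The space is the direct sum of the generalized eigenspaces of `T`. -/
abbrev IsSumOfGenEigenspaces (T : Module.End ℂ V) : Prop :=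
  DirectSum.IsInternal fun c : ℂ => T.maxGenEigenspace c

/-- If the space is the direct sum of the generalized eigenspaces of `T`: the operator acting as
the scalar `φ c` on the generalized eigenspace of `T` with eigenvalue `c`, for all `c`. -/
def spectralMap (T : Module.End ℂ V) (φ : ℂ → ℂ) : Module.End ℂ V :=
  open Classical in
  if h : Function.Bijective (DirectSum.coeLinearMap fun c : ℂ => T.maxGenEigenspace c) then
    DirectSum.toModule ℂ ℂ V (fun c => φ c • (T.maxGenEigenspace c).subtype) ∘ₗ
      (LinearEquiv.ofBijective
        (DirectSum.coeLinearMap fun c : ℂ => T.maxGenEigenspace c) h).symm.toLinearMap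
  else 0

/-- The projection onto the generalized eigenspace of `T` with eigenvalue `c`. -/
def eigenProj (T : Module.End ℂ V) (c : ℂ) : Module.End ℂ V :=
  open Classical in spectralMap T fun d => if d = c then 1 else 0

/-- The semisimple part of `T`. -/
def semisimplePart (T : Module.End ℂ V) : Module.End ℂ V := spectralMap T id

/-- The (locally) nilpotent part of `T`. -/
def nilPart (T : Module.End ℂ V) : Module.End ℂ V := T - semisimplePart T

/-- `e ^ T = e ^ (semisimple part) * e ^ (nilpotent part)`. -/
def expOp (T : Module.End ℂ V) : Module.End ℂ V :=
  spectralMap T Complex.exp * locSum fun j : ℕ => ((j.factorial : ℂ)⁻¹) • nilPart T ^ j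

/-- The coefficient of `x ^ s (log x) ^ t` in
`x ^ T = x ^ (semisimple part) * e ^ ((nilpotent part) log x)`. -/
def powCoeff (T : Module.End ℂ V) (s : ℂ) (t : ℕ) : Module.End ℂ V :=
  ((t.factorial : ℂ)⁻¹) • (nilPart T ^ t * eigenProj T s)

/-- The binomial coefficient `T (T - 1) ⋯ (T - j + 1) / j!`. -/
def binomOp (T : Module.End ℂ V) (j : ℕ) : Module.End ℂ V :=
  ((j.factorial : ℂ)⁻¹) • Polynomial.aeval T (descPochhammer ℂ j)

/-- The coefficients of `((x₂ + x₀) / x₁) ^ T`, expanded in nonnegative powers of `x₀`: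
`((x₂ + x₀) / x₁) ^ T = ∑_{c, j, k, i} ratioPowCoeff T c j k i
   x₀ ^ j x₁ ^ (-c) (log x₁) ^ k x₂ ^ (c - j) (log x₂) ^ i`.
Indeed `(x₂ + x₀) ^ T = (1 + x₀ / x₂) ^ T x₂ ^ T`, where
`(1 + x₀ / x₂) ^ T = ∑_j binomOp T j (x₀ / x₂) ^ j`, and on the generalized eigenspace with
eigenvalue `c` one has `x₂ ^ T = x₂ ^ c e ^ (N log x₂)` and `x₁ ^ (-T) = x₁ ^ (-c) e ^ (-N log x₁)`,
where `N` is the nilpotent part of `T`. -/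
def ratioPowCoeff (T : Module.End ℂ V) (c : ℂ) (j k i : ℕ) : Module.End ℂ V :=
  binomOp T j * powCoeff T c i * powCoeff (-T) (-c) k

/-- The branch `l_p(z) = log |z| + i arg z + 2 π i p` of the logarithm, where `0 ≤ arg z < 2 π`. -/
def logBranch (p : ℤ) (z : ℂ) : ℂ :=
  (Real.log ‖z‖ : ℂ) +
    Complex.I * ((if z.arg < 0 then z.arg + 2 * Real.pi else z.arg : ℝ) : ℂ) +
    2 * Real.pi * Complex.I * p

/-- The operator `𝒮_g`, equal to `α` on the generalized eigenspace of `g` with eigenvalue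
`e ^ (2 π i α)`, where `0 ≤ Re α < 1`. -/
def logSemisimple (g : Module.End ℂ V) : Module.End ℂ V :=
  spectralMap g fun c => logBranch 0 c / (2 * Real.pi * Complex.I)

/-- The locally unipotent part of `g` in its multiplicative Jordan decomposition. -/
def unipotentPart (g : Module.End ℂ V) : Module.End ℂ V :=
  spectralMap g (fun c => c⁻¹) * g

/-- The operator `𝒩_g = (2 π i)⁻¹ log (unipotent part of g)`. -/
def logNilpotent (g : Module.End ℂ V) : Module.End ℂ V :=
  locSum fun j : ℕ =>
    ((-1 : ℂ) ^ j / (2 * Real.pi * Complex.I * (j + 1))) • (unipotentPart g - 1) ^ (j + 1)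

/-- The operator `ℒ_g = 𝒮_g + 𝒩_g`, with `g = e ^ (2 π i ℒ_g)`. -/
def logOp (g : Module.End ℂ V) : Module.End ℂ V := logSemisimple g + logNilpotent g

end Operators

/-! ### Vertex operator algebras -/

/-- The component `u_n v` in `Y(u, x) v = ∑_n u_n v x ^ (-n - 1)`. -/
def modeOf {V : Type*} [AddCommGroup V] [Module ℂ V] (Y : V →ₗ[ℂ] VertexOperator ℂ V)
    (u : V) (n : ℤ) : Module.End ℂ V :=
  VertexOperator.ncoeff (Y u) n

/-- A vertex operator algebra structure on the complex vector space `V`. -/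
structure VertexOperatorAlgebra (V : Type*) [AddCommGroup V] [Module ℂ V] where
  /-- The homogeneous subspaces `V_(n)`. -/
  weight : ℤ → Submodule ℂ V
  isInternal : DirectSum.IsInternal weight
  finiteDimensional : ∀ n, FiniteDimensional ℂ (weight n)
  lowerBounded : ∃ N : ℤ, ∀ n < N, weight n = ⊥
  /-- The vertex operator map; `Y(u, x) v` is a Laurent series. -/
  Y : V →ₗ[ℂ] VertexOperator ℂ V
  vacuum : V
  conformal : V
  centralCharge : ℂ
  vacuum_mem : vacuum ∈ weight 0
  conformal_mem : conformal ∈ weight 2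
  /-- `Y(𝟏, x) v = v`. -/
  vacuum_mode : ∀ (n : ℤ) (v : V), modeOf Y vacuum n v = if n = -1 then v else 0
  /-- `Y(v, x) 𝟏` has no negative powers of `x`, -/
  mode_vacuum_nonneg : ∀ (v : V) (n : ℤ), 0 ≤ n → modeOf Y v n vacuum = 0
  /-- and its constant term is `v`. -/
  mode_vacuum_neg_one : ∀ v : V, modeOf Y v (-1) vacuum = v
  /-- The coefficient of `x₀ ^ (-l - 1) x₁ ^ (-m - 1) x₂ ^ (-n - 1)` in the Jacobi identity. All
  sums are finite. -/
  jacobi : ∀ (u v w : V) (l m n : ℤ),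
    (∑ᶠ i : ℕ, ((-1 : ℂ) ^ i * (Ring.choose l i : ℤ)) •
        modeOf Y u (m + l - i) (modeOf Y v (n + i) w)) -
      (∑ᶠ i : ℕ, ((-1 : ℂ) ^ (l - i) * (Ring.choose l i : ℤ)) •
        modeOf Y v (n + l - i) (modeOf Y u (m + i) w)) =
    ∑ᶠ i : ℕ, ((Ring.choose m i : ℤ) : ℂ) •
        modeOf Y (modeOf Y u (l + i) v) (m + n - i) w
  /-- The Virasoro relations for `L(n) = ω_(n + 1)`. -/
  virasoro : ∀ (m n : ℤ) (v : V),
    modeOf Y conformal (m + 1) (modeOf Y conformal (n + 1) v) -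
      modeOf Y conformal (n + 1) (modeOf Y conformal (m + 1) v) =
    ((m : ℂ) - n) • modeOf Y conformal (m + n + 1) v +
      (if m + n = 0 then centralCharge / 12 * ((m : ℂ) ^ 3 - m) else 0) • v
  /-- `V_(n)` consists of eigenvectors of `L(0)` with eigenvalue `n`. -/
  weight_eigen : ∀ (n : ℤ), ∀ v ∈ weight n, modeOf Y conformal 1 v = (n : ℂ) • v
  /-- The `L(-1)`-derivative property `Y(L(-1) v, x) = d/dx Y(v, x)`. -/
  derivative : ∀ (v w : V) (n : ℤ),
    modeOf Y (modeOf Y conformal 0 v) n w = (-n : ℂ) • modeOf Y v (n - 1) w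

/-- The space `W{x}[log x]` of polynomials in `log x` whose coefficients are formal series in
arbitrary complex powers of `x`: `f k n` is the coefficient of `x ^ n (log x) ^ k`. -/
abbrev LogSeries (W : Type*) [AddCommGroup W] := ℕ →₀ (ℂ → W)

section LogSeries

variable {W : Type*} [AddCommGroup W] [Module ℂ W]

/-- Multiplication by `x ^ s (log x) ^ t`. -/
def LogSeries.shift (s : ℂ) (t : ℕ) : LogSeries W →ₗ[ℂ] LogSeries W :=
  Finsupp.lmapDomain (ℂ → W) ℂ (fun k => k + t) ∘ₗ
    Finsupp.mapRange.linearMap (LinearMap.funLeft ℂ W fun n : ℂ => n - s)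

/-- The term with exponent `n` in `f |_{x ^ n = e ^ (n l_p(z)), log x = l_p(z)}`. -/
def LogSeries.branchTerm (f : LogSeries W) (p : ℤ) (z n : ℂ) : W :=
  f.sum fun k c => (Complex.exp (n * logBranch p z) * logBranch p z ^ k) • c n

end LogSeries

/-- The group `ℂ / ℤ`. -/
abbrev CmodZ := ℂ ⧸ AddSubgroup.zmultiples (1 : ℂ)

namespace VertexOperatorAlgebra

variable {V : Type*} [AddCommGroup V] [Module ℂ V] (A : VertexOperatorAlgebra V)

/-- `A.mode u n` is the component `Y_n(u)` of `Y(u, x) = ∑_n Y_n(u) x ^ (-n - 1)`. -/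
def mode (u : V) (n : ℤ) : Module.End ℂ V := modeOf A.Y u n

/-- The Virasoro operators `L(n)` on `V`. -/
def L (n : ℤ) : Module.End ℂ V := A.mode A.conformal (n + 1)

/-- Automorphisms of a vertex operator algebra. -/
structure IsAutomorphism (g : Module.End ℂ V) : Prop where
  bijective : Function.Bijective g
  map_mode : ∀ (u v : V) (n : ℤ), g (A.mode u n v) = A.mode (g u) n (g v)
  map_vacuum : g A.vacuum = A.vacuum
  map_conformal : g A.conformal = A.conformal

/-- `g_u = e ^ (2 π i Y_0(u))` on `V`. -/
def innerAut (u : V) : Module.End ℂ V :=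
  expOp ((2 * Real.pi * Complex.I : ℂ) • A.mode u 0)

/-- The power series `∑_{m ≥ 1} ((-1) ^ m / m) Y_m(u) X ^ m`. For `X = x⁻¹` this is
`-∫_0^{-x} Y^{≤ -2}(u, y) dy`, where `Y^{≤ -2}(u, y) = ∑_{m ≥ 1} Y_m(u) y ^ (-m - 1)` and
`∫_0^x y ^ n dy = x ^ (n + 1) / (n + 1)`. -/
def deltaExponent (u : V) : PowerSeries (Module.End ℂ V) :=
  PowerSeries.mk fun m => if m = 0 then 0 else ((-1 : ℂ) ^ m / m) • A.mode u m

/-- The coefficient of `x ^ (-r)` in `exp (-∫_0^{-x} Y^{≤ -2}(u, y) dy)`. Powers `k > r` of the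
exponent do not contribute, since it has no constant term. -/
def deltaExpCoeff (u : V) (r : ℕ) : Module.End ℂ V :=
  ∑ k ∈ Finset.range (r + 1),
    ((k.factorial : ℂ)⁻¹) • PowerSeries.coeff r (A.deltaExponent u ^ k)

/-- The coefficient of `x ^ s (log x) ^ t` in
`Δ_V^{(u)}(x) = x ^ (-Y_0(u)) exp (-∫_0^{-x} Y^{≤ -2}(u, y) dy)`. -/
def deltaCoeff (u : V) (s : ℂ) (t : ℕ) : Module.End ℂ V :=
  locSum fun r : ℕ => powCoeff (-A.mode u 0) (s + r) t * A.deltaExpCoeff u r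

/-- `v ↦ Δ_V^{(u)}(x) v`, a finite sum of terms `v_{s,t} x ^ s (log x) ^ t`. -/
def delta (u : V) : V →ₗ[ℂ] (ℂ × ℕ →₀ V) :=
  locFamily fun p : ℂ × ℕ => A.deltaCoeff u p.1 p.2

end VertexOperatorAlgebra

/-! ### Generalized twisted modules -/

section Modules

variable {V : Type*} [AddCommGroup V] [Module ℂ V] (A : VertexOperatorAlgebra V)
  {W : Type*} [AddCommGroup W] [Module ℂ W]

/-- The coefficient of `x ^ n (log x) ^ k` in `Y_W(v, x)`, as an operator on `W`. -/
def coeffOp (YW : V →ₗ[ℂ] W →ₗ[ℂ] LogSeries W) (v : V) (n : ℂ) (k : ℕ) : Module.End ℂ W :=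
  LinearMap.proj n ∘ₗ Finsupp.lapply k ∘ₗ YW v

/-- The operator `(Y_W)_0(v)`: the coefficient of `x ^ (-1)` in `Y_W(v, x)`. -/
def zeroMode (YW : V →ₗ[ℂ] W →ₗ[ℂ] LogSeries W) (v : V) : Module.End ℂ W :=
  coeffOp YW v (-1) 0

/-- The operator `L_W(0)`: the coefficient of `x ^ (-2)` in `Y_W(ω, x)`. -/
def LZero (YW : V →ₗ[ℂ] W →ₗ[ℂ] LogSeries W) : Module.End ℂ W :=
  coeffOp YW A.conformal (-2) 0

/-- The coefficient of `x₀ ^ (-m - 1) x₁ ^ a (log x₁) ^ k x₂ ^ b (log x₂) ^ l` in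
`x₀⁻¹ δ((x₁ - x₂) / x₀) Y_W(u, x₁) Y_W(v, x₂) w`. -/
def jacobiProd (YW : V →ₗ[ℂ] W →ₗ[ℂ] LogSeries W) (u v : V) (w : W)
    (m : ℤ) (a : ℂ) (k : ℕ) (b : ℂ) (l : ℕ) : W :=
  ∑ᶠ j : ℕ, ((-1 : ℂ) ^ j * (Ring.choose m j : ℤ)) •
    coeffOp YW u (a - m + j) k (coeffOp YW v (b - j) l w)

/-- The coefficient of `x₀ ^ (-m - 1) x₁ ^ a (log x₁) ^ k x₂ ^ b (log x₂) ^ l` in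
`x₀⁻¹ δ((-x₂ + x₁) / x₀) Y_W(v, x₂) Y_W(u, x₁) w`. -/
def jacobiProdOpp (YW : V →ₗ[ℂ] W →ₗ[ℂ] LogSeries W) (u v : V) (w : W)
    (m : ℤ) (a : ℂ) (k : ℕ) (b : ℂ) (l : ℕ) : W :=
  ∑ᶠ j : ℕ, ((-1 : ℂ) ^ (m - j) * (Ring.choose m j : ℤ)) •
    coeffOp YW v (b - m + j) l (coeffOp YW u (a - j) k w)

/-- The coefficient of `x₀ ^ (-m - 1) x₁ ^ a (log x₁) ^ k x₂ ^ b (log x₂) ^ l` in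
`x₁⁻¹ δ((x₂ + x₀) / x₁) Y_W(Y(((x₂ + x₀) / x₁) ^ ℒ_g u, x₀) v, x₂) w`, that is, in
`∑_{q ∈ ℤ} x₁⁻¹ Y_W(Y(((x₂ + x₀) / x₁) ^ (q + ℒ_g) u, x₀) v, x₂) w`. Only the eigenvalue
`-(a + 1)` of `q + ℒ_g` contributes to `x₁ ^ a`. -/
def jacobiIter (g : Module.End ℂ V) (YW : V →ₗ[ℂ] W →ₗ[ℂ] LogSeries W) (u v : V) (w : W)
    (m : ℤ) (a : ℂ) (k : ℕ) (b : ℂ) (l : ℕ) : W :=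
  ∑ᶠ q : ℤ, ∑ᶠ j : ℕ, ∑ i ∈ Finset.HasAntidiagonal.antidiagonal l,
    coeffOp YW
      (A.mode (ratioPowCoeff ((q : Module.End ℂ V) + logOp g) (-(a + 1)) j k i.1 u) (m + j) v)
      (b - (-(a + 1) - j)) i.2 w

open Classical in
/-- `(W, Y_W)` is a `ℂ/ℤ`-graded generalized `g`-twisted `V`-module, where `gW` is the action of
`g` on `W` and `gr n α` is the homogeneous subspace `W_[n]^[α]`. -/
structure IsTwistedModule (g : Module.End ℂ V) (YW : V →ₗ[ℂ] W →ₗ[ℂ] LogSeries W)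
    (gW : Module.End ℂ W) (gr : ℂ → CmodZ → Submodule ℂ W) : Prop where
  /-- `W` is the direct sum of the subspaces `W_[n]^[α]`. -/
  isInternal : DirectSum.IsInternal fun p : ℂ × CmodZ => gr p.1 p.2
  /-- `g` acts on `W` by a linear automorphism -/
  act_bijective : Function.Bijective gW
  /-- which is compatible with its action on `V`. -/
  act_compat : ∀ (v : V) (w : W) (n : ℂ) (k : ℕ),
    gW (coeffOp YW v n k w) = coeffOp YW (g v) n k (gW w)
  /-- `Y_W^{p+1}(g v, z) w = Y_W^p(v, z) w`, as series indexed by the exponents `n`. -/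
  equivariance : ∀ (p : ℤ) (z : ℂ), z ≠ 0 → ∀ (v : V) (w : W) (n : ℂ),
    (YW (g v) w).branchTerm (p + 1) z n = (YW v w).branchTerm p z n
  /-- `Y_W(𝟏, x) w = w`. -/
  identity : ∀ (w : W) (n : ℂ) (k : ℕ),
    coeffOp YW A.vacuum n k w = if n = 0 ∧ k = 0 then w else 0
  /-- `Y_W(v, x) w` involves only powers of `x` whose exponents have real parts bounded below. -/
  lowerTruncation : ∀ (v : V) (w : W), ∃ B : ℝ, ∀ n : ℂ, n.re < B → ∀ k : ℕ,
    coeffOp YW v n k w = 0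
  /-- The Jacobi identity, coefficient by coefficient. -/
  jacobi : ∀ (u v : V) (w : W) (m : ℤ) (a : ℂ) (k : ℕ) (b : ℂ) (l : ℕ),
    jacobiProd YW u v w m a k b l - jacobiProdOpp YW u v w m a k b l =
      jacobiIter A g YW u v w m a k b l
  /-- The `L(0)`-grading condition. -/
  gradingLZero : ∀ (n : ℂ), ∀ w ∈ ⨆ α, gr n α,
    ∃ K : ℕ, ((LZero A YW - algebraMap ℂ (Module.End ℂ W) n) ^ K) w = 0
  /-- The `g`-grading condition. -/
  gradingAct : ∀ (α : ℂ), ∀ w ∈ ⨆ n, gr n (α : CmodZ),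
    ∃ K : ℕ, ((gW - algebraMap ℂ (Module.End ℂ W)
      (Complex.exp (2 * Real.pi * Complex.I * α))) ^ K) w = 0
  /-- The `L(-1)`-derivative property `d/dx Y_W(v, x) = Y_W(L(-1) v, x)`. -/
  derivative : ∀ (v : V) (w : W) (n : ℂ) (k : ℕ),
    (n + 1) • coeffOp YW v (n + 1) k w + ((k : ℂ) + 1) • coeffOp YW v (n + 1) (k + 1) w =
      coeffOp YW (A.L (-1) v) n k w

/-- The twisted vertex operator map `Y_W(Δ_V^{(u)}(x) v, x) w`. -/
def deltaTwist (u : V) (YW : V →ₗ[ℂ] W →ₗ[ℂ] LogSeries W) : V →ₗ[ℂ] W →ₗ[ℂ] LogSeries W :=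
  (Finsupp.lsum ℂ fun p : ℂ × ℕ =>
    (LinearMap.compRight ℂ (LogSeries.shift p.1 p.2) : _ →ₗ[ℂ] (W →ₗ[ℂ] LogSeries W)) ∘ₗ YW) ∘ₗ
    A.delta u

/-- The operator `e ^ (2 π i (Y_W)_0(u))` on `W`. -/
def innerAct (u : V) (YW : V →ₗ[ℂ] W →ₗ[ℂ] LogSeries W) : Module.End ℂ W :=
  expOp ((2 * Real.pi * Complex.I : ℂ) • zeroMode YW u)

/-- The subspace `W_⟨n⟩^⟨γ⟩`, the sum of the subspaces `W_[n + β - μ/2]^[α],[β]` over all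
`α ∈ ℂ/ℤ` and `β ∈ ℂ` with `α + β = γ` in `ℂ/ℤ`, where `W_[n]^[α],[β]` is the intersection of
`W_[n]^[α]` with the generalized eigenspace of `(Y_W)_0(u)` with eigenvalue `β`. -/
def deltaGrading (u : V) (YW : V →ₗ[ℂ] W →ₗ[ℂ] LogSeries W)
    (gr : ℂ → CmodZ → Submodule ℂ W) (μ : ℂ) (n : ℂ) (γ : CmodZ) : Submodule ℂ W :=
  ⨆ (α : CmodZ) (β : ℂ) (_ : α + (β : CmodZ) = γ),
    gr (n + β - μ / 2) α ⊓ (zeroMode YW u).maxGenEigenspace β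

end Modules

end TwistedVOA

end

noncomputable section

open Finset.HasAntidiagonal (antidiagonal)

namespace TwistedVOA

section Operators

variable {V : Type*} [AddCommGroup V] [Module ℂ V]

/-! ### Sums of pointwise finite families -/

/-! Write $E(X)=\exp\big(\sum_{m\ge1}\frac{(-1)^m}{m}u_mX^m\big)=\sum_rE_rX^r$, so that
$\Delta(x)=x^{-u_0}E(x^{-1})$. Since weights are nonnegative and $V_{(0)}$ is spanned by the vacuum,
$u_0u=0$, $u_1u=\mu\mathbf 1$ and $u_nu=0$ for $n\ge2$ (`exists_isPrimaryCurrent`). Hence the modes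
$u_m$ with $m\ge0$ commute, and as $u_m$ lowers the weight by $m$, $E(X)v$ is a polynomial in $X$
for every $v$.

The engine is the conjugation formula $\Delta(x_2)Y(v,x_0)=Y(\Delta(x_2+x_0)v,x_0)\Delta(x_2)$,
whose part concerning $E$ is `deltaExpCoeff_mode`. Both sides satisfy the same first-order equation
for the Euler operator $X\,d/dX$ (`smul_deltaExpCoeff`, `smul_binomOp_deltaExpCoeff`), so their
coefficients agree by recursion. Applied to $\omega$, where
$\Delta(x)\omega=\omega-ux^{-1}+\frac{\mu}{2}x^{-2}$, the formula gives
$[\Delta(x),L(-1)]=\frac{d}{dx}\Delta(x)$ (`deltaExpCoeff_L_neg_one`), hence the derivative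
property; the same value of $\Delta(x)\omega$ gives the new $L(0)$.

For the Jacobi identity, products of twisted operators are finite combinations of products of
$Y_W^g$, to which the given identity applies. On the iterate side $\Delta(x_2)$ is moved inside
$Y(\cdot,x_0)$ by conjugation. The two results match because $\mathcal L_{gg_u}$ and $\mathcal
L_g+u_0$ differ on joint generalized eigenspaces only by integer scalars: the nilpotent parts add
exactly (`logNilpotent_mul_innerAut`), and the integers are absorbed by the sum over $q\in\mathbb Z$
in the delta function (`IsAutomorphism.jacobiIter_apply`). Both sides become sums of `iterTerm`,
compared by Chu–Vandermonde for commuting operators (`coeffOp_deltaTwist_iterate`, `sum_jacobiIter`,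
`jacobi_iterTerm`).

Equivariance holds because the monodromy of $x^{-u_0}$ cancels $g_u$. The grading is forced:
$W_{[n]}^{[\alpha]}$ is the full joint generalized eigenspace of $L_W(0)$ and $g$
(`IsTwistedModule.grading_eq`), both operators commute with $(Y_W)_0(u)$, and the new grading
records the eigenvalues of the shifted operators. -/

theorem locSum_apply {ι : Type*} {f : ι → Module.End ℂ V}
    (h : ∀ v, (Function.support fun i => f i v).Finite) (v : V) :
    locSum f v = ∑ᶠ i, f i v := by
  have e : locFamily f v = Finsupp.ofSupportFinite (fun i => f i v) (h v) := by
    rw [locFamily, dif_pos h]; rfl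
  rw [locSum, LinearMap.comp_apply, e, finsum_eq_sum _ (h v), Finsupp.lsum_apply, Finsupp.sum]
  refine Finset.sum_congr ?_ fun i _ => by simp [Finsupp.ofSupportFinite_coe]
  ext i; simp [Finsupp.ofSupportFinite_coe]

theorem locFamily_apply {ι : Type*} {f : ι → Module.End ℂ V}
    (h : ∀ v, (Function.support fun i => f i v).Finite) (v : V) (i : ι) :
    locFamily f v i = f i v := by
  rw [locFamily, dif_pos h]; rfl

theorem locSum_apply_eq_sum {ι : Type*} {f : ι → Module.End ℂ V}
    (h : ∀ v, (Function.support fun i => f i v).Finite) (v : V) (s : Finset ι)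
    (hs : ∀ i ∉ s, f i v = 0) : locSum f v = ∑ i ∈ s, f i v := by
  rw [locSum_apply h]
  refine finsum_eq_sum_of_support_subset _ fun i hi => ?_
  by_contra hn
  exact hi (hs i hn)

theorem commute_locSum {ι : Type*} {f : ι → Module.End ℂ V} {X : Module.End ℂ V}
    (h : ∀ v, (Function.support fun i => f i v).Finite) (hX : ∀ i, Commute X (f i)) :
    Commute X (locSum f) := by
  refine LinearMap.ext fun v => ?_
  rw [Module.End.mul_apply, Module.End.mul_apply, locSum_apply_eq_sum h v (h v).toFinset
    (fun i hi => by simpa using hi), locSum_apply_eq_sum h (X v) (h v).toFinset, map_sum]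
  · refine Finset.sum_congr rfl fun i _ => ?_
    exact LinearMap.congr_fun (hX i) v
  · intro i hi
    have h1 : f i v = 0 := by simpa using hi
    have h2 : X (f i v) = f i (X v) := LinearMap.congr_fun (hX i) v
    rw [← h2, h1, map_zero]

/-! ### Locally nilpotent operators and divided powers -/

/-- Every vector is annihilated by a power of `N`. -/
def IsLocNil (N : Module.End ℂ V) : Prop := ∀ v, ∃ K : ℕ, (N ^ K) v = 0

/-- The divided power `N ^ k / k!`. -/
def dpow (N : Module.End ℂ V) (k : ℕ) : Module.End ℂ V := ((k.factorial : ℂ)⁻¹) • N ^ k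

@[simp] theorem dpow_zero (N : Module.End ℂ V) : dpow N 0 = 1 := by simp [dpow]

theorem succ_smul_dpow (N : Module.End ℂ V) (k : ℕ) :
    ((k : ℂ) + 1) • dpow N (k + 1) = N * dpow N k := by
  rw [dpow, dpow, smul_smul, mul_smul_comm, ← pow_succ']
  congr 1
  have := Nat.cast_ne_zero (R := ℂ).2 k.factorial_ne_zero
  have h2 : (k : ℂ) + 1 ≠ 0 := Nat.cast_add_one_ne_zero k
  rw [Nat.factorial_succ]; push_cast; field_simp

theorem dpow_add {M N : Module.End ℂ V} (h : Commute M N) (k : ℕ) :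
    dpow (M + N) k = ∑ i ∈ antidiagonal k, dpow M i.1 * dpow N i.2 := by
  rw [dpow, h.add_pow', Finset.smul_sum]
  refine Finset.sum_congr rfl fun i hi => ?_
  rw [Finset.HasAntidiagonal.mem_antidiagonal] at hi
  rw [dpow, dpow, smul_mul_smul_comm, ← Nat.cast_smul_eq_nsmul ℂ, smul_smul]
  congr 1
  subst hi
  have h1 := Nat.cast_ne_zero (R := ℂ).2 (i.1 + i.2).factorial_ne_zero
  have h2 := Nat.cast_ne_zero (R := ℂ).2 i.1.factorial_ne_zero
  have h3 := Nat.cast_ne_zero (R := ℂ).2 i.2.factorial_ne_zero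
  rw [Nat.cast_add_choose]
  field_simp

theorem commute_dpow {X N : Module.End ℂ V} (h : Commute X N) (k : ℕ) : Commute X (dpow N k) :=
  (h.pow_right k).smul_right _

theorem dpow_apply_eq_zero {N : Module.End ℂ V} {v : V} {K k : ℕ} (hK : (N ^ K) v = 0)
    (hk : K ≤ k) : dpow N k v = 0 := by
  rw [dpow, LinearMap.smul_apply, Module.End.pow_map_zero_of_le hk hK, smul_zero]

theorem IsLocNil.add {M N : Module.End ℂ V} (hM : IsLocNil M) (hN : IsLocNil N)
    (h : Commute M N) : IsLocNil (M + N) := by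
  intro v
  have := Module.End.genEigenspace_inf_le_add M N 0 0 ⊤ ⊤ h
  have h1 : v ∈ (M + N).maxGenEigenspace 0 := by
    have := @this v ⟨?_, ?_⟩
    · simpa using this
    · obtain ⟨k, hk⟩ := hM v
      exact (Module.End.mem_maxGenEigenspace _ _ _).2 ⟨k, by simpa using hk⟩
    · obtain ⟨k, hk⟩ := hN v
      exact (Module.End.mem_maxGenEigenspace _ _ _).2 ⟨k, by simpa using hk⟩
  obtain ⟨k, hk⟩ := (Module.End.mem_maxGenEigenspace _ _ _).1 h1
  exact ⟨k, by simpa using hk⟩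

theorem IsLocNil.mul_left {X N : Module.End ℂ V} (hN : IsLocNil N) (h : Commute X N) :
    IsLocNil (X * N) := by
  intro v
  obtain ⟨K, hK⟩ := hN v
  exact ⟨K, by rw [h.mul_pow, Module.End.mul_apply, hK, map_zero]⟩

theorem IsLocNil.smul {N : Module.End ℂ V} (hN : IsLocNil N) (c : ℂ) : IsLocNil (c • N) := by
  intro v
  obtain ⟨K, hK⟩ := hN v
  exact ⟨K, by rw [smul_pow, LinearMap.smul_apply, hK, smul_zero]⟩

theorem IsLocNil.neg {N : Module.End ℂ V} (hN : IsLocNil N) : IsLocNil (-N) := by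
  simpa using hN.smul (-1)

theorem IsLocNil.finite_support_smul_pow {N : Module.End ℂ V} (hN : IsLocNil N) (c : ℕ → ℂ)
    (e : ℕ → ℕ) (he : ∀ j, j ≤ e j) (v : V) :
    (Function.support fun j => (c j • N ^ e j) v).Finite := by
  obtain ⟨K, hK⟩ := hN v
  refine (Finset.range K).finite_toSet.subset fun j hj => ?_
  by_contra hn
  refine hj ?_
  have : K ≤ e j := le_trans (by simpa using hn) (he j)
  simp only [LinearMap.smul_apply, Module.End.pow_map_zero_of_le this hK, smul_zero]

/-! ### The exponential of a locally nilpotent operator -/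

/-- The exponential of a locally nilpotent operator. -/
def expNil (N : Module.End ℂ V) : Module.End ℂ V := locSum (dpow N)

theorem IsLocNil.finite_support_dpow {N : Module.End ℂ V} (hN : IsLocNil N) (v : V) :
    (Function.support fun j => dpow N j v).Finite :=
  hN.finite_support_smul_pow (fun j => ((j.factorial : ℂ)⁻¹)) id (fun _ => le_rfl) v

theorem expNil_apply {N : Module.End ℂ V} (hN : IsLocNil N) {v : V} {K : ℕ}
    (hK : (N ^ K) v = 0) : expNil N v = ∑ j ∈ Finset.range K, dpow N j v :=
  locSum_apply_eq_sum hN.finite_support_dpow v _ fun j hj =>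
    dpow_apply_eq_zero hK (by simpa using hj)

theorem commute_expNil {X N : Module.End ℂ V} (hN : IsLocNil N) (h : Commute X N) :
    Commute X (expNil N) :=
  commute_locSum hN.finite_support_dpow fun k => commute_dpow h k

/-- Terms beyond the triangle $i+j<J$ vanish, so a square truncation may be read along
antidiagonals. Every truncated Cauchy product below is regrouped this way. -/
theorem sum_range_sum_range_eq_sum_antidiagonal {M : Type*} [AddCommMonoid M] (J : ℕ)
    (F : ℕ → ℕ → M) (h : ∀ i j, J ≤ i + j → F i j = 0) :
    ∑ i ∈ Finset.range J, ∑ j ∈ Finset.range J, F i j =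
      ∑ k ∈ Finset.range J, ∑ p ∈ antidiagonal k, F p.1 p.2 := by
  rw [← Finset.sum_product', Finset.sum_sigma']
  symm
  apply Finset.sum_of_injOn (fun x : (_ : ℕ) × ℕ × ℕ => x.2)
  · rintro ⟨k, p⟩ hx ⟨k', p'⟩ hx' (e : p = p')
    subst e
    simp only [Finset.coe_sigma, Set.mem_sigma_iff, Finset.mem_coe, Finset.HasAntidiagonal.mem_antidiagonal]
      at hx hx'
    rw [← hx.2, ← hx'.2]
  · rintro ⟨k, p⟩ hx
    simp only [Finset.coe_sigma, Set.mem_sigma_iff, Finset.mem_coe, Finset.HasAntidiagonal.mem_antidiagonal,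
      Finset.mem_range] at hx
    simp only [Finset.coe_product, Set.mem_prod, Finset.mem_coe, Finset.mem_range]
    omega
  · rintro ⟨i, j⟩ _ hn
    apply h
    by_contra hlt
    refine hn ⟨⟨i + j, (i, j)⟩, ?_, rfl⟩
    simp only [Finset.coe_sigma, Set.mem_sigma_iff, Finset.mem_coe, Finset.HasAntidiagonal.mem_antidiagonal,
      Finset.mem_range, and_true]
    omega
  · intro x _; rfl

theorem expNil_add {M N : Module.End ℂ V} (hM : IsLocNil M) (hN : IsLocNil N)
    (h : Commute M N) : expNil (M + N) = expNil M * expNil N := by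
  refine LinearMap.ext fun v => ?_
  obtain ⟨K₁, h₁⟩ := hM v
  obtain ⟨K₂, h₂⟩ := hN v
  obtain ⟨K₃, h₃⟩ := hM.add hN h v
  -- One truncation level serves all three exponentials: $i+j\ge K$ forces $i\ge K_1$ or $j\ge K_2$.
  set K := K₁ + K₂ + K₃
  have hz : ∀ i j, K ≤ i + j → dpow M i (dpow N j v) = 0 := by
    intro i j hij
    rcases (by omega : K₁ ≤ i ∨ K₂ ≤ j) with hi | hj
    · have : dpow M i (dpow N j v) = dpow N j (dpow M i v) :=
        LinearMap.congr_fun (commute_dpow (commute_dpow h.symm i).symm j) v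
      rw [this, dpow_apply_eq_zero h₁ hi, map_zero]
    · rw [dpow_apply_eq_zero h₂ hj, map_zero]
  rw [expNil_apply (hM.add hN h) (Module.End.pow_map_zero_of_le (show K₃ ≤ K by omega) h₃),
    Module.End.mul_apply, expNil_apply hN (Module.End.pow_map_zero_of_le (show K₂ ≤ K by omega) h₂),
    map_sum]
  have e : ∀ j, expNil M (dpow N j v) = ∑ i ∈ Finset.range K, dpow M i (dpow N j v) := by
    intro j
    refine expNil_apply hM ?_
    have : (M ^ K) (dpow N j v) = dpow N j ((M ^ K) v) :=
      LinearMap.congr_fun (commute_dpow (h.pow_left K) j) v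
    rw [this, Module.End.pow_map_zero_of_le (show K₁ ≤ K by omega) h₁, map_zero]
  simp_rw [e]
  rw [Finset.sum_comm, sum_range_sum_range_eq_sum_antidiagonal K _ hz]
  refine Finset.sum_congr rfl fun k _ => ?_
  rw [dpow_add h, LinearMap.sum_apply]
  rfl

theorem expNil_zero : expNil (0 : Module.End ℂ V) = 1 := by
  refine LinearMap.ext fun v => ?_
  rw [expNil_apply (K := 1) (fun v => ⟨1, by simp⟩) (by simp)]
  simp

theorem expNil_mul_neg {N : Module.End ℂ V} (hN : IsLocNil N) : expNil N * expNil (-N) = 1 := by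
  rw [← expNil_add hN hN.neg (Commute.refl N).neg_right, add_neg_cancel, expNil_zero]

theorem expNil_neg_mul {N : Module.End ℂ V} (hN : IsLocNil N) : expNil (-N) * expNil N = 1 := by
  rw [← expNil_add hN.neg hN (Commute.refl N).neg_left, neg_add_cancel, expNil_zero]

/-- If $K\ge2$ is minimal with $N^Kv=0$, then on $N^{K-2}v$ the exponential is $1+N$; being the
identity there, it gives $N^{K-1}v=0$, against minimality. -/
theorem eq_zero_of_expNil_eq_one {N : Module.End ℂ V} (hN : IsLocNil N) (h : expNil N = 1) :
    N = 0 := by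
  refine LinearMap.ext fun v => ?_
  by_contra hv
  classical
  have hex : ∃ K, (N ^ K) v = 0 := hN v
  set K := Nat.find hex
  have hK : (N ^ K) v = 0 := Nat.find_spec hex
  have hK2 : 2 ≤ K := by
    by_contra hlt
    apply hv
    have : (N ^ 1) v = 0 := Module.End.pow_map_zero_of_le (by omega) hK
    simpa using this
  obtain ⟨m, hm⟩ : ∃ m, K = m + 2 := ⟨K - 2, by omega⟩
  have h1 : (N ^ 2) ((N ^ m) v) = 0 := by
    rw [← Module.End.mul_apply, ← pow_add, add_comm, ← hm, hK]
  have h2 := expNil_apply hN h1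
  rw [h] at h2
  simp only [Module.End.one_apply, Finset.sum_range_succ, Finset.sum_range_zero,
    zero_add, dpow, Nat.factorial, pow_one] at h2
  have h3 : (N ^ (m + 1)) v = 0 := by
    rw [pow_succ', Module.End.mul_apply]
    simpa using h2
  exact Nat.find_min hex (show m + 1 < K by omega) h3

/-- Uniqueness of logarithms among commuting locally nilpotent operators; it is what identifies the
nilpotent logarithm of $gg_u$. -/
theorem eq_of_expNil_eq {M N : Module.End ℂ V} (hM : IsLocNil M) (hN : IsLocNil N)
    (h : Commute M N) (e : expNil M = expNil N) : M = N := by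
  have hc : Commute M (-N) := h.neg_right
  have : expNil (M + -N) = 1 := by
    rw [expNil_add hM hN.neg hc, e, expNil_mul_neg hN]
  exact add_neg_eq_zero.1 (eq_zero_of_expNil_eq_one (hM.add hN.neg hc) this)

/-- Leibniz rule for divided powers. -/
theorem dpow_leibniz {W X : Type*} [AddCommGroup W] [Module ℂ W] [AddCommGroup X] [Module ℂ X]
    (B : V →ₗ[ℂ] W →ₗ[ℂ] X) {S : Submodule ℂ V} {R : Submodule ℂ W} {D₁ : Module.End ℂ V}
    {D₂ : Module.End ℂ W}
    {D₃ : Module.End ℂ X} (hS : ∀ v ∈ S, D₁ v ∈ S) (hR : ∀ w ∈ R, D₂ w ∈ R)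
    (h : ∀ v ∈ S, ∀ w ∈ R, D₃ (B v w) = B (D₁ v) w + B v (D₂ w)) (k : ℕ)
    {v : V} (hv : v ∈ S) {w : W} (hw : w ∈ R) :
    dpow D₃ k (B v w) =
      ∑ i ∈ antidiagonal k, B (dpow D₁ i.1 v) (dpow D₂ i.2 w) := by
  have hS' : ∀ k, dpow D₁ k v ∈ S := fun k => S.smul_mem _ <| by
    induction k with
    | zero => simpa
    | succ k ih => rw [pow_succ']; exact hS _ ih
  have hR' : ∀ k, dpow D₂ k w ∈ R := fun k => R.smul_mem _ <| by
    induction k with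
    | zero => simpa
    | succ k ih => rw [pow_succ']; exact hR _ ih
  induction k with
  | zero => simp
  | succ k ih =>
    have hk : ((k : ℂ) + 1) ≠ 0 := Nat.cast_add_one_ne_zero k
    apply smul_right_injective X hk
    have e1 : ((k : ℂ) + 1) • dpow D₃ (k + 1) (B v w) = D₃ (dpow D₃ k (B v w)) := by
      rw [← LinearMap.smul_apply, succ_smul_dpow]; rfl
    have f1 : ∀ i, D₁ (dpow D₁ i v) = ((i : ℂ) + 1) • dpow D₁ (i + 1) v := fun i => by
      rw [← LinearMap.smul_apply, succ_smul_dpow]; rfl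
    have f2 : ∀ i, D₂ (dpow D₂ i w) = ((i : ℂ) + 1) • dpow D₂ (i + 1) w := fun i => by
      rw [← LinearMap.smul_apply, succ_smul_dpow]; rfl
    simp only [e1, ih, map_sum, h _ (hS' _) _ (hR' _), f1, f2, Finset.sum_add_distrib]
    -- On the antidiagonal of $k+1$ the factor $k+1$ is split as $i_1+i_2$; in each half the
    -- boundary term carries coefficient $0$, which allows the reindexing to the antidiagonal of
    -- $k$.
    have s1 : ∑ i ∈ antidiagonal (k + 1), ((i.1 : ℂ)) • B (dpow D₁ i.1 v) (dpow D₂ i.2 w) =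
        ∑ i ∈ antidiagonal k,
          B (((i.1 : ℂ) + 1) • dpow D₁ (i.1 + 1) v) (dpow D₂ i.2 w) := by
      rw [Finset.Nat.sum_antidiagonal_succ]; simp
    have s2 : ∑ i ∈ antidiagonal (k + 1), ((i.2 : ℂ)) • B (dpow D₁ i.1 v) (dpow D₂ i.2 w) =
        ∑ i ∈ antidiagonal k,
          B (dpow D₁ i.1 v) (((i.2 : ℂ) + 1) • dpow D₂ (i.2 + 1) w) := by
      rw [Finset.Nat.sum_antidiagonal_succ']; simp
    rw [← s1, ← s2, ← Finset.sum_add_distrib, Finset.smul_sum]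
    refine Finset.sum_congr rfl fun i hi => ?_
    rw [Finset.HasAntidiagonal.mem_antidiagonal] at hi
    rw [← add_smul]
    congr 1
    exact_mod_cast hi

end Operators

/-! ### Exponentials of formal power series with commuting coefficients -/

section ExpCoeff

variable {R : Type*} [Ring R]

theorem commute_of_commute_coeff {f g : PowerSeries R}
    (h : ∀ m n, Commute (PowerSeries.coeff m f) (PowerSeries.coeff n g)) : Commute f g := by
  ext n
  rw [PowerSeries.coeff_mul, PowerSeries.coeff_mul, ← Finset.Nat.sum_antidiagonal_swap]
  exact Finset.sum_congr rfl fun i _ => h _ _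

/-- A series without constant term is divisible by $X$, so its $k$-th power is divisible by $X^k$.
-/
theorem coeff_pow_eq_zero {D : PowerSeries R} (h0 : PowerSeries.coeff 0 D = 0) {r k : ℕ}
    (hk : r < k) : PowerSeries.coeff r (D ^ k) = 0 := by
  have : ∀ k r, r < k → PowerSeries.coeff r (D ^ k) = 0 := by
    intro k
    induction k with
    | zero => intro r h; omega
    | succ k ih =>
      intro r hr
      rw [pow_succ', PowerSeries.coeff_mul]
      refine Finset.sum_eq_zero fun i hi => ?_
      rw [Finset.HasAntidiagonal.mem_antidiagonal] at hi
      rcases Nat.eq_zero_or_pos i.1 with h1 | h1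
      · rw [h1, h0, zero_mul]
      · rw [ih i.2 (by omega), mul_zero]
  exact this k r hk

variable [Algebra ℂ R]

/-- The coefficient of `X ^ r` in `exp D`, for a power series `D` without constant term. -/
def expCoeff (D : PowerSeries R) (r : ℕ) : R :=
  ∑ k ∈ Finset.range (r + 1), ((k.factorial : ℂ)⁻¹) • PowerSeries.coeff r (D ^ k)

/-- The Euler operator `X d/dX`. -/
def eulerOp (f : PowerSeries R) : PowerSeries R :=
  PowerSeries.mk fun n => (n : ℂ) • PowerSeries.coeff n f

theorem eulerOp_mul (f g : PowerSeries R) :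
    eulerOp (f * g) = eulerOp f * g + f * eulerOp g := by
  ext n
  simp only [eulerOp, PowerSeries.coeff_mk, PowerSeries.coeff_mul, map_add, Finset.smul_sum,
    ← Finset.sum_add_distrib]
  refine Finset.sum_congr rfl fun i hi => ?_
  rw [Finset.HasAntidiagonal.mem_antidiagonal] at hi
  rw [smul_mul_assoc, mul_smul_comm, ← add_smul]
  congr 1
  exact_mod_cast hi.symm

/-- The power rule for a derivation; with noncommuting coefficients it needs $D$ to commute with its
own derivative. -/
theorem eulerOp_pow {D : PowerSeries R} (h : Commute D (eulerOp D)) (k : ℕ) :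
    eulerOp (D ^ (k + 1)) = ((k : ℂ) + 1) • (eulerOp D * D ^ k) := by
  induction k with
  | zero => simp
  | succ k ih =>
    rw [pow_succ', eulerOp_mul, ih, mul_smul_comm, ← mul_assoc, h.eq, mul_assoc,
      ← pow_succ']
    push_cast
    module

theorem expCoeff_eq_sum_range {D : PowerSeries R} (h0 : PowerSeries.coeff 0 D = 0) {r K : ℕ}
    (hK : r < K) :
    expCoeff D r = ∑ k ∈ Finset.range K, ((k.factorial : ℂ)⁻¹) • PowerSeries.coeff r (D ^ k) := by
  refine Finset.sum_subset (by simpa using hK) fun k _ hk => ?_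
  rw [coeff_pow_eq_zero h0 (by simpa using hk), smul_zero]

theorem expCoeff_zero (D : PowerSeries R) : expCoeff D 0 = 1 := by simp [expCoeff]

/-- The differential equation `X d/dX exp D = (X d/dX D) exp D`. -/
theorem smul_expCoeff {D : PowerSeries R} (h0 : PowerSeries.coeff 0 D = 0)
    (h : ∀ m n, Commute (PowerSeries.coeff m D) (PowerSeries.coeff n D)) (r : ℕ) :
    (r : ℂ) • expCoeff D r =
      ∑ i ∈ antidiagonal r, (i.1 : ℂ) • (PowerSeries.coeff i.1 D * expCoeff D i.2) := by
  have hc : Commute D (eulerOp D) := commute_of_commute_coeff fun m n => by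
    rw [eulerOp, PowerSeries.coeff_mk]; exact (h m n).smul_right _
  have h1 : ∀ k, (r : ℂ) • PowerSeries.coeff r (D ^ k) =
      PowerSeries.coeff r (eulerOp (D ^ k)) := fun k => by rw [eulerOp, PowerSeries.coeff_mk]
  rw [expCoeff_eq_sum_range h0 (show r < r + 1 + 1 by omega), Finset.sum_range_succ', smul_add,
    Finset.smul_sum]
  have h2 : (r : ℂ) • ((Nat.factorial 0 : ℂ)⁻¹ • PowerSeries.coeff r (D ^ 0)) = 0 := by
    rcases Nat.eq_zero_or_pos r with rfl | hr
    · simp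
    · simp [PowerSeries.coeff_one, hr.ne']
  have h3 : ∀ k ∈ Finset.range (r + 1),
      (r : ℂ) • (((k + 1).factorial : ℂ)⁻¹ • PowerSeries.coeff r (D ^ (k + 1))) =
      ∑ i ∈ antidiagonal r, (i.1 : ℂ) • (PowerSeries.coeff i.1 D *
        ((k.factorial : ℂ)⁻¹ • PowerSeries.coeff i.2 (D ^ k))) := by
    intro k _
    rw [smul_comm, h1, eulerOp_pow hc, PowerSeries.coeff_smul, smul_smul, PowerSeries.coeff_mul,
      Finset.smul_sum]
    refine Finset.sum_congr rfl fun i _ => ?_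
    have e : (((k + 1).factorial : ℂ)⁻¹ * ((k : ℂ) + 1)) = (k.factorial : ℂ)⁻¹ := by
      have := Nat.cast_ne_zero (R := ℂ).2 k.factorial_ne_zero
      have h2 : (k : ℂ) + 1 ≠ 0 := Nat.cast_add_one_ne_zero k
      rw [Nat.factorial_succ]; push_cast; field_simp
    rw [e, eulerOp, PowerSeries.coeff_mk, mul_smul_comm, smul_mul_assoc, smul_comm]
  rw [h2, add_zero, Finset.sum_congr rfl h3, Finset.sum_comm]
  refine Finset.sum_congr rfl fun i hi => ?_
  rw [Finset.HasAntidiagonal.mem_antidiagonal] at hi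
  rw [expCoeff_eq_sum_range h0 (show i.2 < r + 1 by omega), Finset.mul_sum, Finset.smul_sum]

end ExpCoeff

/-! ### The logarithm of a locally unipotent operator. -/

section Log

variable {V : Type*} [AddCommGroup V] [Module ℂ V]

/-- The power series `log (1 + X)`. -/
def logSeries : PowerSeries ℂ :=
  PowerSeries.mk fun n => if n = 0 then 0 else -((-1 : ℂ) ^ n / n)

theorem coeff_logSeries_succ (n : ℕ) :
    PowerSeries.coeff (n + 1) logSeries = (-1 : ℂ) ^ n / (n + 1) := by
  rw [logSeries, PowerSeries.coeff_mk, if_neg (by omega), pow_succ]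
  push_cast; ring

/-- `exp (log (1 + X)) = 1 + X`. -/
theorem expCoeff_logSeries (r : ℕ) : expCoeff logSeries r = if r ≤ 1 then 1 else 0 := by
  have h0 : PowerSeries.coeff 0 logSeries = 0 := by simp [logSeries]
  have hm : ∀ m : ℕ, (m : ℂ) * PowerSeries.coeff m logSeries = if m = 0 then 0 else
      -(-1 : ℂ) ^ m := by
    intro m
    rw [logSeries, PowerSeries.coeff_mk]
    split_ifs with h
    · simp
    · have : (m : ℂ) ≠ 0 := Nat.cast_ne_zero.2 h
      field_simp
  induction r using Nat.strong_induction_on with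
  | _ r ih =>
    have hrec := smul_expCoeff h0 (fun m n => mul_comm _ _) r
    simp only [smul_eq_mul, ← mul_assoc, hm] at hrec
    match r, ih, hrec with
    | 0, _, _ => simp [expCoeff_zero]
    | 1, _, hrec =>
      rw [Finset.Nat.sum_antidiagonal_succ] at hrec
      simpa [expCoeff_zero] using hrec
    -- In the recursion for index $r+2$ the induction hypothesis leaves only the terms with $E_0$
    -- and $E_1$, whose coefficients have opposite signs.
    | r + 2, ih, hrec =>
      rw [← Finset.Nat.sum_antidiagonal_swap, Finset.Nat.sum_antidiagonal_eq_sum_range_succ_mk,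
        Finset.sum_range_succ', Finset.sum_range_succ', Finset.sum_eq_zero] at hrec
      · rw [if_neg (by omega)]
        have h2 : ((r : ℂ) + 2) ≠ 0 := by exact_mod_cast (by omega : r + 2 ≠ 0)
        simpa [expCoeff_zero, ih 1 (by omega), pow_succ, h2] using hrec
      · intro i hi
        have hi := Finset.mem_range.1 hi
        rcases (by omega : i < r ∨ i = r) with h | h
        · simp [ih (i + 1 + 1) (by omega)]
        · simp [h]

/-- Evaluation of a power series at a locally nilpotent operator. -/
def evalNil (M : Module.End ℂ V) (f : PowerSeries ℂ) : Module.End ℂ V :=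
  locSum fun j : ℕ => PowerSeries.coeff j f • M ^ j

theorem evalNil_apply {M : Module.End ℂ V} (hM : IsLocNil M) (f : PowerSeries ℂ) {v : V} {K : ℕ}
    (hK : (M ^ K) v = 0) :
    evalNil M f v = ∑ j ∈ Finset.range K, PowerSeries.coeff j f • (M ^ j) v :=
  locSum_apply_eq_sum (hM.finite_support_smul_pow _ id fun _ => le_rfl) v _ fun j hj => by
    rw [LinearMap.smul_apply, Module.End.pow_map_zero_of_le (by simpa using hj) hK, smul_zero]

theorem commute_evalNil {X M : Module.End ℂ V} (hM : IsLocNil M) (h : Commute X M)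
    (f : PowerSeries ℂ) : Commute X (evalNil M f) :=
  commute_locSum (hM.finite_support_smul_pow _ id fun _ => le_rfl) fun k =>
    (h.pow_right k).smul_right _

/-- Multiplicativity of the evaluation is what carries identities of formal series over to locally
nilpotent operators. -/
theorem evalNil_mul {M : Module.End ℂ V} (hM : IsLocNil M) (f g : PowerSeries ℂ) :
    evalNil M (f * g) = evalNil M f * evalNil M g := by
  refine LinearMap.ext fun v => ?_
  obtain ⟨K, hK⟩ := hM v
  rw [Module.End.mul_apply, evalNil_apply hM g hK, evalNil_apply hM _ hK, map_sum]
  have e : ∀ j, evalNil M f (PowerSeries.coeff j g • (M ^ j) v) =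
      ∑ i ∈ Finset.range K,
        (PowerSeries.coeff i f * PowerSeries.coeff j g) • (M ^ (i + j)) v := by
    intro j
    have h1 : (M ^ K) ((M ^ j) v) = 0 := by
      rw [← Module.End.mul_apply, ← pow_add]
      exact Module.End.pow_map_zero_of_le (by omega) hK
    rw [map_smul, evalNil_apply hM f h1, Finset.smul_sum]
    refine Finset.sum_congr rfl fun i _ => ?_
    rw [← Module.End.mul_apply, ← pow_add, smul_smul, mul_comm]
  simp_rw [e]
  rw [Finset.sum_comm, sum_range_sum_range_eq_sum_antidiagonal K
    (fun i j => (PowerSeries.coeff i f * PowerSeries.coeff j g) • (M ^ (i + j)) v)]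
  · refine Finset.sum_congr rfl fun k _ => ?_
    rw [PowerSeries.coeff_mul, Finset.sum_smul]
    refine Finset.sum_congr rfl fun p hp => ?_
    rw [Finset.HasAntidiagonal.mem_antidiagonal.1 hp]
  · intro i j hij
    rw [Module.End.pow_map_zero_of_le hij hK, smul_zero]

theorem evalNil_one {M : Module.End ℂ V} (hM : IsLocNil M) : evalNil M 1 = 1 := by
  refine LinearMap.ext fun v => ?_
  obtain ⟨K, hK⟩ := hM v
  rw [evalNil_apply hM 1 (Module.End.pow_map_zero_of_le (Nat.le_succ K) hK),
    Finset.sum_range_succ']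
  simp [PowerSeries.coeff_one]

theorem evalNil_pow {M : Module.End ℂ V} (hM : IsLocNil M) (f : PowerSeries ℂ) (k : ℕ) :
    evalNil M (f ^ k) = evalNil M f ^ k := by
  induction k with
  | zero => rw [pow_zero, pow_zero, evalNil_one hM]
  | succ k ih => rw [pow_succ, pow_succ, evalNil_mul hM, ih]

theorem evalNil_logSeries_pow_apply_eq_zero {M : Module.End ℂ V} (hM : IsLocNil M) {v : V} {K : ℕ}
    (hK : (M ^ K) v = 0) : (evalNil M logSeries ^ K) v = 0 := by
  have h0 : PowerSeries.coeff 0 logSeries = 0 := by simp [logSeries]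
  rw [← evalNil_pow hM, evalNil_apply hM _ hK]
  refine Finset.sum_eq_zero fun j hj => ?_
  rw [coeff_pow_eq_zero h0 (by simpa using hj), zero_smul]

theorem isLocNil_evalNil_logSeries {M : Module.End ℂ V} (hM : IsLocNil M) :
    IsLocNil (evalNil M logSeries) := fun v => by
  obtain ⟨K, hK⟩ := hM v
  exact ⟨K, evalNil_logSeries_pow_apply_eq_zero hM hK⟩

/-- Powers of the logarithm are evaluations of powers of the series, so the coefficient identity
$\exp(\log(1+X))=1+X$ transfers once all sums are cut at a common level. -/
theorem expNil_evalNil_logSeries {M : Module.End ℂ V} (hM : IsLocNil M) :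
    expNil (evalNil M logSeries) = 1 + M := by
  have h0 : PowerSeries.coeff 0 logSeries = 0 := by simp [logSeries]
  refine LinearMap.ext fun v => ?_
  obtain ⟨K', hK'⟩ := hM v
  -- The summand $2$ ensures that the indices $0$ and $1$ of $1+M$ lie in the truncated range even
  -- when $v=0$.
  set K := K' + 2
  have hK : (M ^ K) v = 0 := Module.End.pow_map_zero_of_le (by omega) hK'
  rw [expNil_apply (isLocNil_evalNil_logSeries hM) (evalNil_logSeries_pow_apply_eq_zero hM hK)]
  have e : ∀ k, dpow (evalNil M logSeries) k v = ∑ j ∈ Finset.range K,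
      ((k.factorial : ℂ)⁻¹ • PowerSeries.coeff j (logSeries ^ k)) • (M ^ j) v := by
    intro k
    rw [dpow, ← evalNil_pow hM, LinearMap.smul_apply, evalNil_apply hM _ hK, Finset.smul_sum]
    simp_rw [smul_assoc]
  simp_rw [e]
  rw [Finset.sum_comm]
  simp_rw [← Finset.sum_smul]
  have e2 : ∀ j ∈ Finset.range K, (∑ k ∈ Finset.range K,
      (k.factorial : ℂ)⁻¹ • PowerSeries.coeff j (logSeries ^ k)) • (M ^ j) v =
      (if j ≤ 1 then (1 : ℂ) else 0) • (M ^ j) v := by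
    intro j hj
    rw [← expCoeff_eq_sum_range h0 (by simpa using hj), expCoeff_logSeries]
  rw [Finset.sum_congr rfl e2, Finset.sum_range_succ', Finset.sum_range_succ', Finset.sum_eq_zero]
  · simp [add_comm]
  · intro i _; simp

theorem evalNil_logSeries_eq {M : Module.End ℂ V} (hM : IsLocNil M) :
    evalNil M logSeries = locSum fun j : ℕ => ((-1 : ℂ) ^ j / (j + 1)) • M ^ (j + 1) := by
  refine LinearMap.ext fun v => ?_
  obtain ⟨K, hK⟩ := hM v
  rw [evalNil_apply hM _ (Module.End.pow_map_zero_of_le (Nat.le_succ K) hK),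
    locSum_apply_eq_sum (hM.finite_support_smul_pow _ (· + 1) fun _ => by omega) v
      (Finset.range K), Finset.sum_range_succ']
  · simp only [coeff_logSeries_succ]
    simp [logSeries]
  · intro j hj
    rw [LinearMap.smul_apply, Module.End.pow_map_zero_of_le (by simp at hj; omega) hK, smul_zero]

end Log

/-! ### Functional calculus on generalized eigenspaces. -/

section Spectral

variable {V : Type*} [AddCommGroup V] [Module ℂ V] {T : Module.End ℂ V}

theorem spectralMap_apply_of_mem (hT : IsSumOfGenEigenspaces T) (φ : ℂ → ℂ) {c : ℂ} {v : V}
    (hv : v ∈ T.maxGenEigenspace c) : spectralMap T φ v = φ c • v := by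
  classical
  have h : Function.Bijective (DirectSum.coeLinearMap fun c : ℂ => T.maxGenEigenspace c) := hT
  rw [spectralMap, dif_pos h, LinearMap.comp_apply, LinearEquiv.coe_coe]
  have e : (LinearEquiv.ofBijective
      (DirectSum.coeLinearMap fun c : ℂ => T.maxGenEigenspace c) h).symm v =
      DirectSum.lof ℂ ℂ (fun c => T.maxGenEigenspace c) c ⟨v, hv⟩ := by
    rw [LinearEquiv.symm_apply_eq, LinearEquiv.ofBijective_apply, DirectSum.coeLinearMap_lof]
  rw [e, DirectSum.toModule_lof]
  rfl

theorem IsSumOfGenEigenspaces.induction (hT : IsSumOfGenEigenspaces T) {p : V → Prop}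
    (gen : ∀ c, ∀ v ∈ T.maxGenEigenspace c, p v) (add : ∀ v w, p v → p w → p (v + w)) (v : V) :
    p v := by
  have hv : v ∈ ⨆ c, T.maxGenEigenspace c := by
    rw [hT.submodule_iSup_eq_top]; trivial
  exact Submodule.iSup_induction _ (motive := p) hv gen (gen 0 0 (Submodule.zero_mem _)) add

theorem IsSumOfGenEigenspaces.ext (hT : IsSumOfGenEigenspaces T) {X : Type*} [AddCommGroup X]
    [Module ℂ X] {f g : V →ₗ[ℂ] X} (h : ∀ c, ∀ v ∈ T.maxGenEigenspace c, f v = g v) : f = g :=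
  LinearMap.ext fun v => hT.induction (p := fun v => f v = g v) h
    (fun v w hv hw => by rw [map_add, map_add, hv, hw]) v

theorem mem_maxGenEigenspace_of_commute {X : Module.End ℂ V} (h : Commute X T) {c : ℂ} {v : V}
    (hv : v ∈ T.maxGenEigenspace c) : X v ∈ T.maxGenEigenspace c :=
  Module.End.mapsTo_maxGenEigenspace_of_comm h.symm c hv

theorem commute_spectralMap (hT : IsSumOfGenEigenspaces T) {X : Module.End ℂ V}
    (h : Commute X T) (φ : ℂ → ℂ) : Commute X (spectralMap T φ) :=
  hT.ext fun c v hv => by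
    rw [Module.End.mul_apply, Module.End.mul_apply, spectralMap_apply_of_mem hT φ hv,
      spectralMap_apply_of_mem hT φ (mem_maxGenEigenspace_of_commute h hv), map_smul]

theorem eigenProj_apply_self (hT : IsSumOfGenEigenspaces T) {c : ℂ} {v : V}
    (hv : v ∈ T.maxGenEigenspace c) : eigenProj T c v = v := by
  rw [eigenProj, spectralMap_apply_of_mem hT _ hv, if_pos rfl, one_smul]

theorem eigenProj_apply_of_ne (hT : IsSumOfGenEigenspaces T) {c d : ℂ} {v : V}
    (hv : v ∈ T.maxGenEigenspace c) (h : c ≠ d) : eigenProj T d v = 0 := by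
  rw [eigenProj, spectralMap_apply_of_mem hT _ hv, if_neg h, zero_smul]

theorem eigenProj_mem (hT : IsSumOfGenEigenspaces T) (c : ℂ) (v : V) :
    eigenProj T c v ∈ T.maxGenEigenspace c := by
  refine hT.induction (p := fun v => eigenProj T c v ∈ T.maxGenEigenspace c) (fun d v hv => ?_)
    (fun v w hv hw => by rw [map_add]; exact Submodule.add_mem _ hv hw) v
  by_cases h : d = c
  · subst h; rwa [eigenProj_apply_self hT hv]
  · rw [eigenProj_apply_of_ne hT hv h]; exact Submodule.zero_mem _

theorem commute_eigenProj (hT : IsSumOfGenEigenspaces T) {X : Module.End ℂ V}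
    (h : Commute X T) (c : ℂ) : Commute X (eigenProj T c) := commute_spectralMap hT h _

theorem finite_support_eigenProj (hT : IsSumOfGenEigenspaces T) (v : V) :
    (Function.support fun c => eigenProj T c v).Finite := by
  refine hT.induction (p := fun v => (Function.support fun c => eigenProj T c v).Finite)
    (fun d v hv => ?_) (fun v w hv hw => ?_) v
  · refine (Set.finite_singleton d).subset fun c hc => ?_
    by_contra hn
    exact hc (eigenProj_apply_of_ne hT hv fun e => hn e.symm)
  · refine (hv.union hw).subset fun c hc => ?_
    by_contra hn
    simp only [Set.mem_union, Function.mem_support, not_or, not_not] at hn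
    exact hc (by simp [hn.1, hn.2])

theorem sum_eigenProj (hT : IsSumOfGenEigenspaces T) (v : V) :
    locSum (eigenProj T) v = v := by
  have : locSum (eigenProj T) = LinearMap.id := hT.ext fun c v hv => by
    rw [locSum_apply_eq_sum (finite_support_eigenProj hT) v {c}, Finset.sum_singleton,
      eigenProj_apply_self hT hv, LinearMap.id_apply]
    intro d hd
    exact eigenProj_apply_of_ne hT hv fun e => hd (by simp [e])
  rw [this, LinearMap.id_apply]

/-- Induction inside a submodule that is stable under the spectral projections. -/
theorem IsSumOfGenEigenspaces.induction_of_stable (hT : IsSumOfGenEigenspaces T)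
    {q : Submodule ℂ V} (hq : ∀ c, ∀ v ∈ q, eigenProj T c v ∈ q) {p : V → Prop}
    (gen : ∀ c, ∀ v ∈ q, v ∈ T.maxGenEigenspace c → p v) (add : ∀ v w, p v → p w → p (v + w))
    {v : V} (hv : v ∈ q) : p v := by
  have h0 : p 0 := gen 0 0 (Submodule.zero_mem _) (Submodule.zero_mem _)
  have h := sum_eigenProj hT v
  rw [locSum_apply_eq_sum (finite_support_eigenProj hT) v
    (finite_support_eigenProj hT v).toFinset (fun i hi => by simpa using hi)] at h
  rw [← h]
  exact Finset.sum_induction _ p add h0 fun c _ => gen c _ (hq c v hv) (eigenProj_mem hT c v)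

theorem nilPart_apply_of_mem (hT : IsSumOfGenEigenspaces T) {c : ℂ} {v : V}
    (hv : v ∈ T.maxGenEigenspace c) : nilPart T v = T v - c • v := by
  rw [nilPart, LinearMap.sub_apply, semisimplePart, spectralMap_apply_of_mem hT _ hv, id]

theorem commute_nilPart (hT : IsSumOfGenEigenspaces T) {X : Module.End ℂ V} (h : Commute X T) :
    Commute X (nilPart T) := h.sub_right (commute_spectralMap hT h _)

theorem nilPart_mem (hT : IsSumOfGenEigenspaces T) {c : ℂ} {v : V}
    (hv : v ∈ T.maxGenEigenspace c) : nilPart T v ∈ T.maxGenEigenspace c :=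
  mem_maxGenEigenspace_of_commute (commute_nilPart hT (Commute.refl T)).symm hv

theorem nilPart_pow_apply_of_mem (hT : IsSumOfGenEigenspaces T) {c : ℂ} {v : V}
    (hv : v ∈ T.maxGenEigenspace c) (k : ℕ) :
    (nilPart T ^ k) v = ((T - c • (1 : Module.End ℂ V)) ^ k) v := by
  have h : ∀ k, ((T - c • (1 : Module.End ℂ V)) ^ k) v ∈ T.maxGenEigenspace c := fun k =>
    mem_maxGenEigenspace_of_commute
      (((Commute.refl T).sub_left ((Commute.one_left T).smul_left c)).pow_left k) hv
  induction k with
  | zero => simp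
  | succ k ih =>
    rw [pow_succ', Module.End.mul_apply, ih, nilPart_apply_of_mem hT (h k), pow_succ',
      Module.End.mul_apply]
    simp

theorem isLocNil_nilPart (hT : IsSumOfGenEigenspaces T) : IsLocNil (nilPart T) := fun v => by
  refine hT.induction (p := fun v => ∃ K : ℕ, (nilPart T ^ K) v = 0) (fun c v hv => ?_) ?_ v
  · obtain ⟨k, hk⟩ := (Module.End.mem_maxGenEigenspace _ _ _).1 hv
    exact ⟨k, by rw [nilPart_pow_apply_of_mem hT hv, hk]⟩
  · rintro v w ⟨k, hk⟩ ⟨l, hl⟩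
    exact ⟨k + l, by rw [map_add, Module.End.pow_map_zero_of_le (by omega) hk,
      Module.End.pow_map_zero_of_le (by omega) hl, add_zero]⟩

theorem maxGenEigenspace_smul (T : Module.End ℂ V) {z : ℂ} (hz : z ≠ 0) (c : ℂ) :
    (z • T).maxGenEigenspace (z * c) = T.maxGenEigenspace c := by
  apply le_antisymm
  · have := Module.End.genEigenspace_le_smul (z • T) (z * c) z⁻¹ ⊤
    rwa [smul_smul, inv_mul_cancel₀ hz, one_smul, ← mul_assoc, inv_mul_cancel₀ hz, one_mul] at this
  · exact Module.End.genEigenspace_le_smul T c z ⊤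

theorem isSumOfGenEigenspaces_of_iSup (h : ⨆ c, T.maxGenEigenspace c = ⊤) :
    IsSumOfGenEigenspaces T :=
  DirectSum.isInternal_submodule_of_iSupIndep_of_iSup_eq_top
    (Module.End.independent_maxGenEigenspace T) h

theorem IsSumOfGenEigenspaces.smul (hT : IsSumOfGenEigenspaces T) {z : ℂ} (hz : z ≠ 0) :
    IsSumOfGenEigenspaces (z • T) := by
  apply isSumOfGenEigenspaces_of_iSup
  rw [eq_top_iff, ← hT.submodule_iSup_eq_top]
  refine iSup_le fun c => ?_
  rw [← maxGenEigenspace_smul T hz c]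
  exact le_iSup (fun c => (z • T).maxGenEigenspace c) (z * c)

theorem nilPart_smul (hT : IsSumOfGenEigenspaces T) {z : ℂ} (hz : z ≠ 0) :
    nilPart (z • T) = z • nilPart T :=
  hT.ext fun c v hv => by
    have hv' : v ∈ (z • T).maxGenEigenspace (z * c) := by rwa [maxGenEigenspace_smul T hz]
    rw [nilPart_apply_of_mem (hT.smul hz) hv', LinearMap.smul_apply, LinearMap.smul_apply,
      nilPart_apply_of_mem hT hv, smul_sub, mul_smul]

theorem dpow_smul (N : Module.End ℂ V) (z : ℂ) (k : ℕ) : dpow (z • N) k = z ^ k • dpow N k := by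
  rw [dpow, dpow, smul_pow, smul_comm]

theorem powCoeff_apply (hT : IsSumOfGenEigenspaces T) {c : ℂ} {v : V}
    (hv : v ∈ T.maxGenEigenspace c) (s : ℂ) (t : ℕ) :
    powCoeff T s t v = if s = c then dpow (nilPart T) t v else 0 := by
  rw [powCoeff, LinearMap.smul_apply, Module.End.mul_apply]
  split_ifs with h
  · subst h; rw [eigenProj_apply_self hT hv, dpow, LinearMap.smul_apply]
  · rw [eigenProj_apply_of_ne hT hv (Ne.symm h), map_zero, smul_zero]

theorem powCoeff_neg_apply (hT : IsSumOfGenEigenspaces T) {c : ℂ} {v : V}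
    (hv : v ∈ T.maxGenEigenspace c) (s : ℂ) (t : ℕ) :
    powCoeff (-T) s t v = if s = -c then dpow (-nilPart T) t v else 0 := by
  have h1 : (-1 : ℂ) ≠ 0 := by simp
  have hv' : v ∈ ((-1 : ℂ) • T).maxGenEigenspace (-1 * c) := by rwa [maxGenEigenspace_smul T h1]
  have := powCoeff_apply (hT.smul h1) hv' s t
  rw [nilPart_smul hT h1] at this
  simpa using this

theorem expOp_smul_apply (hT : IsSumOfGenEigenspaces T) {z : ℂ} (hz : z ≠ 0) {c : ℂ} {v : V}
    (hv : v ∈ T.maxGenEigenspace c) :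
    expOp (z • T) v = Complex.exp (z * c) • expNil (z • nilPart T) v := by
  have hv' : v ∈ (z • T).maxGenEigenspace (z * c) := by rwa [maxGenEigenspace_smul T hz]
  have h1 : expNil (z • nilPart T) v ∈ (z • T).maxGenEigenspace (z * c) :=
    mem_maxGenEigenspace_of_commute (commute_expNil ((isLocNil_nilPart hT).smul z)
      (((commute_nilPart hT (Commute.refl T)).smul_right z).smul_left z)).symm hv'
  rw [← spectralMap_apply_of_mem (hT.smul hz) _ h1, ← nilPart_smul hT hz]
  rfl

theorem commute_expOp_smul (hT : IsSumOfGenEigenspaces T) {z : ℂ} (hz : z ≠ 0)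
    {X : Module.End ℂ V} (h : Commute X T) : Commute X (expOp (z • T)) := by
  have e : expOp (z • T) = spectralMap (z • T) Complex.exp * expNil (nilPart (z • T)) := rfl
  rw [e]
  exact (commute_spectralMap (hT.smul hz) (h.smul_right z) _).mul_right
    (commute_expNil (isLocNil_nilPart (hT.smul hz)) (commute_nilPart (hT.smul hz) (h.smul_right z)))

theorem expOp_smul_mem (hT : IsSumOfGenEigenspaces T) {z : ℂ} (hz : z ≠ 0) {c : ℂ} {v : V}
    (hv : v ∈ T.maxGenEigenspace c) : expOp (z • T) v ∈ T.maxGenEigenspace c :=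
  mem_maxGenEigenspace_of_commute (commute_expOp_smul hT hz (Commute.refl T)).symm hv

theorem bijective_expOp_smul (hT : IsSumOfGenEigenspaces T) {z : ℂ} (hz : z ≠ 0) :
    Function.Bijective (expOp (z • T)) := by
  have key : ∀ z : ℂ, z ≠ 0 → expOp (-z • T) * expOp (z • T) = 1 := fun z hz => by
    refine hT.ext fun c v hv => ?_
    have h1 := expOp_smul_mem hT hz hv
    have h2 := expNil_neg_mul ((isLocNil_nilPart hT).smul z)
    rw [Module.End.mul_apply, expOp_smul_apply hT (neg_ne_zero.2 hz) h1,
      expOp_smul_apply hT hz hv, map_smul, smul_smul, ← Complex.exp_add, neg_smul,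
      ← Module.End.mul_apply, h2]
    simp
  have k1 := key z hz
  have k2 := key (-z) (neg_ne_zero.2 hz)
  rw [neg_neg] at k2
  exact ⟨Function.LeftInverse.injective (g := expOp (-z • T)) (LinearMap.congr_fun k1),
    Function.RightInverse.surjective (g := expOp (-z • T)) (LinearMap.congr_fun k2)⟩

/-! ### Bilinear maps intertwining locally finite operators -/

section Bilinear

variable {W X : Type*} [AddCommGroup W] [Module ℂ W] [AddCommGroup X] [Module ℂ X]
  {B : V →ₗ[ℂ] W →ₗ[ℂ] X} {T₁ : Module.End ℂ V} {T₂ : Module.End ℂ W} {T₃ : Module.End ℂ X}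

/-- The shifted operators $T_1-a$, $T_2-b$, $T_3-(a+b)$ obey the same Leibniz rule, and in its
$(k+l)$-th divided power every term contains a vanishing factor. -/
theorem apply_apply_mem_maxGenEigenspace
    (h : ∀ v w, T₃ (B v w) = B (T₁ v) w + B v (T₂ w)) {a b : ℂ} {v : V} {w : W}
    (hv : v ∈ T₁.maxGenEigenspace a) (hw : w ∈ T₂.maxGenEigenspace b) :
    B v w ∈ T₃.maxGenEigenspace (a + b) := by
  obtain ⟨k, hk⟩ := (Module.End.mem_maxGenEigenspace _ _ _).1 hv
  obtain ⟨l, hl⟩ := (Module.End.mem_maxGenEigenspace _ _ _).1 hw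
  refine (Module.End.mem_maxGenEigenspace _ _ _).2 ⟨k + l, ?_⟩
  have := dpow_leibniz B (S := ⊤) (R := ⊤) (D₁ := T₁ - a • 1) (D₂ := T₂ - b • 1)
    (D₃ := T₃ - (a + b) • 1) (by simp) (by simp) (fun v _ w _ => by
      simp [h, add_smul]; abel) (k + l) (v := v) (by simp) (w := w) (by simp)
  rw [Finset.sum_eq_zero] at this
  · rw [dpow, LinearMap.smul_apply, smul_eq_zero_iff_right] at this
    · exact this
    · exact inv_ne_zero (Nat.cast_ne_zero.2 (Nat.factorial_ne_zero _))
  · intro i hi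
    rw [Finset.HasAntidiagonal.mem_antidiagonal] at hi
    rcases (by omega : k ≤ i.1 ∨ l ≤ i.2) with h1 | h1
    · rw [dpow_apply_eq_zero hk h1, map_zero, LinearMap.zero_apply]
    · rw [dpow_apply_eq_zero hl h1, map_zero]

/-- Eigenvalues add under $B$, so the semisimple parts satisfy the Leibniz rule too; the nilpotent
parts inherit it by subtraction. -/
theorem nilPart_apply_apply (h₁ : IsSumOfGenEigenspaces T₁) (h₂ : IsSumOfGenEigenspaces T₂)
    (h₃ : IsSumOfGenEigenspaces T₃)
    (h : ∀ v w, T₃ (B v w) = B (T₁ v) w + B v (T₂ w)) (v : V) (w : W) :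
    nilPart T₃ (B v w) = B (nilPart T₁ v) w + B v (nilPart T₂ w) := by
  refine h₁.induction (p := fun v => nilPart T₃ (B v w) = B (nilPart T₁ v) w + B v (nilPart T₂ w))
    (fun a v hv => ?_) (fun v v' e e' => ?_) v
  · refine h₂.induction (p := fun w => nilPart T₃ (B v w) =
      B (nilPart T₁ v) w + B v (nilPart T₂ w)) (fun b w hw => ?_) (fun w w' e e' => ?_) w
    · rw [nilPart_apply_of_mem h₃ (apply_apply_mem_maxGenEigenspace h hv hw),
        nilPart_apply_of_mem h₁ hv, nilPart_apply_of_mem h₂ hw, h]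
      simp [add_smul]; abel
    · simp only [map_add, e, e']; abel
  · simp only [map_add, LinearMap.add_apply, e, e']; abel

theorem dpow_nilPart_apply_apply (h₁ : IsSumOfGenEigenspaces T₁) (h₂ : IsSumOfGenEigenspaces T₂)
    (h₃ : IsSumOfGenEigenspaces T₃)
    (h : ∀ v w, T₃ (B v w) = B (T₁ v) w + B v (T₂ w)) (z : ℂ) (k : ℕ) (v : V) (w : W) :
    dpow (z • nilPart T₃) k (B v w) = ∑ i ∈ antidiagonal k,
      B (dpow (z • nilPart T₁) i.1 v) (dpow (z • nilPart T₂) i.2 w) :=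
  dpow_leibniz B (S := ⊤) (R := ⊤) (by simp) (by simp)
    (fun v _ w _ => by simp [nilPart_apply_apply h₁ h₂ h₃ h]) k (by simp) (by simp)

theorem expNil_nilPart_apply_apply (h₁ : IsSumOfGenEigenspaces T₁)
    (h₂ : IsSumOfGenEigenspaces T₂) (h₃ : IsSumOfGenEigenspaces T₃)
    (h : ∀ v w, T₃ (B v w) = B (T₁ v) w + B v (T₂ w)) (z : ℂ) (v : V) (w : W) :
    expNil (z • nilPart T₃) (B v w) =
      B (expNil (z • nilPart T₁) v) (expNil (z • nilPart T₂) w) := by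
  have n₁ := (isLocNil_nilPart h₁).smul z
  have n₂ := (isLocNil_nilPart h₂).smul z
  have n₃ := (isLocNil_nilPart h₃).smul z
  obtain ⟨k₁, e₁⟩ := n₁ v
  obtain ⟨k₂, e₂⟩ := n₂ w
  obtain ⟨k₃, e₃⟩ := n₃ (B v w)
  set K := k₁ + k₂ + k₃
  rw [expNil_apply n₁ (Module.End.pow_map_zero_of_le (show k₁ ≤ K by omega) e₁),
    expNil_apply n₂ (Module.End.pow_map_zero_of_le (show k₂ ≤ K by omega) e₂),
    expNil_apply n₃ (Module.End.pow_map_zero_of_le (show k₃ ≤ K by omega) e₃)]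
  simp only [map_sum, LinearMap.sum_apply]
  simp_rw [dpow_nilPart_apply_apply h₁ h₂ h₃ h]
  rw [← sum_range_sum_range_eq_sum_antidiagonal K
    (fun i j => B (dpow (z • nilPart T₁) i v) (dpow (z • nilPart T₂) j w)), Finset.sum_comm]
  intro i j hij
  rcases (by omega : k₁ ≤ i ∨ k₂ ≤ j) with h1 | h1
  · rw [dpow_apply_eq_zero e₁ h1, map_zero, LinearMap.zero_apply]
  · rw [dpow_apply_eq_zero e₂ h1, map_zero]

/-- The exponential of a derivation is multiplicative: on generalized eigenvectors the scalar
factors $e^{za}$, $e^{zb}$ multiply, and so do the nilpotent exponentials. With one bilinear map per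
mode this covers both $g_u$ on $V$ and its action on $W$. -/
theorem expOp_smul_apply_apply (h₁ : IsSumOfGenEigenspaces T₁)
    (h₂ : IsSumOfGenEigenspaces T₂) (h₃ : IsSumOfGenEigenspaces T₃)
    (h : ∀ v w, T₃ (B v w) = B (T₁ v) w + B v (T₂ w)) {z : ℂ} (hz : z ≠ 0) (v : V) (w : W) :
    expOp (z • T₃) (B v w) = B (expOp (z • T₁) v) (expOp (z • T₂) w) := by
  refine h₁.induction (p := fun v => expOp (z • T₃) (B v w) =
    B (expOp (z • T₁) v) (expOp (z • T₂) w)) (fun a v hv => ?_) (fun v v' e e' => ?_) v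
  · refine h₂.induction (p := fun w => expOp (z • T₃) (B v w) =
      B (expOp (z • T₁) v) (expOp (z • T₂) w)) (fun b w hw => ?_) (fun w w' e e' => ?_) w
    · rw [expOp_smul_apply h₃ hz (apply_apply_mem_maxGenEigenspace h hv hw),
        expOp_smul_apply h₁ hz hv, expOp_smul_apply h₂ hz hw,
        expNil_nilPart_apply_apply h₁ h₂ h₃ h]
      simp only [map_smul, LinearMap.smul_apply, smul_smul]
      rw [← Complex.exp_add]
      congr 2
      ring
    · simp only [map_add, e, e']
  · simp only [map_add, LinearMap.add_apply, e, e']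

end Bilinear

end Spectral

/-- Split $x\in R_i$ as $a+y$ with $a\in S_i$ and $y$ in the sum of the other $S_j$; then $y=x-a$
lies in $R_i$ and in the sum of the other $R_j$, so $y=0$. This turns an inclusion of graded pieces
into eigenspaces into an equality. -/
theorem le_of_iSupIndep_of_iSup_eq_top {ι V : Type*} [AddCommGroup V] [Module ℂ V]
    {S R : ι → Submodule ℂ V} (hle : ∀ i, S i ≤ R i) (hR : iSupIndep R) (hS : ⨆ i, S i = ⊤) (i : ι) :
    R i ≤ S i := by
  intro x hx
  have hx' : x ∈ S i ⊔ ⨆ j, ⨆ _ : j ≠ i, S j := by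
    have : ⨆ j, S j ≤ S i ⊔ ⨆ j, ⨆ _ : j ≠ i, S j := iSup_le fun j => by
      by_cases h : j = i
      · subst h; exact le_sup_left
      · exact le_sup_of_le_right (le_iSup₂_of_le j h le_rfl)
    rw [hS] at this
    exact this trivial
  obtain ⟨a, ha, y, hy, rfl⟩ := Submodule.mem_sup.1 hx'
  have hy1 : y ∈ R i := by simpa using (R i).sub_mem hx (hle i ha)
  have hy2 : y ∈ ⨆ j, ⨆ _ : j ≠ i, R j := (iSup₂_mono fun j _ => hle j) hy
  have : y = 0 := by
    have := (hR i).le_bot ⟨hy1, hy2⟩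
    simpa using this
  simpa [this] using ha

/-! ### Modes, weights, automorphisms and primary currents. -/

namespace VertexOperatorAlgebra

variable {V : Type*} [AddCommGroup V] [Module ℂ V] (A : VertexOperatorAlgebra V)

/-- The `n`-th product `(u, v) ↦ u_n v` as a bilinear map. -/
def modeHom (n : ℤ) : V →ₗ[ℂ] Module.End ℂ V :=
  LinearMap.proj n ∘ₗ VertexOperator.ncoeff ∘ₗ A.Y

theorem modeHom_apply (n : ℤ) (u : V) : A.modeHom n u = A.mode u n := rfl

@[simp] theorem mode_zero (n : ℤ) : A.mode 0 n = 0 := map_zero (A.modeHom n)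

theorem mode_add (u v : V) (n : ℤ) : A.mode (u + v) n = A.mode u n + A.mode v n :=
  map_add (A.modeHom n) u v

theorem mode_neg (u : V) (n : ℤ) : A.mode (-u) n = -A.mode u n := map_neg (A.modeHom n) u

theorem mode_smul (c : ℂ) (u : V) (n : ℤ) : A.mode (c • u) n = c • A.mode u n :=
  map_smul (A.modeHom n) c u

theorem mode_sum {ι : Type*} (s : Finset ι) (f : ι → V) (n : ℤ) :
    A.mode (∑ i ∈ s, f i) n = ∑ i ∈ s, A.mode (f i) n := map_sum (A.modeHom n) f s

theorem mode_vacuum (n : ℤ) (v : V) : A.mode A.vacuum n v = if n = -1 then v else 0 :=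
  A.vacuum_mode n v

theorem mode_apply_vacuum_of_nonneg (v : V) {n : ℤ} (hn : 0 ≤ n) : A.mode v n A.vacuum = 0 :=
  A.mode_vacuum_nonneg v n hn

theorem mode_neg_one_apply_vacuum (v : V) : A.mode v (-1) A.vacuum = v := A.mode_vacuum_neg_one v

/-- The commutator formula. -/
theorem mode_commutator (u v w : V) (m n : ℤ) :
    A.mode u m (A.mode v n w) - A.mode v n (A.mode u m w) =
      ∑ᶠ i : ℕ, ((Ring.choose m i : ℤ) : ℂ) • A.mode (A.mode u i v) (m + n - i) w := by
  have h := A.jacobi u v w 0 m n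
  rw [finsum_eq_single _ 0, finsum_eq_single _ 0] at h
  · simpa [VertexOperatorAlgebra.mode] using h
  · intro i hi
    obtain ⟨j, rfl⟩ := Nat.exists_eq_succ_of_ne_zero hi
    simp [Ring.choose_zero_succ]
  · intro i hi
    obtain ⟨j, rfl⟩ := Nat.exists_eq_succ_of_ne_zero hi
    simp [Ring.choose_zero_succ]

theorem mode_commutator_eq_sum {u v : V} (w : V) (m n : ℤ) {K : ℕ}
    (hK : ∀ i : ℕ, K ≤ i → A.mode u i v = 0) :
    A.mode u m (A.mode v n w) - A.mode v n (A.mode u m w) =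
      ∑ i ∈ Finset.range K,
        ((Ring.choose m i : ℤ) : ℂ) • A.mode (A.mode u i v) (m + n - i) w := by
  rw [mode_commutator]
  refine finsum_eq_sum_of_support_subset _ fun i hi => ?_
  by_contra hn
  exact hi (by simp [hK i (by simpa using hn)])

theorem mode_commutator_of_nonneg (u v w : V) (m : ℕ) (n : ℤ) :
    A.mode u m (A.mode v n w) - A.mode v n (A.mode u m w) =
      ∑ i ∈ Finset.range (m + 1),
        (m.choose i : ℂ) • A.mode (A.mode u i v) (m + n - i) w := by
  rw [mode_commutator]
  have e : ∀ i : ℕ, ((Ring.choose (m : ℤ) i : ℤ) : ℂ) = (m.choose i : ℂ) := fun i => by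
    rw [Ring.choose_natCast]; simp
  simp_rw [e]
  refine finsum_eq_sum_of_support_subset _ fun i hi => ?_
  by_contra hn
  exact hi (by simp [Nat.choose_eq_zero_of_lt (show m < i by simpa using hn)])

theorem mode_zero_leibniz (u v w : V) (n : ℤ) :
    A.mode u 0 (A.mode v n w) = A.mode (A.mode u 0 v) n w + A.mode v n (A.mode u 0 w) := by
  have := A.mode_commutator_of_nonneg u v w 0 n
  rw [sub_eq_iff_eq_add] at this
  simpa using this

theorem L_zero_apply {n : ℤ} {v : V} (hv : v ∈ A.weight n) : A.L 0 v = (n : ℂ) • v :=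
  A.weight_eigen n v hv

/-- The weight spaces already span $V$ and the eigenspaces of $L(0)$ are independent, so no
eigenvector is missed. Consequently every operator commuting with $L(0)$ preserves weights. -/
theorem mem_weight_iff {n : ℤ} {v : V} : v ∈ A.weight n ↔ A.L 0 v = (n : ℂ) • v := by
  refine ⟨A.L_zero_apply, fun h => ?_⟩
  have hle : ∀ n : ℤ, A.weight n ≤ (A.L 0).eigenspace (n : ℂ) := fun n v hv =>
    Module.End.mem_eigenspace_iff.2 (A.L_zero_apply hv)
  have hind : iSupIndep fun n : ℤ => (A.L 0).eigenspace (n : ℂ) :=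
    (Module.End.eigenspaces_iSupIndep (A.L 0)).comp Int.cast_injective
  exact le_of_iSupIndep_of_iSup_eq_top hle hind A.isInternal.submodule_iSup_eq_top n
    (Module.End.mem_eigenspace_iff.2 h)

theorem weight_induction {p : V → Prop} (gen : ∀ n, ∀ v ∈ A.weight n, p v)
    (add : ∀ v w, p v → p w → p (v + w)) (v : V) : p v := by
  have hv : v ∈ ⨆ c, A.weight c := by
    rw [A.isInternal.submodule_iSup_eq_top]; trivial
  exact Submodule.iSup_induction _ (motive := p) hv gen (gen 0 0 (Submodule.zero_mem _)) add

theorem mem_weight_of_commute {X : Module.End ℂ V} (h : Commute X (A.L 0)) {n : ℤ} {v : V}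
    (hv : v ∈ A.weight n) : X v ∈ A.weight n := by
  have e : A.L 0 (X v) = X (A.L 0 v) := (LinearMap.congr_fun h v).symm
  rw [mem_weight_iff, e, A.L_zero_apply hv, map_smul]

/-- Such an operator acts on each finite-dimensional weight space, where generalized eigenvectors
span because $\mathbb C$ is algebraically closed. It makes the functional calculus available for
$g$, $u_0$, $gg_u$ and $q+\mathcal L_g$. -/
theorem isSumOfGenEigenspaces {X : Module.End ℂ V} (h : Commute X (A.L 0)) :
    IsSumOfGenEigenspaces X := by
  apply isSumOfGenEigenspaces_of_iSup
  rw [eq_top_iff, ← A.isInternal.submodule_iSup_eq_top]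
  refine iSup_le fun n v hv => ?_
  have hX : ∀ v ∈ A.weight n, X v ∈ A.weight n := fun v hv => A.mem_weight_of_commute h hv
  have := A.finiteDimensional n
  have htop := Module.End.iSup_maxGenEigenspace_eq_top (LinearMap.restrict X hX)
  have hmem : (⟨v, hv⟩ : A.weight n) ∈ ⨆ c, Module.End.maxGenEigenspace (LinearMap.restrict X hX) c := by
    rw [htop]; trivial
  have h2 := Submodule.mem_map_of_mem (f := (A.weight n).subtype) hmem
  rw [Submodule.map_iSup] at h2
  refine (iSup_mono (g := fun c => X.maxGenEigenspace c) fun c => ?_ :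
    _ ≤ ⨆ c, X.maxGenEigenspace c) h2
  have := Submodule.inf_genEigenspace X (A.weight n) hX (k := ⊤) (μ := c)
  exact this.symm.le.trans inf_le_right

theorem L_neg_one_mode (v w : V) (n : ℤ) :
    A.mode (A.L (-1) v) n w = (-n : ℂ) • A.mode v (n - 1) w := A.derivative v w n

/-- Homogeneous components: `u_n` has weight `wt u - n - 1`. -/
theorem mode_mem_weight {a b : ℤ} {u v : V} (hu : u ∈ A.weight a) (hv : v ∈ A.weight b) (n : ℤ) :
    A.mode u n v ∈ A.weight (a + b - n - 1) := by
  have h := A.mode_commutator_of_nonneg A.conformal u v 1 n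
  rw [mem_weight_iff]
  have e0 : A.mode A.conformal ((0 : ℕ) : ℤ) u = A.L (-1) u := rfl
  have e1 : A.mode A.conformal ((1 : ℕ) : ℤ) = A.L 0 := rfl
  rw [Finset.sum_range_succ, Finset.sum_range_one, e0, e1, A.L_zero_apply hu, A.L_zero_apply hv,
    A.L_neg_one_mode, A.mode_smul, sub_eq_iff_eq_add] at h
  have e2 : ((1 : ℕ) : ℤ) + n - ((0 : ℕ) : ℤ) - 1 = n := by push_cast; ring
  have e3 : ((1 : ℕ) : ℤ) + n - ((1 : ℕ) : ℤ) = n := by push_cast; ring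
  rw [e2, e3, map_smul] at h
  rw [h, LinearMap.smul_apply]
  push_cast
  simp only [Nat.choose_zero_right, Nat.choose_self, Nat.cast_one]
  module

theorem IsAutomorphism.commute_L {A : VertexOperatorAlgebra V} {g : Module.End ℂ V}
    (hg : A.IsAutomorphism g) (n : ℤ) : Commute g (A.L n) :=
  LinearMap.ext fun v => by
    change g (A.mode A.conformal (n + 1) v) = A.mode A.conformal (n + 1) (g v)
    rw [hg.map_mode, hg.map_conformal]

theorem IsAutomorphism.isSumOfGenEigenspaces {A : VertexOperatorAlgebra V} {g : Module.End ℂ V}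
    (hg : A.IsAutomorphism g) : IsSumOfGenEigenspaces g :=
  A.isSumOfGenEigenspaces (hg.commute_L 0)

theorem IsAutomorphism.commute_mode {A : VertexOperatorAlgebra V} {g : Module.End ℂ V}
    (hg : A.IsAutomorphism g) {u : V} (hu : g u = u) (n : ℤ) : Commute g (A.mode u n) :=
  LinearMap.ext fun v => by
    rw [Module.End.mul_apply, hg.map_mode, hu, Module.End.mul_apply]

theorem IsAutomorphism.mul {A : VertexOperatorAlgebra V} {g h : Module.End ℂ V}
    (hg : A.IsAutomorphism g) (hh : A.IsAutomorphism h) : A.IsAutomorphism (g * h) where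
  bijective := hg.bijective.comp hh.bijective
  map_mode u v n := by simp only [Module.End.mul_apply, hh.map_mode, hg.map_mode]
  map_vacuum := by rw [Module.End.mul_apply, hh.map_vacuum, hg.map_vacuum]
  map_conformal := by rw [Module.End.mul_apply, hh.map_conformal, hg.map_conformal]

/-- A vector `u` of weight one in a nonnegatively graded vertex operator algebra which is primary
and generates a Heisenberg algebra of level `μ`. -/
structure IsPrimaryCurrent (u : V) (μ : ℂ) : Prop where
  weight_neg : ∀ n < 0, A.weight n = ⊥
  mem : u ∈ A.weight 1
  L_one : A.L 1 u = 0
  mode_zero_self : A.mode u 0 u = 0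
  mode_one_self : A.mode u 1 u = μ • A.vacuum

theorem eq_zero_of_mem_weight_neg {A : VertexOperatorAlgebra V} (h : ∀ n < 0, A.weight n = ⊥)
    {n : ℤ} (hn : n < 0) {v : V} (hv : v ∈ A.weight n) : v = 0 := by
  rw [h n hn] at hv; exact hv

/-- The weight of $u_nu$ is $1-n$, which gives $u_1u\in V_{(0)}=\mathbb C\mathbf 1$ and $u_nu=0$ for
$n\ge2$. That $u_0u=0$ is skew-symmetry. -/
theorem exists_isPrimaryCurrent (hV0 : A.weight 0 = Submodule.span ℂ {A.vacuum})
    (hVneg : ∀ n < 0, A.weight n = ⊥) {u : V} (hu : u ∈ A.weight 1) (hL : A.L 1 u = 0) :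
    ∃ μ : ℂ, A.IsPrimaryCurrent u μ := by
  have h1 : A.mode u 1 u ∈ A.weight 0 := A.mode_mem_weight hu hu 1
  rw [hV0] at h1
  obtain ⟨μ, hμ⟩ := Submodule.mem_span_singleton.1 h1
  refine ⟨μ, hVneg, hu, hL, ?_, hμ.symm⟩
  have hK : ∀ i : ℕ, 2 ≤ i → A.mode u i u = 0 := fun i hi =>
    eq_zero_of_mem_weight_neg hVneg (by omega) (A.mode_mem_weight hu hu i)
  have e1 := A.mode_commutator_eq_sum A.vacuum 0 (-1) hK
  -- Evaluated directly, $[u_{-1},u_0]\mathbf 1=-u_0u$; by the commutator formula it is $u_0u$,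
  -- since the other term $-\mu\mathbf 1_{-2}\mathbf 1$ vanishes. Hence $2u_0u=0$.
  have e2 := A.mode_commutator_eq_sum A.vacuum (-1) 0 hK
  have hch : Ring.choose (-1 : ℤ) 1 = -1 := Ring.choose_one_right (-1)
  simp [Finset.sum_range_succ, ← hμ, mode_smul, mode_vacuum, mode_neg_one_apply_vacuum, hch,
    mode_apply_vacuum_of_nonneg] at e1 e2
  have e3 : A.mode u 0 u + A.mode u 0 u = 0 := by
    nth_rewrite 2 [← e2]; simp
  have : (2 : ℂ) • A.mode u 0 u = 0 := by rw [two_smul]; exact e3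
  simpa using this

end VertexOperatorAlgebra

/-! ### Generalized binomial coefficients of operators -/

section Binomial

variable {V : Type*} [AddCommGroup V] [Module ℂ V]

@[simp] theorem binomOp_zero (T : Module.End ℂ V) : binomOp T 0 = 1 := by simp [binomOp]

theorem succ_smul_binomOp (T : Module.End ℂ V) (j : ℕ) :
    ((j : ℂ) + 1) • binomOp T (j + 1) = binomOp T j * (T - (j : ℂ) • 1) := by
  have := Nat.cast_ne_zero (R := ℂ).2 j.factorial_ne_zero
  have h2 : (j : ℂ) + 1 ≠ 0 := Nat.cast_add_one_ne_zero j
  have e : ((j : ℂ) + 1) * ((j + 1).factorial : ℂ)⁻¹ = (j.factorial : ℂ)⁻¹ := by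
    rw [Nat.factorial_succ]; push_cast; field_simp
  rw [binomOp, binomOp, smul_smul, e, descPochhammer_succ_right, map_mul, smul_mul_assoc]
  congr 2
  simp [Nat.cast_smul_eq_nsmul]

theorem binomOp_eq_choose (T : Module.End ℂ V) (j : ℕ) :
    binomOp T j = ((j.factorial : ℂ)⁻¹) • (descPochhammer ℤ j).smeval T := by
  rw [binomOp, ← descPochhammer_map (algebraMap ℤ ℂ), Polynomial.aeval_map_algebraMap,
    Polynomial.aeval_eq_smeval]

/-- Chu–Vandermonde for commuting operators, that is, $(1+X)^{S+T}=(1+X)^S(1+X)^T$. -/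
theorem binomOp_add {S T : Module.End ℂ V} (h : Commute S T) (k : ℕ) :
    binomOp (S + T) k = ∑ i ∈ antidiagonal k, binomOp S i.1 * binomOp T i.2 := by
  rw [binomOp_eq_choose, Ring.descPochhammer_smeval_add k h, Finset.smul_sum]
  refine Finset.sum_congr rfl fun i hi => ?_
  rw [Finset.HasAntidiagonal.mem_antidiagonal] at hi
  rw [binomOp_eq_choose, binomOp_eq_choose, smul_mul_smul_comm, ← nsmul_eq_mul,
    ← Nat.cast_smul_eq_nsmul ℂ,
    smul_smul]
  congr 1
  subst hi
  have h1 := Nat.cast_ne_zero (R := ℂ).2 (i.1 + i.2).factorial_ne_zero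
  have h2 := Nat.cast_ne_zero (R := ℂ).2 i.1.factorial_ne_zero
  have h3 := Nat.cast_ne_zero (R := ℂ).2 i.2.factorial_ne_zero
  rw [Nat.cast_add_choose]
  field_simp

theorem commute_binomOp {X T : Module.End ℂ V} (h : Commute X T) (j : ℕ) :
    Commute X (binomOp T j) := by
  refine Commute.smul_right ?_ _
  exact Polynomial.induction_on (motive := fun p => Commute X (Polynomial.aeval T p)) _
    (fun a => by rw [Polynomial.aeval_C]; exact Algebra.commute_algebraMap_right a X)
    (fun p q hp hq => by rw [map_add]; exact hp.add_right hq)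
    (fun n a _ => by
      rw [map_mul, Polynomial.aeval_C, map_pow, Polynomial.aeval_X]
      exact (Algebra.commute_algebraMap_right a X).mul_right (h.pow_right _))

theorem binomOp_apply_congr {S T : Module.End ℂ V} {q : Submodule ℂ V} (hS : ∀ v ∈ q, S v ∈ q)
    (h : ∀ v ∈ q, S v = T v) (j : ℕ) {v : V} (hv : v ∈ q) : binomOp S j v = binomOp T j v := by
  have key : ∀ p : Polynomial ℂ, ∀ v ∈ q, Polynomial.aeval S p v = Polynomial.aeval T p v := by
    intro p
    induction p using Polynomial.induction_on with
    | C a => intro v _; simp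
    | add p r hp hr => intro v hv; simp [hp v hv, hr v hv]
    | monomial n a ih =>
      intro v hv
      have e : (Polynomial.C a * Polynomial.X ^ (n + 1) : Polynomial ℂ) =
        (Polynomial.C a * Polynomial.X ^ n) * Polynomial.X := by ring
      rw [e, map_mul (Polynomial.aeval S), map_mul (Polynomial.aeval T) (_ * _) Polynomial.X,
        Polynomial.aeval_X, Polynomial.aeval_X, Module.End.mul_apply,
        Module.End.mul_apply, ih _ (hS v hv), h v hv]
  rw [binomOp, binomOp, LinearMap.smul_apply, LinearMap.smul_apply, key _ v hv]

theorem binomOp_natCast (n j : ℕ) :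
    binomOp ((n : ℂ) • (1 : Module.End ℂ V)) j = (n.choose j : ℂ) • 1 := by
  have h := binomOp_eq_choose ((n : ℂ) • (1 : Module.End ℂ V)) j
  have e : (descPochhammer ℂ j).eval (n : ℂ) = j.factorial * n.choose j := by
    rw [descPochhammer_eval_eq_descFactorial, Nat.descFactorial_eq_factorial_mul_choose]
    push_cast; rfl
  have e2 : ((n : ℂ) • (1 : Module.End ℂ V)) = algebraMap ℂ _ (n : ℂ) := by
    rw [Algebra.algebraMap_eq_smul_one]
  have := Nat.cast_ne_zero (R := ℂ).2 j.factorial_ne_zero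
  rw [binomOp, e2, Polynomial.aeval_algebraMap_apply, Polynomial.coe_aeval_eq_eval, e,
    Algebra.algebraMap_eq_smul_one, smul_smul]
  congr 1
  field_simp

/-- The coefficients of $(1+X)^{-n-1}$, which arise when powers of $X/(1+x_0X)$ are expanded. -/
theorem binomOp_neg_succ (n j : ℕ) :
    binomOp ((-(n : ℂ) - 1) • (1 : Module.End ℂ V)) j =
      ((-1) ^ j * ((n + j).choose n : ℂ)) • 1 := by
  induction j with
  | zero => simp
  | succ j ih =>
    have h2 : (j : ℂ) + 1 ≠ 0 := Nat.cast_add_one_ne_zero j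
    apply smul_right_injective _ h2
    have e : ((n + (j + 1)).choose n : ℂ) * ((j : ℂ) + 1) =
        ((n + j).choose n : ℂ) * ((n : ℂ) + j + 1) := by
      have e1 := Nat.add_one_mul_choose_eq (n + j) j
      rw [← Nat.choose_symm_of_eq_add (show n + (j + 1) = (j + 1) + n by omega),
        ← Nat.choose_symm_of_eq_add (show n + j = j + n by omega)]
      rw [mul_comm ((n + j).choose j : ℂ)]
      exact_mod_cast e1.symm
    simp only [succ_smul_binomOp, ih, ← sub_smul, smul_mul_smul_comm, mul_one, smul_smul]
    congr 1
    rw [pow_succ]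
    linear_combination (-(-1 : ℂ) ^ j * (-1) ) * e

end Binomial

/-! ### Commutation relations of the current. -/

namespace VertexOperatorAlgebra

variable {V : Type*} [AddCommGroup V] [Module ℂ V] {A : VertexOperatorAlgebra V}

namespace IsPrimaryCurrent

variable {u : V} {μ : ℂ} (h : A.IsPrimaryCurrent u μ)
include h

theorem mode_self_eq_zero {n : ℤ} (hn : 2 ≤ n) : A.mode u n u = 0 :=
  eq_zero_of_mem_weight_neg h.weight_neg (by omega) (A.mode_mem_weight h.mem h.mem n)

/-- The value $i=2$ is the primary condition $L(1)u=0$; for $i\ge3$ the weight $2-i$ is negative. -/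
theorem conformal_mode {i : ℕ} (hi : 2 ≤ i) : A.mode A.conformal i u = 0 := by
  rcases (by omega : i = 2 ∨ 3 ≤ i) with rfl | h3
  · exact h.L_one
  · exact eq_zero_of_mem_weight_neg h.weight_neg (by omega)
      (A.mode_mem_weight A.conformal_mem h.mem i)

/-- `[L(p), u_q] = -q u_{p+q}`. -/
theorem L_mode (p q : ℤ) (w : V) :
    A.L p (A.mode u q w) = A.mode u q (A.L p w) - (q : ℂ) • A.mode u (p + q) w := by
  have e := A.mode_commutator_eq_sum (u := A.conformal) w (p + 1) q
    fun i hi => h.conformal_mode hi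
  have e0 : A.mode A.conformal ((0 : ℕ) : ℤ) u = A.L (-1) u := rfl
  have e1 : A.mode A.conformal ((1 : ℕ) : ℤ) u = u := by
    have := A.L_zero_apply h.mem
    rwa [Int.cast_one, one_smul] at this
  have e2 : p + 1 + q - ((0 : ℕ) : ℤ) - 1 = p + q := by push_cast; ring
  have e3 : p + 1 + q - ((1 : ℕ) : ℤ) = p + q := by push_cast; ring
  rw [Finset.sum_range_succ, Finset.sum_range_one, e0, e1, A.L_neg_one_mode, e2, e3,
    Ring.choose_zero_right, Ring.choose_one_right, sub_eq_iff_eq_add] at e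
  rw [L, e]
  push_cast
  module

theorem commute_mode_zero_L (p : ℤ) : Commute (A.mode u 0) (A.L p) :=
  LinearMap.ext fun v => by
    have := h.L_mode p 0 v
    simp at this
    exact this.symm

theorem isSumOfGenEigenspaces : IsSumOfGenEigenspaces (A.mode u 0) :=
  A.isSumOfGenEigenspaces (h.commute_mode_zero_L 0)

/-- The Heisenberg relation $[u_m,u_n]=m\mu\,\delta_{m+n,0}$ is trivial when both indices are
nonnegative. -/
theorem commute_mode {m n : ℤ} (hm : 0 ≤ m) (hn : 0 ≤ n) :
    Commute (A.mode u m) (A.mode u n) := by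
  refine LinearMap.ext fun v => sub_eq_zero.1 ?_
  rw [Module.End.mul_apply, Module.End.mul_apply, A.mode_commutator_eq_sum v m n (K := 2)
    fun i hi => h.mode_self_eq_zero (by omega)]
  have e0 : A.mode u ((0 : ℕ) : ℤ) u = 0 := h.mode_zero_self
  have e1 : A.mode u ((1 : ℕ) : ℤ) u = μ • A.vacuum := h.mode_one_self
  rw [Finset.sum_range_succ, Finset.sum_range_one, e0, e1, mode_zero, mode_smul,
    LinearMap.smul_apply, mode_vacuum, Ring.choose_one_right]
  split_ifs with hc
  · have : m = 0 := by omega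
    simp [this]
  · simp

/-- Since $\omega=L(-2)\mathbf 1$ and $u_n\mathbf 1=0$, only the commutator $[L(-2),u_n]$
contributes. -/
theorem mode_conformal (n : ℕ) :
    A.mode u n A.conformal = (n : ℂ) • A.mode u ((n : ℤ) - 2) A.vacuum := by
  have e : A.conformal = A.L (-2) A.vacuum := (A.mode_neg_one_apply_vacuum A.conformal).symm
  have e2 := h.L_mode (-2) n A.vacuum
  rw [A.mode_apply_vacuum_of_nonneg u (Int.natCast_nonneg n), map_zero, ← e, eq_comm,
    sub_eq_zero] at e2
  rw [e2, add_comm (-2 : ℤ), ← sub_eq_add_neg]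
  simp

theorem mode_zero_conformal : A.mode u 0 A.conformal = 0 := by
  simpa using h.mode_conformal 0

theorem mode_one_conformal : A.mode u 1 A.conformal = u := by
  have := h.mode_conformal 1
  simpa [A.mode_neg_one_apply_vacuum] using this

theorem mode_conformal_eq_zero {n : ℕ} (hn : 2 ≤ n) : A.mode u n A.conformal = 0 := by
  rw [h.mode_conformal, A.mode_apply_vacuum_of_nonneg u (by omega), smul_zero]

/-! ### The exponential factor of `Δ` -/

theorem commute_deltaExponent_coeff (m n : ℕ) :
    Commute (PowerSeries.coeff m (A.deltaExponent u)) (PowerSeries.coeff n (A.deltaExponent u)) := by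
  simp only [deltaExponent, PowerSeries.coeff_mk]
  split_ifs
  · exact Commute.zero_left _
  · exact Commute.zero_left _
  · exact Commute.zero_right _
  · exact ((h.commute_mode (Int.natCast_nonneg m) (Int.natCast_nonneg n)).smul_left _).smul_right _

theorem smul_deltaExpCoeff (r : ℕ) :
    (r : ℂ) • A.deltaExpCoeff u r =
      ∑ i ∈ antidiagonal r, (if i.1 = 0 then 0 else (-1 : ℂ) ^ i.1) •
        (A.mode u i.1 * A.deltaExpCoeff u i.2) := by
  have := smul_expCoeff (D := A.deltaExponent u) (by simp [deltaExponent])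
    h.commute_deltaExponent_coeff r
  refine this.trans (Finset.sum_congr rfl fun i _ => ?_)
  rw [deltaExponent, PowerSeries.coeff_mk]
  split_ifs with hi
  · simp
  · have : (i.1 : ℂ) ≠ 0 := Nat.cast_ne_zero.2 hi
    rw [smul_mul_assoc, smul_smul, mul_div_cancel₀ _ this]
    rfl

end IsPrimaryCurrent

theorem deltaExpCoeff_zero (u : V) : A.deltaExpCoeff u 0 = 1 := expCoeff_zero _

namespace IsPrimaryCurrent

variable {u : V} {μ : ℂ} (h : A.IsPrimaryCurrent u μ)
include h

/-- The Euler recursion expresses $E_r$ for $r>0$ through the $u_m$ with $m>0$ and earlier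
coefficients, so strong induction suffices. -/
theorem commute_deltaExpCoeff {X : Module.End ℂ V} (hX : ∀ m : ℕ, 0 < m → Commute X (A.mode u m))
    (r : ℕ) : Commute X (A.deltaExpCoeff u r) := by
  induction r using Nat.strong_induction_on with
  | _ r ih =>
    rcases Nat.eq_zero_or_pos r with rfl | hr
    · rw [deltaExpCoeff_zero]; exact Commute.one_right X
    · have hr' : (r : ℂ) ≠ 0 := Nat.cast_ne_zero.2 hr.ne'
      have e := h.smul_deltaExpCoeff r
      rw [← eq_inv_smul_iff₀ hr'] at e
      rw [e]
      refine Commute.smul_right (Commute.sum_right _ _ _ fun i hi => ?_) _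
      rw [Finset.HasAntidiagonal.mem_antidiagonal] at hi
      split_ifs with h0
      · rw [zero_smul]; exact Commute.zero_right X
      · exact ((hX _ (by omega)).mul_right (ih _ (by omega))).smul_right _

/-- In the recursion $u_m$ lowers the weight by $m$ and $E_{r-m}$ by $r-m$. With no negative
weights, $E(X)v$ is therefore a polynomial. -/
theorem deltaExpCoeff_mem_weight (r : ℕ) {d : ℤ} {v : V} (hv : v ∈ A.weight d) :
    A.deltaExpCoeff u r v ∈ A.weight (d - r) := by
  induction r using Nat.strong_induction_on with
  | _ r ih =>
    rcases Nat.eq_zero_or_pos r with rfl | hr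
    · rw [deltaExpCoeff_zero]; simpa using hv
    · have hr' : (r : ℂ) ≠ 0 := Nat.cast_ne_zero.2 hr.ne'
      have e := h.smul_deltaExpCoeff r
      rw [← eq_inv_smul_iff₀ hr'] at e
      rw [e, LinearMap.smul_apply, LinearMap.sum_apply]
      refine Submodule.smul_mem _ _ (Submodule.sum_mem _ fun i hi => ?_)
      rw [Finset.HasAntidiagonal.mem_antidiagonal] at hi
      split_ifs with h0
      · simp
      · have := A.mode_mem_weight h.mem (ih i.2 (by omega)) i.1
        have e3 : 1 + (d - (i.2 : ℤ)) - i.1 - 1 = d - r := by rw [← hi]; push_cast; ring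
        rw [e3] at this
        exact Submodule.smul_mem _ _ this

theorem deltaExpCoeff_eq_zero {r : ℕ} {d : ℤ} {v : V} (hv : v ∈ A.weight d) (hr : d < r) :
    A.deltaExpCoeff u r v = 0 :=
  eq_zero_of_mem_weight_neg h.weight_neg (by omega) (h.deltaExpCoeff_mem_weight r hv)

theorem exists_deltaExpCoeff_eq_zero (v : V) : ∃ R : ℕ, ∀ r, R ≤ r → A.deltaExpCoeff u r v = 0 := by
  refine A.weight_induction (p := fun v => ∃ R : ℕ, ∀ r, R ≤ r → A.deltaExpCoeff u r v = 0)
    (fun d v hv => ⟨d.toNat + 1, fun r hr => h.deltaExpCoeff_eq_zero hv (by omega)⟩) ?_ v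
  rintro v w ⟨R, hR⟩ ⟨R', hR'⟩
  exact ⟨R + R', fun r hr => by rw [map_add, hR r (by omega), hR' r (by omega), add_zero]⟩

theorem commute_mode_zero_deltaExpCoeff (r : ℕ) :
    Commute (A.mode u 0) (A.deltaExpCoeff u r) :=
  h.commute_deltaExpCoeff (fun m _ => h.commute_mode le_rfl (Int.natCast_nonneg m)) r

end IsPrimaryCurrent

end VertexOperatorAlgebra

/-! ### Regrouping of nested antidiagonal sums. -/

theorem sum_antidiagonal_exchange {M : Type*} [AddCommMonoid M] (s : ℕ)
    (F : ℕ → ℕ → ℕ → ℕ → M) :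
    ∑ x ∈ antidiagonal s, ∑ y ∈ antidiagonal x.1, ∑ z ∈ antidiagonal x.2, F y.1 y.2 z.1 z.2 =
      ∑ x ∈ antidiagonal s, ∑ y ∈ antidiagonal x.1, ∑ z ∈ antidiagonal x.2,
        F y.1 z.1 y.2 z.2 := by
  simp only [Finset.sum_sigma']
  refine Finset.sum_bij'
    (fun x _ => ⟨(x.2.1.1 + x.2.2.1, x.2.1.2 + x.2.2.2), (x.2.1.1, x.2.2.1), (x.2.1.2, x.2.2.2)⟩)
    (fun x _ => ⟨(x.2.1.1 + x.2.2.1, x.2.1.2 + x.2.2.2), (x.2.1.1, x.2.2.1), (x.2.1.2, x.2.2.2)⟩)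
    ?_ ?_ ?_ ?_ ?_
  · rintro ⟨⟨a, b⟩, ⟨c, d⟩, ⟨e, f⟩⟩ h
    simp only [Finset.mem_sigma, Finset.HasAntidiagonal.mem_antidiagonal, and_true] at h ⊢
    omega
  · rintro ⟨⟨a, b⟩, ⟨c, d⟩, ⟨e, f⟩⟩ h
    simp only [Finset.mem_sigma, Finset.HasAntidiagonal.mem_antidiagonal, and_true] at h ⊢
    omega
  · rintro ⟨⟨a, b⟩, ⟨c, d⟩, ⟨e, f⟩⟩ h
    simp only [Finset.mem_sigma, Finset.HasAntidiagonal.mem_antidiagonal] at h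
    obtain ⟨-, rfl, rfl⟩ := h
    rfl
  · rintro ⟨⟨a, b⟩, ⟨c, d⟩, ⟨e, f⟩⟩ h
    simp only [Finset.mem_sigma, Finset.HasAntidiagonal.mem_antidiagonal] at h
    obtain ⟨-, rfl, rfl⟩ := h
    rfl
  · intros; rfl

theorem sum_antidiagonal_assoc {M : Type*} [AddCommMonoid M] (s : ℕ) (F : ℕ → ℕ → ℕ → M) :
    ∑ x ∈ antidiagonal s, ∑ y ∈ antidiagonal x.1, F y.1 y.2 x.2 =
      ∑ x ∈ antidiagonal s, ∑ y ∈ antidiagonal x.2, F x.1 y.1 y.2 := by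
  simp only [Finset.sum_sigma']
  refine Finset.sum_bij'
    (fun x _ => ⟨(x.2.1, x.2.2 + x.1.2), (x.2.2, x.1.2)⟩)
    (fun x _ => ⟨(x.1.1 + x.2.1, x.2.2), (x.1.1, x.2.1)⟩)
    ?_ ?_ ?_ ?_ ?_
  · rintro ⟨⟨a, b⟩, ⟨c, d⟩⟩ h
    simp only [Finset.mem_sigma, Finset.HasAntidiagonal.mem_antidiagonal, and_true] at h ⊢
    omega
  · rintro ⟨⟨a, b⟩, ⟨c, d⟩⟩ h
    simp only [Finset.mem_sigma, Finset.HasAntidiagonal.mem_antidiagonal, and_true] at h ⊢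
    omega
  · rintro ⟨⟨a, b⟩, ⟨c, d⟩⟩ h
    simp only [Finset.mem_sigma, Finset.HasAntidiagonal.mem_antidiagonal] at h
    obtain ⟨-, rfl⟩ := h
    rfl
  · rintro ⟨⟨a, b⟩, ⟨c, d⟩⟩ h
    simp only [Finset.mem_sigma, Finset.HasAntidiagonal.mem_antidiagonal] at h
    obtain ⟨-, rfl⟩ := h
    rfl
  · intros; rfl

/-- The absorption identity for binomial coefficients; both sides equal $(j+1)!\,\binom{y}{j+1}$
divided by $j!$. -/
theorem mul_binomOp_sub_one {V : Type*} [AddCommGroup V] [Module ℂ V] (y : Module.End ℂ V)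
    (j : ℕ) : y * binomOp (y - 1) j = binomOp y j * (y - (j : ℂ) • 1) := by
  induction j with
  | zero => simp
  | succ j ih =>
    have h2 : (j : ℂ) + 1 ≠ 0 := Nat.cast_add_one_ne_zero j
    apply smul_right_injective _ h2
    have e : y - ((j + 1 : ℕ) : ℂ) • (1 : Module.End ℂ V) = y - 1 - (j : ℂ) • 1 := by
      push_cast; module
    have c : Commute (y - (j : ℂ) • (1 : Module.End ℂ V)) (y - 1 - (j : ℂ) • 1) := by
      have : Commute (y - (j : ℂ) • (1 : Module.End ℂ V)) y :=
        (Commute.refl y).sub_left ((Commute.one_left y).smul_left _)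
      exact (this.sub_right (Commute.one_right _)).sub_right ((Commute.one_right _).smul_right _)
    change ((j : ℂ) + 1) • (y * binomOp (y - 1) (j + 1)) = ((j : ℂ) + 1) • (binomOp y (j + 1) * _)
    rw [← mul_smul_comm, succ_smul_binomOp, ← smul_mul_assoc, succ_smul_binomOp, e,
      ← mul_assoc, ih]

/-! ### Conjugation of vertex operators by the exponential factor. -/

namespace VertexOperatorAlgebra.IsPrimaryCurrent

variable {V : Type*} [AddCommGroup V] [Module ℂ V] {A : VertexOperatorAlgebra V}
variable {u : V} {μ : ℂ} (h : A.IsPrimaryCurrent u μ)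
include h

/-- The differential equation satisfied by
`(1 + x₀ X) ^ (-u₀) exp (∑_m ((-1) ^ m / m) u_m (X / (1 + x₀ X)) ^ m)`. -/
theorem smul_binomOp_deltaExpCoeff (a j : ℕ) :
    ((a : ℂ) + j) • (binomOp (-A.mode u 0 - (a : ℂ) • 1) j * A.deltaExpCoeff u a) =
      ∑ y ∈ antidiagonal a, ∑ z ∈ antidiagonal j,
        (if y.1 + z.1 = 0 then 0 else (-1 : ℂ) ^ (y.1 + z.1) * ((y.1 + z.1).choose y.1 : ℂ)) •
          (A.mode u y.1 * (binomOp (-A.mode u 0 - (y.2 : ℂ) • 1) z.2 * A.deltaExpCoeff u y.2)) := by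
  set P := A.mode u 0
  set y₀ := -P - (a : ℂ) • (1 : Module.End ℂ V)
  have hP : ∀ m : ℕ, Commute P (A.mode u m) := fun m =>
    h.commute_mode le_rfl (Int.natCast_nonneg m)
  have hy : ∀ (X : Module.End ℂ V), Commute X P → ∀ c : ℂ, Commute X (-P - c • 1) :=
    fun X hX c => hX.neg_right.sub_right ((Commute.one_right X).smul_right c)
  -- the sum without excluding the term `y.1 + z.1 = 0`
  have full : ∑ y ∈ antidiagonal a, ∑ z ∈ antidiagonal j,
        ((-1 : ℂ) ^ (y.1 + z.1) * ((y.1 + z.1).choose y.1 : ℂ)) •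
          (A.mode u y.1 * (binomOp (-P - (y.2 : ℂ) • 1) z.2 * A.deltaExpCoeff u y.2)) =
      binomOp (y₀ - 1) j * ((a : ℂ) • A.deltaExpCoeff u a + P * A.deltaExpCoeff u a) := by
    have inner : ∀ y ∈ antidiagonal a, ∑ z ∈ antidiagonal j,
        ((-1 : ℂ) ^ (y.1 + z.1) * ((y.1 + z.1).choose y.1 : ℂ)) •
          (A.mode u y.1 * (binomOp (-P - (y.2 : ℂ) • 1) z.2 * A.deltaExpCoeff u y.2)) =
        binomOp (y₀ - 1) j * ((-1 : ℂ) ^ y.1 • (A.mode u y.1 * A.deltaExpCoeff u y.2)) := by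
      intro y hy1
      rw [Finset.HasAntidiagonal.mem_antidiagonal] at hy1
      -- The exponent is split so that Chu–Vandermonde reads $(1+x_0X)^{-i-1}(1+x_0X)^{-u_0-a'}$
      -- with $i+a'=a$; the first factor produces the signed binomial coefficients of the sum.
      have e1 : y₀ - 1 = (-(y.1 : ℂ) - 1) • (1 : Module.End ℂ V) + (-P - (y.2 : ℂ) • 1) := by
        simp only [y₀, ← hy1]; push_cast; module
      rw [e1, binomOp_add ((Commute.one_left _).smul_left _), Finset.sum_mul]
      refine Finset.sum_congr rfl fun z _ => ?_
      rw [binomOp_neg_succ, smul_mul_assoc, one_mul, smul_mul_assoc, mul_smul_comm, smul_smul,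
        ← mul_assoc, ← mul_assoc,
        (commute_binomOp (hy _ (hP y.1).symm (y.2 : ℂ)) z.2).eq, pow_add]
      congr 1
      ring
    rw [Finset.sum_congr rfl inner, ← Finset.mul_sum, h.smul_deltaExpCoeff a]
    congr 1
    -- The recursion for $aE_a$ omits $m=0$; the product $u_0E_a$ is exactly the omitted term.
    have e2 : P * A.deltaExpCoeff u a = ∑ i ∈ antidiagonal a, (if i.1 = 0 then (1 : ℂ) else 0) •
        (A.mode u i.1 * A.deltaExpCoeff u i.2) := by
      rw [Finset.sum_eq_single (0, a)]
      · simp [P]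
      · rintro ⟨i, k⟩ hi hne
        rw [Finset.HasAntidiagonal.mem_antidiagonal] at hi
        rw [if_neg, zero_smul]
        rintro rfl
        exact hne (by simp only [zero_add] at hi; rw [hi])
      · simp
    rw [e2, ← Finset.sum_add_distrib]
    refine Finset.sum_congr rfl fun i _ => ?_
    split_ifs with h0
    · simp [h0]
    · simp
  -- Excluding $y_1+z_1=0$ removes the single term $u_0\binom{-u_0-a}{j}E_a$.
  have diff : ∀ y ∈ antidiagonal a, ∀ z ∈ antidiagonal j,
      ((if y.1 + z.1 = 0 then 0 else (-1 : ℂ) ^ (y.1 + z.1) * ((y.1 + z.1).choose y.1 : ℂ)) •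
          (A.mode u y.1 * (binomOp (-P - (y.2 : ℂ) • 1) z.2 * A.deltaExpCoeff u y.2))) =
      ((-1 : ℂ) ^ (y.1 + z.1) * ((y.1 + z.1).choose y.1 : ℂ)) •
          (A.mode u y.1 * (binomOp (-P - (y.2 : ℂ) • 1) z.2 * A.deltaExpCoeff u y.2)) -
      (if y.1 = 0 then if z.1 = 0 then P * (binomOp y₀ j * A.deltaExpCoeff u a) else 0 else 0) := by
    intro y hy1 z hz1
    rw [Finset.HasAntidiagonal.mem_antidiagonal] at hy1 hz1
    by_cases h1 : y.1 = 0
    · by_cases h2 : z.1 = 0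
      · have h3 : y.2 = a := by omega
        have h4 : z.2 = j := by omega
        simp [h1, h2, h3, h4, P, y₀]
      · simp [h1, h2]
    · simp [h1]
  have last : ∑ y ∈ antidiagonal a, ∑ z ∈ antidiagonal j,
      (if y.1 = 0 then if z.1 = 0 then P * (binomOp y₀ j * A.deltaExpCoeff u a) else 0 else 0) =
      P * (binomOp y₀ j * A.deltaExpCoeff u a) := by
    have s : ∀ (n : ℕ) (x : Module.End ℂ V),
        ∑ z ∈ antidiagonal n, (if z.1 = 0 then x else 0) = x := by
      intro n x
      rw [Finset.sum_eq_single (0, n)]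
      · simp
      · rintro ⟨i, k⟩ hi hne
        rw [Finset.HasAntidiagonal.mem_antidiagonal] at hi
        rw [if_neg]
        rintro rfl
        exact hne (by simp only [zero_add] at hi; rw [hi])
      · simp
    have : ∀ y : ℕ × ℕ, ∑ z ∈ antidiagonal j,
      (if y.1 = 0 then if z.1 = 0 then P * (binomOp y₀ j * A.deltaExpCoeff u a) else 0 else 0) =
      if y.1 = 0 then P * (binomOp y₀ j * A.deltaExpCoeff u a) else 0 := fun y => by
      split_ifs
      · exact s j _
      · simp
    simp_rw [this]
    exact s a _
  rw [Finset.sum_congr rfl fun y hy1 => Finset.sum_congr rfl (diff y hy1)]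
  simp only [Finset.sum_sub_distrib]
  rw [last, full]
  -- With $y_0=-u_0-a$ the full sum is $-y_0\binom{y_0-1}{j}E_a=-\binom{y_0}{j}(y_0-j)E_a$;
  -- subtracting the excluded term leaves $(a+j)\binom{y_0}{j}E_a$.
  have key := mul_binomOp_sub_one y₀ j
  have c1 : Commute P (binomOp (y₀ - 1) j) :=
    commute_binomOp ((hy P (Commute.refl P) _).sub_right (Commute.one_right P)) j
  have c2 : Commute P (binomOp y₀ j) := commute_binomOp (hy P (Commute.refl P) _) j
  have e3 : binomOp (y₀ - 1) j * ((a : ℂ) • A.deltaExpCoeff u a + P * A.deltaExpCoeff u a) =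
      -(y₀ * binomOp (y₀ - 1) j) * A.deltaExpCoeff u a := by
    have : y₀ * binomOp (y₀ - 1) j = -(P * binomOp (y₀ - 1) j) - (a : ℂ) • binomOp (y₀ - 1) j := by
      simp [y₀, sub_mul]
    rw [this, c1.eq, mul_add, ← mul_assoc, mul_smul_comm, neg_sub, sub_neg_eq_add, add_mul,
      smul_mul_assoc]
  have e4 : binomOp y₀ j * y₀ = -(P * binomOp y₀ j) - (a : ℂ) • binomOp y₀ j := by
    rw [c2.eq]; simp [y₀, mul_sub]
  rw [e3, key, mul_sub, e4, mul_smul_comm, mul_one, ← mul_assoc]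
  simp only [neg_mul, sub_mul, smul_mul_assoc, neg_sub, add_smul]
  abel

/-- The conjugation formula for the coefficients `E_r` of the exponential factor of `Δ`:
`E_r (v_n w) = ∑_{a + j + b = r} (binom(-u₀ - a, j) E_a v)_{n + j} (E_b w)`. -/
theorem deltaExpCoeff_mode (r : ℕ) (v w : V) (n : ℤ) :
    A.deltaExpCoeff u r (A.mode v n w) =
      ∑ x ∈ antidiagonal r, ∑ y ∈ antidiagonal x.1,
        A.mode (binomOp (-A.mode u 0 - (y.1 : ℂ) • 1) y.2 (A.deltaExpCoeff u y.1 v)) (n + y.2)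
          (A.deltaExpCoeff u x.2 w) := by
  -- $Z_s$ is the candidate for the $X^s$-coefficient of $E(X)v_nE(X)^{-1}$; it is shown to satisfy
  -- the differential equation of that conjugate.
  set Z : ℕ → Module.End ℂ V := fun s => ∑ y ∈ antidiagonal s,
    A.mode (binomOp (-A.mode u 0 - (y.1 : ℂ) • 1) y.2 (A.deltaExpCoeff u y.1 v)) (n + y.2) with hZ
  set c : ℕ → ℂ := fun m => if m = 0 then 0 else (-1 : ℂ) ^ m with hc
  -- the commutator of the exponent with `Z`
  have hcomm : ∀ s : ℕ, (s : ℂ) • Z s = ∑ x ∈ antidiagonal s,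
      c x.1 • (A.mode u x.1 * Z x.2 - Z x.2 * A.mode u x.1) := by
    intro s
    have e1 : ∀ x ∈ antidiagonal s, c x.1 • (A.mode u x.1 * Z x.2 - Z x.2 * A.mode u x.1) =
        ∑ y ∈ antidiagonal x.1, ∑ z ∈ antidiagonal x.2,
          ((if y.1 + y.2 = 0 then 0 else
            (-1 : ℂ) ^ (y.1 + y.2) * ((y.1 + y.2).choose y.1 : ℂ)) •
          A.mode (A.mode u y.1 (binomOp (-A.mode u 0 - (z.1 : ℂ) • 1) z.2
            (A.deltaExpCoeff u z.1 v))) (n + ((y.2 + z.2 : ℕ) : ℤ))) := by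
      intro x _
      rw [hZ]
      simp only
      rw [Finset.mul_sum, Finset.sum_mul, ← Finset.sum_sub_distrib, Finset.smul_sum,
        Finset.sum_comm]
      refine Finset.sum_congr rfl fun z _ => LinearMap.ext fun w => ?_
      rw [LinearMap.smul_apply, LinearMap.sub_apply, Module.End.mul_apply, Module.End.mul_apply,
        A.mode_commutator_of_nonneg, Finset.smul_sum, LinearMap.sum_apply,
        Finset.Nat.sum_antidiagonal_eq_sum_range_succ_mk]
      refine Finset.sum_congr rfl fun i hi => ?_
      have hi : i ≤ x.1 := by simpa [Nat.lt_succ_iff] using hi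
      have e2 : (x.1 : ℤ) + (n + z.2) - i = n + ((x.1 - i + z.2 : ℕ) : ℤ) := by
        push_cast [hi]; ring
      have e3 : i + (x.1 - i) = x.1 := by omega
      rw [LinearMap.smul_apply, smul_smul, e2]
      simp only [e3, hc]
      split_ifs <;> simp
    -- The commutator formula pairs the two indices coming from $u$; the differential equation for
    -- the argument of $Z$ pairs them with the index of $E$ and with that of the binomial
    -- coefficient instead.
    rw [Finset.sum_congr rfl e1, sum_antidiagonal_exchange s (fun i p a j =>
      ((if i + p = 0 then 0 else (-1 : ℂ) ^ (i + p) * ((i + p).choose i : ℂ)) •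
          A.mode (A.mode u i (binomOp (-A.mode u 0 - (a : ℂ) • 1) j
            (A.deltaExpCoeff u a v))) (n + ((p + j : ℕ) : ℤ)))), hZ]
    simp only
    rw [Finset.smul_sum]
    refine Finset.sum_congr rfl fun x hx => ?_
    rw [Finset.HasAntidiagonal.mem_antidiagonal] at hx
    have e4 := LinearMap.congr_fun (h.smul_binomOp_deltaExpCoeff x.1 x.2) v
    simp only [LinearMap.smul_apply, Module.End.mul_apply, LinearMap.sum_apply] at e4
    rw [← hx]; push_cast
    rw [← mode_smul, e4, mode_sum]
    refine Finset.sum_congr rfl fun y _ => ?_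
    rw [mode_sum]
    refine Finset.sum_congr rfl fun z hz => ?_
    rw [Finset.HasAntidiagonal.mem_antidiagonal] at hz
    rw [mode_smul, ← hz]
    push_cast; rfl
  set E := A.deltaExpCoeff u with hE
  have hrec : ∀ s : ℕ, (s : ℂ) • E s = ∑ x ∈ antidiagonal s, c x.1 • (A.mode u x.1 * E x.2) :=
    h.smul_deltaExpCoeff
  -- Multiply by $r$ and use both Euler recursions: on the right $r$ is split between $Z$ and $E$,
  -- and the terms $Z\,u_m\,E$ from the commutator cancel those from the recursion of $E$.
  have main : ∀ r, E r * A.mode v n = ∑ x ∈ antidiagonal r, Z x.1 * E x.2 := by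
    intro r
    induction r using Nat.strong_induction_on with
    | _ r ih =>
      rcases Nat.eq_zero_or_pos r with rfl | hr
      · simp [hZ, hE, deltaExpCoeff_zero]
      · have hr' : (r : ℂ) ≠ 0 := Nat.cast_ne_zero.2 hr.ne'
        apply smul_right_injective _ hr'
        simp only
        rw [← smul_mul_assoc, hrec, Finset.sum_mul]
        have f1 : ∀ x ∈ antidiagonal r, c x.1 • (A.mode u x.1 * E x.2) * A.mode v n =
            ∑ z ∈ antidiagonal x.2, c x.1 • (A.mode u x.1 * Z z.1 * E z.2) := by
          intro x hx
          rw [Finset.HasAntidiagonal.mem_antidiagonal] at hx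
          by_cases h0 : x.1 = 0
          · simp [hc, h0]
          · rw [smul_mul_assoc, mul_assoc, ih x.2 (by omega), Finset.mul_sum, Finset.smul_sum]
            simp_rw [mul_assoc]
        have f2 : ∀ x ∈ antidiagonal r, (r : ℂ) • (Z x.1 * E x.2) =
            (∑ y ∈ antidiagonal x.1,
              c y.1 • (A.mode u y.1 * Z y.2 - Z y.2 * A.mode u y.1) * E x.2) +
            ∑ y ∈ antidiagonal x.2, c y.1 • (Z x.1 * A.mode u y.1 * E y.2) := by
          intro x hx
          rw [Finset.HasAntidiagonal.mem_antidiagonal] at hx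
          have : (r : ℂ) = x.1 + x.2 := by exact_mod_cast hx.symm
          rw [this, add_smul, ← smul_mul_assoc, hcomm, Finset.sum_mul, ← mul_smul_comm, hrec,
            Finset.mul_sum]
          simp_rw [mul_smul_comm, mul_assoc]
        rw [Finset.sum_congr rfl f1, Finset.smul_sum, Finset.sum_congr rfl f2,
          Finset.sum_add_distrib]
        have g1 : ∑ x ∈ antidiagonal r, ∑ z ∈ antidiagonal x.2,
            c x.1 • (A.mode u x.1 * Z z.1 * E z.2) =
            ∑ x ∈ antidiagonal r, ∑ y ∈ antidiagonal x.1,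
              c y.1 • (A.mode u y.1 * Z y.2 * E x.2) :=
          (sum_antidiagonal_assoc r fun i j k => c i • (A.mode u i * Z j * E k)).symm
        have g2 : ∑ x ∈ antidiagonal r, ∑ y ∈ antidiagonal x.2,
            c y.1 • (Z x.1 * A.mode u y.1 * E y.2) =
            ∑ x ∈ antidiagonal r, ∑ y ∈ antidiagonal x.1,
              c y.1 • (Z y.2 * A.mode u y.1 * E x.2) := by
          rw [← sum_antidiagonal_assoc r fun i j k => c j • (Z i * A.mode u j * E k)]
          exact Finset.sum_congr rfl fun x _ => (Finset.Nat.sum_antidiagonal_swap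
            (f := fun y => c y.1 • (Z y.2 * A.mode u y.1 * E x.2)))
        rw [g1, g2, ← Finset.sum_add_distrib]
        refine Finset.sum_congr rfl fun x _ => ?_
        rw [← Finset.sum_add_distrib]
        refine Finset.sum_congr rfl fun y _ => ?_
        rw [smul_mul_assoc, sub_mul, smul_sub, sub_add_cancel]
  have := LinearMap.congr_fun (main r) w
  rw [Module.End.mul_apply, LinearMap.sum_apply] at this
  rw [this]
  refine Finset.sum_congr rfl fun x _ => ?_
  rw [Module.End.mul_apply, hZ, LinearMap.sum_apply]

end VertexOperatorAlgebra.IsPrimaryCurrent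

section Scalars

variable {V : Type*} [AddCommGroup V] [Module ℂ V]

theorem binomOp_apply_of_apply_eq {T : Module.End ℂ V} {c : ℂ} {v : V} (hv : T v = c • v) (j : ℕ) :
    binomOp T j v = binomOp (c • (1 : Module.End ℂ V)) j v := by
  refine binomOp_apply_congr (q := T.eigenspace c) (fun v hv => ?_) (fun v hv => ?_) j
    (Module.End.mem_eigenspace_iff.2 hv)
  · rw [Module.End.mem_eigenspace_iff] at hv
    rw [hv]
    exact Submodule.smul_mem _ _ (Module.End.mem_eigenspace_iff.2 hv)
  · rw [Module.End.mem_eigenspace_iff] at hv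
    simpa using hv

theorem exists_binomOp_smul_one (c : ℂ) (j : ℕ) :
    ∃ s : ℂ, binomOp (c • (1 : Module.End ℂ V)) j = s • 1 :=
  ⟨(j.factorial : ℂ)⁻¹ * (descPochhammer ℂ j).eval c, by
    rw [binomOp, ← Algebra.algebraMap_eq_smul_one, Polynomial.aeval_algebraMap_apply,
      Polynomial.coe_aeval_eq_eval, Algebra.algebraMap_eq_smul_one, smul_smul]⟩

end Scalars

theorem VertexOperatorAlgebra.mode_zero_mul_eq_sum {V : Type*} [AddCommGroup V] [Module ℂ V]
    (A : VertexOperatorAlgebra V) (u : V) (X : ℕ → Module.End ℂ V) (r : ℕ) :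
    A.mode u 0 * X r = ∑ i ∈ antidiagonal r, (if i.1 = 0 then (1 : ℂ) else 0) •
        (A.mode u i.1 * X i.2) := by
  rw [Finset.sum_eq_single (0, r)]
  · simp
  · rintro ⟨i, k⟩ hi hne
    rw [Finset.HasAntidiagonal.mem_antidiagonal] at hi
    rw [if_neg, zero_smul]
    rintro rfl
    exact hne (by simp only [zero_add] at hi; rw [hi])
  · simp

/-! ### The operator Δ on the vacuum, on the conformal vector and against L(-1). -/

namespace VertexOperatorAlgebra.IsPrimaryCurrent

variable {V : Type*} [AddCommGroup V] [Module ℂ V] {A : VertexOperatorAlgebra V}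
variable {u : V} {μ : ℂ} (h : A.IsPrimaryCurrent u μ)
include h

theorem deltaExpCoeff_vacuum {r : ℕ} (hr : 0 < r) : A.deltaExpCoeff u r A.vacuum = 0 :=
  h.deltaExpCoeff_eq_zero A.vacuum_mem (by exact_mod_cast hr)

theorem deltaExpCoeff_one : A.deltaExpCoeff u 1 = -A.mode u 1 := by
  have := h.smul_deltaExpCoeff 1
  simpa [Finset.Nat.antidiagonal_succ, deltaExpCoeff_zero] using this

theorem deltaExpCoeff_one_conformal : A.deltaExpCoeff u 1 A.conformal = -u := by
  rw [h.deltaExpCoeff_one, LinearMap.neg_apply, h.mode_one_conformal]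

/-- From $2E_2=-u_1E_1+u_2E_0$ with $E_1\omega=-u$ and $u_2\omega=0$. This is the source of the
constant $\frac12\mu$. -/
theorem deltaExpCoeff_two_conformal : A.deltaExpCoeff u 2 A.conformal = (μ / 2) • A.vacuum := by
  have e := LinearMap.congr_fun (h.smul_deltaExpCoeff 2) A.conformal
  have e2 : A.mode u 2 A.conformal = 0 := h.mode_conformal_eq_zero (n := 2) le_rfl
  simp [Finset.Nat.antidiagonal_succ, deltaExpCoeff_zero, h.deltaExpCoeff_one,
    h.mode_one_conformal, h.mode_one_self, e2] at e
  have e3 := congrArg (fun x => (2 : ℂ)⁻¹ • x) e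
  simpa [smul_smul, div_eq_inv_mul] using e3

theorem deltaExpCoeff_conformal_eq_zero {r : ℕ} (hr : 3 ≤ r) :
    A.deltaExpCoeff u r A.conformal = 0 :=
  h.deltaExpCoeff_eq_zero A.conformal_mem (by exact_mod_cast hr)

/-- `[Δ, L(-1)] = d/dx Δ` for the exponential factor. -/
theorem deltaExpCoeff_L_neg_one (r : ℕ) (w : V) :
    A.deltaExpCoeff u (r + 1) (A.L (-1) w) = A.L (-1) (A.deltaExpCoeff u (r + 1) w) -
      A.mode u 0 (A.deltaExpCoeff u r w) - (r : ℂ) • A.deltaExpCoeff u r w := by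
  -- Since $L(-1)=\omega_0$, the commutator is the conjugation formula for $v=\omega$ and $n=0$.
  have e := h.deltaExpCoeff_mode (r + 1) A.conformal w 0
  have hT : ∀ a j : ℕ, binomOp (-A.mode u 0 - (a : ℂ) • 1) j (A.deltaExpCoeff u a A.conformal) =
      binomOp ((-(a : ℂ)) • (1 : Module.End ℂ V)) j (A.deltaExpCoeff u a A.conformal) := by
    intro a j
    refine binomOp_apply_of_apply_eq ?_ j
    have c : A.mode u 0 (A.deltaExpCoeff u a A.conformal) = 0 := by
      have := LinearMap.congr_fun (h.commute_mode_zero_deltaExpCoeff a) A.conformal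
      rw [Module.End.mul_apply, Module.End.mul_apply, h.mode_zero_conformal, map_zero] at this
      exact this
    simp [c]
  -- All $E_a\omega$ are killed by $u_0$, so the binomials are scalars. For $a=0$ only $j=0$
  -- survives, $a=1$ gives $\binom{-1}{j}=(-1)^j$ times $-u_j$, and $a=2$ gives multiples of
  -- $\mathbf 1_j=0$, as $j\ge0$.
  have hterm : ∀ y : ℕ × ℕ,
      A.mode (binomOp (-A.mode u 0 - (y.1 : ℂ) • 1) y.2 (A.deltaExpCoeff u y.1 A.conformal))
        (0 + y.2) = if y.1 = 0 then (if y.2 = 0 then A.L (-1) else 0) else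
          if y.1 = 1 then (-1 : ℂ) ^ (y.2 + 1) • A.mode u y.2 else 0 := by
    rintro ⟨a, j⟩
    simp only [hT, zero_add]
    match a with
    | 0 =>
      have := binomOp_natCast (V := V) 0 j
      rw [Nat.cast_zero] at this
      simp only [Nat.cast_zero, neg_zero, this, deltaExpCoeff_zero, if_true]
      rcases Nat.eq_zero_or_pos j with rfl | hj
      · simp [L]
      · simp [Nat.choose_eq_zero_of_lt hj, hj.ne']
    | 1 =>
      have := binomOp_neg_succ (V := V) 0 j
      rw [Nat.cast_zero, neg_zero, zero_sub] at this
      simp only [Nat.cast_one, this, h.deltaExpCoeff_one_conformal]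
      simp [mode_smul, mode_neg, pow_succ]
    | 2 =>
      obtain ⟨s, hs⟩ := exists_binomOp_smul_one (V := V) (-((2 : ℕ) : ℂ)) j
      refine LinearMap.ext fun v => ?_
      simp only [hs, h.deltaExpCoeff_two_conformal, LinearMap.smul_apply, Module.End.one_apply,
        mode_smul, mode_vacuum]
      rw [if_neg (by omega)]
      simp
    | a + 3 =>
      rw [h.deltaExpCoeff_conformal_eq_zero (by omega)]
      simp
  simp only [hterm] at e
  have hsum : ∀ s : ℕ, ∑ y ∈ antidiagonal (s + 1), (if y.1 = 0 then
      (if y.2 = 0 then A.L (-1) else 0) else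
          if y.1 = 1 then (-1 : ℂ) ^ (y.2 + 1) • A.mode u y.2 else 0) =
      (-1 : ℂ) ^ (s + 1) • A.mode u s := by
    intro s
    rw [Finset.sum_eq_single (1, s)]
    · simp
    · rintro ⟨a, j⟩ hi hne
      rw [Finset.HasAntidiagonal.mem_antidiagonal] at hi
      simp only at hi ⊢
      split_ifs with h1 h2 h2
      · omega
      · rfl
      · exact absurd (by rw [h2]; congr 1; omega) hne
      · rfl
    · intro hn
      exact absurd (Finset.HasAntidiagonal.mem_antidiagonal.2 (by simp [add_comm])) hn
  simp only [← LinearMap.sum_apply] at e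
  rw [Finset.Nat.sum_antidiagonal_succ] at e
  simp only [hsum] at e
  have e0 : A.mode A.conformal 0 = A.L (-1) := rfl
  rw [e0] at e
  rw [e]
  -- The remaining sum $\sum_{m\ge0}(-1)^mu_mE_{r-m}$ equals $u_0E_r+rE_r$ by the Euler recursion.
  have f1 := LinearMap.congr_fun (A.mode_zero_mul_eq_sum u (A.deltaExpCoeff u) r) w
  have f2 := LinearMap.congr_fun (h.smul_deltaExpCoeff r) w
  simp only [Module.End.mul_apply, LinearMap.smul_apply] at f1 f2
  rw [f1, f2, sub_sub, ← LinearMap.add_apply, ← Finset.sum_add_distrib, sub_eq_add_neg,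
    LinearMap.sum_apply _ _ w, ← Finset.sum_neg_distrib]
  congr 1
  · simp
  · refine Finset.sum_congr rfl fun i _ => ?_
    rcases Nat.eq_zero_or_pos i.1 with h0 | h0
    · simp [h0]
    · simp [h0.ne', pow_succ]

/-! ### The operator `Δ` on generalized eigenvectors of `u₀` -/

theorem dpow_neg_nilPart_deltaExpCoeff (r t : ℕ) (v : V) :
    dpow (-nilPart (A.mode u 0)) t (A.deltaExpCoeff u r v) =
      A.deltaExpCoeff u r (dpow (-nilPart (A.mode u 0)) t v) := by
  have := commute_nilPart h.isSumOfGenEigenspaces (h.commute_mode_zero_deltaExpCoeff r).symm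
  exact (LinearMap.congr_fun (commute_dpow this.neg_right t) v).symm

theorem deltaExpCoeff_mem {β : ℂ} {v : V} (hv : v ∈ (A.mode u 0).maxGenEigenspace β) (r : ℕ) :
    A.deltaExpCoeff u r v ∈ (A.mode u 0).maxGenEigenspace β :=
  mem_maxGenEigenspace_of_commute (h.commute_mode_zero_deltaExpCoeff r).symm hv

theorem deltaCoeff_apply {β : ℂ} {v : V} (hv : v ∈ (A.mode u 0).maxGenEigenspace β) {R : ℕ}
    (hR : ∀ r, R ≤ r → A.deltaExpCoeff u r v = 0) (s : ℂ) (t : ℕ) :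
    A.deltaCoeff u s t v = ∑ r ∈ Finset.range R, if s + r = -β then
      dpow (-nilPart (A.mode u 0)) t (A.deltaExpCoeff u r v) else 0 := by
  have hfin : ∀ v, (Function.support fun r : ℕ =>
      (powCoeff (-A.mode u 0) (s + r) t * A.deltaExpCoeff u r) v).Finite := fun v => by
    obtain ⟨R, hR⟩ := h.exists_deltaExpCoeff_eq_zero v
    refine (Finset.range R).finite_toSet.subset fun r hr => ?_
    by_contra hn
    exact hr (by simp only; rw [Module.End.mul_apply, hR r (by simpa using hn), map_zero])
  rw [deltaCoeff, locSum_apply_eq_sum hfin v (Finset.range R)]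
  · refine Finset.sum_congr rfl fun r _ => ?_
    rw [Module.End.mul_apply,
      powCoeff_neg_apply h.isSumOfGenEigenspaces (h.deltaExpCoeff_mem hv r)]
  · intro r hr
    rw [Module.End.mul_apply, hR r (by simpa using hr), map_zero]

theorem deltaCoeff_apply_eq_zero {β : ℂ} {v : V} (hv : v ∈ (A.mode u 0).maxGenEigenspace β)
    {R K : ℕ} (hR : ∀ r, R ≤ r → A.deltaExpCoeff u r v = 0)
    (hK : (nilPart (A.mode u 0) ^ K) v = 0) {s : ℂ} {t : ℕ}
    (hst : (s, t) ∉ (Finset.range R ×ˢ Finset.range K).image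
      fun p : ℕ × ℕ => (-β - (p.1 : ℂ), p.2)) :
    A.deltaCoeff u s t v = 0 := by
  rw [h.deltaCoeff_apply hv hR]
  refine Finset.sum_eq_zero fun r hr => ?_
  split_ifs with hs
  · have ht : K ≤ t := by
      by_contra hlt
      refine hst (Finset.mem_image.2 ⟨(r, t), ?_, ?_⟩)
      · simpa using ⟨by simpa using hr, by omega⟩
      · simp only [Prod.mk.injEq, and_true]; rw [← hs]; ring
    rw [h.dpow_neg_nilPart_deltaExpCoeff, dpow_apply_eq_zero (K := K) _ ht, map_zero]
    rw [neg_pow]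
    rcases neg_one_pow_eq_or (Module.End ℂ V) K with e | e <;> simp [e, hK]
  · rfl

theorem finite_support_deltaCoeff (v : V) :
    (Function.support fun p : ℂ × ℕ => A.deltaCoeff u p.1 p.2 v).Finite := by
  refine h.isSumOfGenEigenspaces.induction
    (p := fun v => (Function.support fun p : ℂ × ℕ => A.deltaCoeff u p.1 p.2 v).Finite)
    (fun β v hv => ?_) (fun v w hv hw => ?_) v
  · obtain ⟨R, hR⟩ := h.exists_deltaExpCoeff_eq_zero v
    obtain ⟨K, hK⟩ := isLocNil_nilPart h.isSumOfGenEigenspaces v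
    refine ((Finset.range R ×ˢ Finset.range K).image
      fun p : ℕ × ℕ => (-β - (p.1 : ℂ), p.2)).finite_toSet.subset fun p hp => ?_
    by_contra hn
    exact hp (h.deltaCoeff_apply_eq_zero hv hR hK hn)
  · refine (hv.union hw).subset fun c hc => ?_
    by_contra hn
    simp only [Set.mem_union, Function.mem_support, not_or, not_not] at hn
    exact hc (by simp [hn.1, hn.2])

/-- `Δ(x) v` for a generalized eigenvector `v` of `u₀`. -/
theorem delta_apply {β : ℂ} {v : V} (hv : v ∈ (A.mode u 0).maxGenEigenspace β) {R K : ℕ}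
    (hR : ∀ r, R ≤ r → A.deltaExpCoeff u r v = 0)
    (hK : (nilPart (A.mode u 0) ^ K) v = 0) :
    A.delta u v = ∑ r ∈ Finset.range R, ∑ t ∈ Finset.range K,
      Finsupp.single (-β - (r : ℂ), t)
        (dpow (-nilPart (A.mode u 0)) t (A.deltaExpCoeff u r v)) := by
  ext ⟨s, t⟩
  rw [delta, locFamily_apply h.finite_support_deltaCoeff, h.deltaCoeff_apply hv hR,
    Finsupp.finsetSum_apply]
  refine Finset.sum_congr rfl fun r _ => ?_
  rw [Finsupp.finsetSum_apply]
  have hz : ∀ t, K ≤ t → dpow (-nilPart (A.mode u 0)) t (A.deltaExpCoeff u r v) = 0 := by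
    intro t ht
    rw [h.dpow_neg_nilPart_deltaExpCoeff, dpow_apply_eq_zero (K := K) _ ht, map_zero]
    rw [neg_pow]
    rcases neg_one_pow_eq_or (Module.End ℂ V) K with e | e <;> simp [e, hK]
  have hs : s + r = -β ↔ -β - (r : ℂ) = s :=
    ⟨fun e => by rw [← e]; ring, fun e => by rw [← e]; ring⟩
  simp only [Finsupp.single_apply, Prod.mk.injEq, hs]
  split_ifs with h1
  · by_cases ht : t < K
    · rw [Finset.sum_eq_single t]
      · rw [if_pos ⟨h1, rfl⟩]
      · intro b _ hb; rw [if_neg (fun e => hb e.2)]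
      · intro hn; exact absurd (Finset.mem_range.2 ht) hn
    · rw [hz t (by omega), Finset.sum_eq_zero]
      intro b hb
      rw [if_neg]
      rintro ⟨-, rfl⟩
      exact ht (Finset.mem_range.1 hb)
  · exact (Finset.sum_eq_zero fun b _ => if_neg fun e => h1 e.1).symm

end VertexOperatorAlgebra.IsPrimaryCurrent

/-! ### Coefficients of the twisted vertex operator map. -/

section Twist

variable {V : Type*} [AddCommGroup V] [Module ℂ V] {A : VertexOperatorAlgebra V}
  {W : Type*} [AddCommGroup W] [Module ℂ W]

theorem LogSeries.shift_apply (s : ℂ) (t : ℕ) (f : LogSeries W) (k : ℕ) (n : ℂ) :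
    LogSeries.shift (W := W) s t f k n = if t ≤ k then f (k - t) (n - s) else 0 := by
  rw [LogSeries.shift, LinearMap.comp_apply]
  change Finsupp.mapDomain (fun k => k + t) (Finsupp.mapRange.linearMap
    (LinearMap.funLeft ℂ W fun n : ℂ => n - s) f) k n = _
  split_ifs with h
  · obtain ⟨j, rfl⟩ := Nat.exists_eq_add_of_le' h
    rw [Finsupp.mapDomain_apply (add_left_injective t), Nat.add_sub_cancel]
    rfl
  · rw [Finsupp.mapDomain_of_notMem_range]
    · rfl
    · rintro ⟨j, rfl⟩
      simp at h

/-- The coefficients of `Y_W` as a trilinear operation. -/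
def coeffHom (YW : V →ₗ[ℂ] W →ₗ[ℂ] LogSeries W) (n : ℂ) (k : ℕ) : V →ₗ[ℂ] Module.End ℂ W :=
  LinearMap.compRight ℂ (LinearMap.proj n ∘ₗ Finsupp.lapply k) ∘ₗ YW

theorem coeffHom_apply (YW : V →ₗ[ℂ] W →ₗ[ℂ] LogSeries W) (n : ℂ) (k : ℕ) (v : V) :
    coeffHom YW n k v = coeffOp YW v n k := rfl

theorem coeffOp_apply (YW : V →ₗ[ℂ] W →ₗ[ℂ] LogSeries W) (n : ℂ) (k : ℕ) (v : V) (w : W) :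
    coeffOp YW v n k w = YW v w k n := rfl

variable (YW : V →ₗ[ℂ] W →ₗ[ℂ] LogSeries W)

@[simp] theorem coeffOp_zero (n : ℂ) (k : ℕ) : coeffOp YW 0 n k = 0 := map_zero (coeffHom YW n k)

theorem coeffOp_add (v v' : V) (n : ℂ) (k : ℕ) :
    coeffOp YW (v + v') n k = coeffOp YW v n k + coeffOp YW v' n k :=
  map_add (coeffHom YW n k) v v'

theorem coeffOp_neg (v : V) (n : ℂ) (k : ℕ) :
    coeffOp YW (-v) n k = -coeffOp YW v n k := map_neg (coeffHom YW n k) v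

theorem coeffOp_sub (v v' : V) (n : ℂ) (k : ℕ) :
    coeffOp YW (v - v') n k = coeffOp YW v n k - coeffOp YW v' n k :=
  map_sub (coeffHom YW n k) v v'

theorem coeffOp_smul (c : ℂ) (v : V) (n : ℂ) (k : ℕ) :
    coeffOp YW (c • v) n k = c • coeffOp YW v n k := map_smul (coeffHom YW n k) c v

theorem coeffOp_sum {ι : Type*} (s : Finset ι) (f : ι → V) (n : ℂ) (k : ℕ) :
    coeffOp YW (∑ i ∈ s, f i) n k = ∑ i ∈ s, coeffOp YW (f i) n k :=
  map_sum (coeffHom YW n k) f s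

theorem VertexOperatorAlgebra.IsPrimaryCurrent.deltaTwist_apply {u : V} {μ : ℂ}
    (h : A.IsPrimaryCurrent u μ)
    {β : ℂ} {v : V} (hv : v ∈ (A.mode u 0).maxGenEigenspace β) {R K : ℕ}
    (hR : ∀ r, R ≤ r → A.deltaExpCoeff u r v = 0)
    (hK : (nilPart (A.mode u 0) ^ K) v = 0) (w : W) :
    deltaTwist A u YW v w = ∑ r ∈ Finset.range R, ∑ t ∈ Finset.range K,
      LogSeries.shift (W := W) (-β - (r : ℂ)) t
        (YW (dpow (-nilPart (A.mode u 0)) t (A.deltaExpCoeff u r v)) w) := by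
  rw [deltaTwist, LinearMap.comp_apply, h.delta_apply hv hR hK]
  simp only [map_sum, LinearMap.sum_apply]
  refine Finset.sum_congr rfl fun r _ => Finset.sum_congr rfl fun t _ => ?_
  rw [Finsupp.lsum_single]
  rfl

/-- A term of $\Delta(x)v$ with $x^{-\beta-r}(\log x)^t$ meets the coefficient of $Y_W$ at
$x^{n+\beta+r}(\log x)^{k-t}$. This is the working form of the twist for a generalized eigenvector
of $u_0$. -/
theorem VertexOperatorAlgebra.IsPrimaryCurrent.coeffOp_deltaTwist {u : V} {μ : ℂ}
    (h : A.IsPrimaryCurrent u μ)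
    {β : ℂ} {v : V} (hv : v ∈ (A.mode u 0).maxGenEigenspace β) {R : ℕ}
    (hR : ∀ r, R ≤ r → A.deltaExpCoeff u r v = 0) (n : ℂ) (k : ℕ) :
    coeffOp (deltaTwist A u YW) v n k = ∑ r ∈ Finset.range R, ∑ i ∈ antidiagonal k,
      coeffOp YW (dpow (-nilPart (A.mode u 0)) i.1 (A.deltaExpCoeff u r v)) (n + β + r) i.2 := by
  refine LinearMap.ext fun w => ?_
  obtain ⟨K', hK'⟩ := isLocNil_nilPart h.isSumOfGenEigenspaces v
  -- The bound must exceed the nilpotency order of $v$ and also all powers of the logarithm up to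
  -- $k$.
  set K := K' + (k + 1)
  have hK := Module.End.pow_map_zero_of_le (show K' ≤ K by omega) hK'
  rw [coeffOp_apply, h.deltaTwist_apply YW hv hR hK, Finsupp.finsetSum_apply, Finset.sum_apply,
    LinearMap.sum_apply]
  refine Finset.sum_congr rfl fun r _ => ?_
  rw [Finsupp.finsetSum_apply, Finset.sum_apply, LinearMap.sum_apply,
    Finset.Nat.sum_antidiagonal_eq_sum_range_succ_mk]
  have hs : Finset.range (k + 1) ⊆ Finset.range K := by simp [K]
  rw [← Finset.sum_subset hs]
  · refine Finset.sum_congr rfl fun t ht => ?_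
    have ht : t ≤ k := by simpa [Nat.lt_succ_iff] using ht
    have e : n - (-β - (r : ℂ)) = n + β + r := by ring
    rw [LogSeries.shift_apply, if_pos ht, coeffOp_apply, e]
  · intro t _ ht
    rw [LogSeries.shift_apply, if_neg]
    simpa [Nat.lt_succ_iff] using ht

end Twist

/-! ### Eigenspaces of products and exponentials. -/

section Operators

variable {V : Type*} [AddCommGroup V] [Module ℂ V]

theorem dpow_apply_congr {S N : Module.End ℂ V} {q : Submodule ℂ V} (hN : ∀ v ∈ q, N v ∈ q)
    (h : ∀ v ∈ q, S v = N v) (k : ℕ) {v : V} (hv : v ∈ q) : dpow S k v = dpow N k v := by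
  have : ∀ k, (N ^ k) v ∈ q ∧ (S ^ k) v = (N ^ k) v := by
    intro k
    induction k with
    | zero => simpa
    | succ k ih =>
      rw [pow_succ', pow_succ', Module.End.mul_apply, Module.End.mul_apply, ih.2]
      exact ⟨hN _ ih.1, h _ ih.1⟩
  rw [dpow, dpow, LinearMap.smul_apply, LinearMap.smul_apply, (this k).2]

theorem mem_maxGenEigenspace_of_apply_eq {T N : Module.End ℂ V} {c : ℂ} {q : Submodule ℂ V}
    (hN : ∀ v ∈ q, N v ∈ q) (h : ∀ v ∈ q, T v = c • v + N v) (hl : IsLocNil N) {v : V}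
    (hv : v ∈ q) : v ∈ T.maxGenEigenspace c := by
  obtain ⟨k, hk⟩ := hl v
  refine (Module.End.mem_maxGenEigenspace _ _ _).2 ⟨k, ?_⟩
  have e := dpow_apply_congr (S := T - c • 1) hN (fun v hv => by simp [h v hv]) k hv
  rw [dpow_apply_eq_zero hk le_rfl, dpow, LinearMap.smul_apply, smul_eq_zero_iff_right] at e
  · exact e
  · exact inv_ne_zero (Nat.cast_ne_zero.2 (Nat.factorial_ne_zero _))

/-- $ST-st=(S-s)T+s(T-t)$ is a sum of commuting operators, each nilpotent on $v$. -/
theorem mem_maxGenEigenspace_mul {S T : Module.End ℂ V} (h : Commute S T) {s t : ℂ} {v : V}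
    (hs : v ∈ S.maxGenEigenspace s) (ht : v ∈ T.maxGenEigenspace t) :
    v ∈ (S * T).maxGenEigenspace (s * t) := by
  obtain ⟨k, hk⟩ := (Module.End.mem_maxGenEigenspace _ _ _).1 hs
  obtain ⟨l, hl⟩ := (Module.End.mem_maxGenEigenspace _ _ _).1 ht
  set S' := S - s • (1 : Module.End ℂ V)
  set T' := T - t • (1 : Module.End ℂ V)
  have hS'T : Commute S' T := h.sub_left ((Commute.one_left T).smul_left s)
  have hS'T' : Commute S' T' := hS'T.sub_right ((Commute.one_right S').smul_right t)
  have hTT' : Commute T T' := (Commute.refl T).sub_right ((Commute.one_right T).smul_right t)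
  have h1 : v ∈ (S' * T).maxGenEigenspace 0 := by
    refine (Module.End.mem_maxGenEigenspace _ _ _).2 ⟨k, ?_⟩
    rw [zero_smul, sub_zero, hS'T.eq, hS'T.symm.mul_pow, Module.End.mul_apply, hk, map_zero]
  have h2 : v ∈ (s • T').maxGenEigenspace 0 := by
    refine (Module.End.mem_maxGenEigenspace _ _ _).2 ⟨l, ?_⟩
    rw [zero_smul, sub_zero, smul_pow, LinearMap.smul_apply, hl, smul_zero]
  have hc : Commute (S' * T) (s • T') := (hS'T'.mul_left hTT').smul_right s
  have h3 := Module.End.genEigenspace_inf_le_add _ _ 0 0 ⊤ ⊤ hc ⟨h1, h2⟩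
  have e : S' * T + s • T' = S * T - (s * t) • 1 := by
    simp [S', T', sub_mul, smul_sub, smul_smul]
  rw [e, add_zero, top_add] at h3
  obtain ⟨m, hm⟩ := (Module.End.mem_maxGenEigenspace _ _ _).1 h3
  rw [zero_smul, sub_zero] at hm
  exact (Module.End.mem_maxGenEigenspace _ _ _).2 ⟨m, hm⟩

/-- $e^N-1$ is divisible by $N$, so each application lowers the nilpotency order by at least one. -/
theorem expNil_sub_one_pow_apply_eq_zero {N : Module.End ℂ V} (hN : IsLocNil N) (K : ℕ) {v : V}
    (hK : (N ^ K) v = 0) : ((expNil N - 1) ^ K) v = 0 := by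
  induction K generalizing v with
  | zero => simpa using hK
  | succ K ih =>
    rw [pow_succ, Module.End.mul_apply]
    refine ih ?_
    rw [LinearMap.sub_apply, expNil_apply hN hK, Finset.sum_range_succ', dpow_zero,
      add_sub_cancel_right, map_sum]
    refine Finset.sum_eq_zero fun j _ => ?_
    rw [dpow, LinearMap.smul_apply, map_smul, ← Module.End.mul_apply, ← pow_add,
      Module.End.pow_map_zero_of_le (by omega) hK, smul_zero]

theorem isLocNil_expNil_sub_one {N : Module.End ℂ V} (hN : IsLocNil N) :
    IsLocNil (expNil N - 1) := fun v => by
  obtain ⟨K, hK⟩ := hN v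
  exact ⟨K, expNil_sub_one_pow_apply_eq_zero hN K hK⟩

theorem mem_maxGenEigenspace_expOp_smul {T : Module.End ℂ V} (hT : IsSumOfGenEigenspaces T) {z : ℂ}
    (hz : z ≠ 0) {c : ℂ} {v : V} (hv : v ∈ T.maxGenEigenspace c) :
    v ∈ (expOp (z • T)).maxGenEigenspace (Complex.exp (z * c)) := by
  have hn := (isLocNil_nilPart hT).smul z
  have hc : Commute T (expNil (z • nilPart T)) :=
    commute_expNil hn ((commute_nilPart hT (Commute.refl T)).smul_right z)
  refine mem_maxGenEigenspace_of_apply_eq (q := T.maxGenEigenspace c)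
    (N := Complex.exp (z * c) • (expNil (z • nilPart T) - 1)) (fun v hv => ?_) (fun v hv => ?_)
    ((isLocNil_expNil_sub_one hn).smul _) hv
  · exact Submodule.smul_mem _ _ (Submodule.sub_mem _ (mem_maxGenEigenspace_of_commute hc.symm hv)
      (by simpa using hv))
  · rw [expOp_smul_apply hT hz hv, LinearMap.smul_apply, LinearMap.sub_apply, smul_sub]
    simp

theorem expOp_smul_apply_of_apply_eq_zero {T : Module.End ℂ V} (hT : IsSumOfGenEigenspaces T)
    {z : ℂ} (hz : z ≠ 0) {v : V} (hv : T v = 0) : expOp (z • T) v = v := by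
  have h0 : v ∈ T.maxGenEigenspace 0 :=
    (Module.End.mem_maxGenEigenspace _ _ _).2 ⟨1, by simp [hv]⟩
  have h1 : ((z • nilPart T) ^ 1) v = 0 := by simp [nilPart_apply_of_mem hT h0, hv]
  rw [expOp_smul_apply hT hz h0, expNil_apply ((isLocNil_nilPart hT).smul z) h1]
  simp

/-! ### The logarithm of a locally finite automorphism -/

section LogOp

variable {g : Module.End ℂ V} (hg : IsSumOfGenEigenspaces g) (hi : Function.Injective g)
include hg

theorem commute_unipotentPart {X : Module.End ℂ V} (h : Commute X g) :
    Commute X (unipotentPart g) :=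
  (commute_spectralMap hg h _).mul_right h

theorem unipotentPart_apply {c : ℂ} {v : V} (hv : v ∈ g.maxGenEigenspace c) :
    unipotentPart g v = c⁻¹ • g v := by
  rw [unipotentPart, Module.End.mul_apply, spectralMap_apply_of_mem hg _
    (mem_maxGenEigenspace_of_commute (Commute.refl g) hv)]

include hi

omit hg in
theorem eq_zero_of_mem_maxGenEigenspace_zero {v : V} (hv : v ∈ g.maxGenEigenspace 0) : v = 0 := by
  obtain ⟨k, hk⟩ := (Module.End.mem_maxGenEigenspace _ _ _).1 hv
  rw [zero_smul, sub_zero, Module.End.pow_apply] at hk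
  exact hi.iterate k (hk.trans (by rw [← Module.End.pow_apply, map_zero]))

/-- On the eigenvalue $c$ this is $c^{-1}g-1=c^{-1}(g-c)$. Injectivity of $g$ excludes $c=0$, where
the convention $0^{-1}=0$ would break it. -/
theorem unipotentPart_sub_one : unipotentPart g - 1 = spectralMap g (fun c => c⁻¹) * nilPart g := by
  refine hg.ext fun c v hv => ?_
  rw [LinearMap.sub_apply, unipotentPart_apply hg hv, Module.End.mul_apply,
    spectralMap_apply_of_mem hg _ (nilPart_mem hg hv), nilPart_apply_of_mem hg hv, smul_sub,
    Module.End.one_apply]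
  rcases eq_or_ne c 0 with rfl | hc
  · rw [eq_zero_of_mem_maxGenEigenspace_zero hi hv]; simp
  · rw [smul_smul, inv_mul_cancel₀ hc, one_smul]

theorem isLocNil_unipotentPart_sub_one : IsLocNil (unipotentPart g - 1) := by
  rw [unipotentPart_sub_one hg hi]
  refine (isLocNil_nilPart hg).mul_left ?_
  exact commute_nilPart hg (commute_spectralMap hg (Commute.refl g) _).symm

theorem smul_logNilpotent : (2 * Real.pi * Complex.I : ℂ) • logNilpotent g =
    evalNil (unipotentPart g - 1) logSeries := by
  have hM := isLocNil_unipotentPart_sub_one hg hi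
  rw [evalNil_logSeries_eq hM]
  refine LinearMap.ext fun v => ?_
  obtain ⟨K, hK⟩ := hM v
  have hz : ∀ (c : ℕ → ℂ), ∀ j ∉ Finset.range K,
      (c j • (unipotentPart g - 1) ^ (j + 1)) v = 0 := fun c j hj => by
    rw [LinearMap.smul_apply, Module.End.pow_map_zero_of_le (by simp at hj; omega) hK, smul_zero]
  rw [LinearMap.smul_apply, logNilpotent, locSum_apply_eq_sum (hM.finite_support_smul_pow _ (· + 1)
    fun _ => by omega) v _ (hz _), locSum_apply_eq_sum (hM.finite_support_smul_pow _ (· + 1)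
    fun _ => by omega) v _ (hz _), Finset.smul_sum]
  refine Finset.sum_congr rfl fun j _ => ?_
  rw [LinearMap.smul_apply, LinearMap.smul_apply, smul_smul]
  congr 1
  have := Complex.two_pi_I_ne_zero
  have h2 : (j : ℂ) + 1 ≠ 0 := Nat.cast_add_one_ne_zero j
  field_simp

theorem logNilpotent_eq : logNilpotent g = (2 * Real.pi * Complex.I : ℂ)⁻¹ •
    evalNil (unipotentPart g - 1) logSeries := by
  rw [← smul_logNilpotent hg hi, smul_smul, inv_mul_cancel₀ Complex.two_pi_I_ne_zero, one_smul]

theorem isLocNil_logNilpotent : IsLocNil (logNilpotent g) := by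
  rw [logNilpotent_eq hg hi]
  exact (isLocNil_evalNil_logSeries (isLocNil_unipotentPart_sub_one hg hi)).smul _

theorem commute_logNilpotent {X : Module.End ℂ V} (h : Commute X g) :
    Commute X (logNilpotent g) := by
  rw [logNilpotent_eq hg hi]
  exact (commute_evalNil (isLocNil_unipotentPart_sub_one hg hi)
    ((commute_unipotentPart hg h).sub_right (Commute.one_right X)) _).smul_right _

theorem expNil_smul_logNilpotent :
    expNil ((2 * Real.pi * Complex.I : ℂ) • logNilpotent g) = unipotentPart g := by
  rw [smul_logNilpotent hg hi, expNil_evalNil_logSeries (isLocNil_unipotentPart_sub_one hg hi),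
    add_sub_cancel]

theorem commute_logOp {X : Module.End ℂ V} (h : Commute X g) : Commute X (logOp g) :=
  (commute_spectralMap hg h _).add_right (commute_logNilpotent hg hi h)

theorem logNilpotent_mem {c : ℂ} {v : V} (hv : v ∈ g.maxGenEigenspace c) :
    logNilpotent g v ∈ g.maxGenEigenspace c :=
  mem_maxGenEigenspace_of_commute (commute_logNilpotent hg hi (Commute.refl g)).symm hv

end LogOp

theorem logOp_apply {g : Module.End ℂ V} (hg : IsSumOfGenEigenspaces g) {c : ℂ} {v : V}
    (hv : v ∈ g.maxGenEigenspace c) :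
    logOp g v = (logBranch 0 c / (2 * Real.pi * Complex.I)) • v + logNilpotent g v := by
  rw [logOp, LinearMap.add_apply, logSemisimple, spectralMap_apply_of_mem hg _ hv]

theorem exp_logBranch (p : ℤ) {z : ℂ} (hz : z ≠ 0) : Complex.exp (logBranch p z) = z := by
  have h1 : Complex.exp (logBranch p z) = Complex.exp (Complex.log z) := by
    rw [Complex.exp_eq_exp_iff_exists_int]
    rw [logBranch, Complex.log]
    split_ifs
    · exact ⟨p + 1, by push_cast; ring⟩
    · exact ⟨p, by ring⟩
  rw [h1, Complex.exp_log hz]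

theorem logBranch_succ (p : ℤ) (z : ℂ) :
    logBranch (p + 1) z = logBranch p z + 2 * Real.pi * Complex.I := by
  simp only [logBranch]; push_cast; ring

/-- Both sides have the same exponential after multiplication by $2\pi i$: on joint generalized
eigenvectors the unipotent part of the product is the product of the unipotent parts. Logarithms of
commuting unipotents are unique. No such exact equality can be expected of the semisimple
logarithms, where the choice of branch intervenes. -/
theorem logNilpotent_mul_expOp {g T : Module.End ℂ V} (hg : IsSumOfGenEigenspaces g)
    (hi : Function.Injective g) (hT : IsSumOfGenEigenspaces T) (hc : Commute g T)
    (hh : IsSumOfGenEigenspaces (g * expOp ((2 * Real.pi * Complex.I : ℂ) • T)))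
    (hhi : Function.Injective (g * expOp ((2 * Real.pi * Complex.I : ℂ) • T))) :
    logNilpotent (g * expOp ((2 * Real.pi * Complex.I : ℂ) • T)) = logNilpotent g + nilPart T := by
  set τ : ℂ := 2 * Real.pi * Complex.I
  have hτ : τ ≠ 0 := Complex.two_pi_I_ne_zero
  set h := g * expOp (τ • T) with hdef
  have hge : Commute g (expOp (τ • T)) := commute_expOp_smul hT hτ hc
  have hgh : Commute g h := (Commute.refl g).mul_right hge
  have hTh : Commute T h := hc.symm.mul_right (commute_expOp_smul hT hτ (Commute.refl T))
  have ng := isLocNil_logNilpotent hg hi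
  have nT := isLocNil_nilPart hT
  have cgT : Commute (logNilpotent g) (nilPart T) :=
    commute_nilPart hT (commute_logNilpotent hg hi hc.symm).symm
  have hlg : Commute (logNilpotent h) g := (commute_logNilpotent hh hhi hgh).symm
  have hlT : Commute (logNilpotent h) T := (commute_logNilpotent hh hhi hTh).symm
  have e : τ • logNilpotent h = τ • logNilpotent g + τ • nilPart T := by
    refine eq_of_expNil_eq ((isLocNil_logNilpotent hh hhi).smul τ)
      ((ng.smul τ).add (nT.smul τ) ((cgT.smul_left τ).smul_right τ)) ?_ ?_
    · exact (((commute_logNilpotent hg hi hlg).smul_left τ).smul_right τ).add_right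
        (((commute_nilPart hT hlT).smul_left τ).smul_right τ)
    · rw [expNil_add (ng.smul τ) (nT.smul τ) ((cgT.smul_left τ).smul_right τ),
        expNil_smul_logNilpotent hh hhi, expNil_smul_logNilpotent hg hi]
      refine hT.ext fun β v hv => ?_
      refine hg.induction_of_stable (q := T.maxGenEigenspace β)
        (p := fun v => unipotentPart h v = (unipotentPart g * expNil (τ • nilPart T)) v)
        (fun c v hv => mem_maxGenEigenspace_of_commute (commute_eigenProj hg hc.symm c).symm hv)
        (fun c v hv hv' => ?_) (fun v w hv hw => by rw [map_add, map_add, hv, hw]) hv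
      have hv2 : v ∈ h.maxGenEigenspace (c * Complex.exp (τ * β)) :=
        mem_maxGenEigenspace_mul hge hv' (mem_maxGenEigenspace_expOp_smul hT hτ hv)
      have hcom : Commute (expNil (τ • nilPart T)) g :=
        (commute_expNil (nT.smul τ) ((commute_nilPart hT hc).smul_right τ)).symm
      rw [unipotentPart_apply hh hv2, hdef, Module.End.mul_apply, Module.End.mul_apply,
        unipotentPart_apply hg (mem_maxGenEigenspace_of_commute hcom hv'),
        expOp_smul_apply hT hτ hv, map_smul, smul_smul, mul_inv,
        mul_assoc, inv_mul_cancel₀ (Complex.exp_ne_zero _), mul_one]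
  have := congrArg (fun X => τ⁻¹ • X) e
  simpa [smul_smul, inv_mul_cancel₀ hτ] using this

end Operators

/-! ### The inner automorphism and the delta-function side of the Jacobi identity. -/

namespace VertexOperatorAlgebra

variable {V : Type*} [AddCommGroup V] [Module ℂ V] {A : VertexOperatorAlgebra V}

/-- The operator $u_0$ is a derivation of every $n$-th product and annihilates $\mathbf 1$ and
$\omega$. -/
theorem IsPrimaryCurrent.isAutomorphism_innerAut {u : V} {μ : ℂ} (h : A.IsPrimaryCurrent u μ) :
    A.IsAutomorphism (A.innerAut u) where
  bijective := bijective_expOp_smul h.isSumOfGenEigenspaces Complex.two_pi_I_ne_zero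
  map_mode v w n := expOp_smul_apply_apply (B := A.modeHom n) h.isSumOfGenEigenspaces
    h.isSumOfGenEigenspaces h.isSumOfGenEigenspaces
    (fun v w => A.mode_zero_leibniz u v w n) Complex.two_pi_I_ne_zero v w
  map_vacuum := expOp_smul_apply_of_apply_eq_zero h.isSumOfGenEigenspaces
    Complex.two_pi_I_ne_zero (A.mode_apply_vacuum_of_nonneg u le_rfl)
  map_conformal := expOp_smul_apply_of_apply_eq_zero h.isSumOfGenEigenspaces
    Complex.two_pi_I_ne_zero h.mode_zero_conformal

theorem IsPrimaryCurrent.logNilpotent_mul_innerAut {u : V} {μ : ℂ} (h : A.IsPrimaryCurrent u μ)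
    {g : Module.End ℂ V} (hg : A.IsAutomorphism g) (hgu : g u = u) :
    logNilpotent (g * A.innerAut u) = logNilpotent g + nilPart (A.mode u 0) :=
  logNilpotent_mul_expOp hg.isSumOfGenEigenspaces hg.bijective.injective h.isSumOfGenEigenspaces
    (hg.commute_mode hgu 0) (hg.mul h.isAutomorphism_innerAut).isSumOfGenEigenspaces
    (hg.mul h.isAutomorphism_innerAut).bijective.injective

variable {W : Type*} [AddCommGroup W] [Module ℂ W]

/-- On this eigenspace $q+\mathcal L_g$ is the scalar $q+\alpha$ plus $\mathcal N_g$, with $\alpha$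
the chosen logarithm of $c$; hence a single exponent occurs. -/
theorem IsAutomorphism.ratioPowCoeff_apply {g : Module.End ℂ V} (hg : A.IsAutomorphism g) {c : ℂ}
    {v : V} (hv : v ∈ g.maxGenEigenspace c) (q : ℤ) (s : ℂ) (j k i : ℕ) :
    ratioPowCoeff ((q : Module.End ℂ V) + logOp g) s j k i v =
      if s = q + logBranch 0 c / (2 * Real.pi * Complex.I) then
        binomOp (s • 1 + logNilpotent g) j (dpow (logNilpotent g) i (dpow (-logNilpotent g) k v))
      else 0 := by
  have hS := hg.isSumOfGenEigenspaces
  have hi := hg.bijective.injective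
  set N := logNilpotent g with hN
  set T := (q : Module.End ℂ V) + logOp g with hT
  set α := logBranch 0 c / (2 * Real.pi * Complex.I)
  have hTL : Commute T (A.L 0) :=
    ((Int.cast_commute q _).add_left (commute_logOp hS hi (hg.commute_L 0).symm).symm)
  have hTS : IsSumOfGenEigenspaces T := A.isSumOfGenEigenspaces hTL
  have hNm : ∀ v ∈ g.maxGenEigenspace c, N v ∈ g.maxGenEigenspace c :=
    fun v hv => logNilpotent_mem hS hi hv
  have hTv : ∀ v ∈ g.maxGenEigenspace c, T v = ((q : ℂ) + α) • v + N v := by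
    intro v hv
    rw [hT, LinearMap.add_apply, logOp_apply hS hv, add_smul, ← add_assoc]
    congr 2
    rw [Module.End.intCast_apply, Int.cast_smul_eq_zsmul]
  have hmem : ∀ v ∈ g.maxGenEigenspace c, v ∈ T.maxGenEigenspace ((q : ℂ) + α) := fun v hv =>
    mem_maxGenEigenspace_of_apply_eq hNm hTv (isLocNil_logNilpotent hS hi) hv
  have hnil : ∀ v ∈ g.maxGenEigenspace c, nilPart T v = N v := fun v hv => by
    rw [nilPart_apply_of_mem hTS (hmem v hv), hTv v hv, add_sub_cancel_left]
  have hd : ∀ i, ∀ v ∈ g.maxGenEigenspace c, dpow (nilPart T) i v = dpow N i v :=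
    fun i v hv => dpow_apply_congr hNm hnil i hv
  have hd' : ∀ i, ∀ v ∈ g.maxGenEigenspace c, dpow (-nilPart T) i v = dpow (-N) i v :=
    fun i v hv => dpow_apply_congr (fun v hv => Submodule.neg_mem _ (hNm v hv))
      (fun v hv => by simp [hnil v hv]) i hv
  have hcN : Commute N g := (commute_logNilpotent hS hi (Commute.refl g)).symm
  rw [ratioPowCoeff, Module.End.mul_apply, Module.End.mul_apply,
    powCoeff_neg_apply hTS (hmem v hv)]
  by_cases hs : s = q + α
  · rw [if_pos hs, if_pos (by rw [hs]), hd' k v hv]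
    have h1 : dpow (-N) k v ∈ g.maxGenEigenspace c :=
      mem_maxGenEigenspace_of_commute (commute_dpow hcN.symm.neg_right k).symm hv
    have h2 : dpow N i (dpow (-N) k v) ∈ g.maxGenEigenspace c :=
      mem_maxGenEigenspace_of_commute (commute_dpow hcN.symm i).symm h1
    rw [powCoeff_apply hTS (hmem _ h1), if_pos hs, hd i _ h1]
    refine binomOp_apply_congr (fun v hv => ?_) (fun v hv => ?_) j h2
    · rw [hTv v hv]
      exact Submodule.add_mem _ (Submodule.smul_mem _ _ hv) (hNm v hv)
    · rw [hTv v hv, hs]; simp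
  · rw [if_neg hs, if_neg (fun e => hs (neg_injective e)), map_zero, map_zero]

/-- The right-hand side of the Jacobi identity on a generalized eigenvector of `g`. -/
theorem IsAutomorphism.jacobiIter_apply {g : Module.End ℂ V} (hg : A.IsAutomorphism g)
    (YW : V →ₗ[ℂ] W →ₗ[ℂ] LogSeries W) {e : ℂ}
    {v : V} (hv : v ∈ g.maxGenEigenspace e) (v' : V) (w : W) (m : ℤ) (a : ℂ) (k : ℕ) (b : ℂ)
    (l : ℕ) {c : ℂ} (hca : c = -(a + 1)) :
    jacobiIter A g YW v v' w m a k b l =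
      if e = Complex.exp (2 * Real.pi * Complex.I * c) then
        ∑ᶠ j : ℕ, ∑ i ∈ antidiagonal l,
          coeffOp YW (A.mode (binomOp (c • 1 + logNilpotent g) j
            (dpow (logNilpotent g) i.1 (dpow (-logNilpotent g) k v))) (m + j) v')
            (b - (c - j)) i.2 w
      else 0 := by
  subst hca
  rcases eq_or_ne e 0 with rfl | he
  · rw [if_neg (Complex.exp_ne_zero _).symm,
      eq_zero_of_mem_maxGenEigenspace_zero hg.bijective.injective hv]
    simp [jacobiIter]
  have hτ : (2 * Real.pi * Complex.I : ℂ) ≠ 0 := Complex.two_pi_I_ne_zero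
  rw [jacobiIter]
  simp only [hg.ratioPowCoeff_apply hv]
  split_ifs with h
  · have h2 : Complex.exp (2 * Real.pi * Complex.I * (-(a + 1))) =
        Complex.exp (logBranch 0 e) := by rw [exp_logBranch 0 he, h]
    rw [Complex.exp_eq_exp_iff_exists_int] at h2
    -- Exactly one integer $q$ corrects the branch. After this step the right-hand side depends only
    -- on the eigenvalue of $g$ and on $\mathcal N_g$, not on the semisimple logarithm.
    obtain ⟨q, hq⟩ := h2
    have hq' : -(a + 1) = q + logBranch 0 e / (2 * Real.pi * Complex.I) := by
      field_simp
      linear_combination hq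
    rw [finsum_eq_single _ q]
    · simp only [if_pos hq']
    · intro q' hne
      have : ¬ -(a + 1) = q' + logBranch 0 e / (2 * Real.pi * Complex.I) := by
        rw [hq']
        intro e'
        exact hne (by exact_mod_cast (add_right_cancel e').symm)
      simp only [if_neg this, mode_zero, LinearMap.zero_apply, coeffOp_zero,
        Finset.sum_const_zero, finsum_zero]
  · have : ∀ q : ℤ, ¬ -(a + 1) = q + logBranch 0 e / (2 * Real.pi * Complex.I) := by
      intro q hq
      apply h
      have e2 : 2 * Real.pi * Complex.I * (-(a + 1)) =
          logBranch 0 e + q * (2 * Real.pi * Complex.I) := by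
        rw [hq]; field_simp; ring
      rw [e2, Complex.exp_add, Complex.exp_int_mul_two_pi_mul_I, mul_one, exp_logBranch 0 he]
    simp only [if_neg (this _), mode_zero, LinearMap.zero_apply, coeffOp_zero,
      Finset.sum_const_zero, finsum_zero]

end VertexOperatorAlgebra

theorem logNilpotent_apply_of_apply_eq {V : Type*} [AddCommGroup V] [Module ℂ V]
    {g : Module.End ℂ V} (hg : IsSumOfGenEigenspaces g) (hi : Function.Injective g) {v : V}
    (hv : g v = v) : logNilpotent g v = 0 := by
  have h1 : v ∈ g.maxGenEigenspace 1 :=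
    (Module.End.mem_maxGenEigenspace _ _ _).2 ⟨1, by simp [hv]⟩
  have h2 : (unipotentPart g - 1) v = 0 := by simp [unipotentPart_apply hg h1, hv]
  rw [logNilpotent, locSum_apply_eq_sum ((isLocNil_unipotentPart_sub_one hg
    hi).finite_support_smul_pow _ (· + 1) fun _ => by omega) v ∅ fun j _ => by
      rw [LinearMap.smul_apply, pow_succ, Module.End.mul_apply, h2, map_zero, smul_zero],
    Finset.sum_empty]

theorem dpow_succ_apply_of_apply_eq_zero {V : Type*} [AddCommGroup V] [Module ℂ V]
    {N : Module.End ℂ V} {v : V} (hv : N v = 0) (k : ℕ) : dpow N (k + 1) v = 0 := by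
  rw [dpow, LinearMap.smul_apply, pow_succ, Module.End.mul_apply, hv, map_zero, smul_zero]

/-! ### The module axioms other than the Jacobi identity and the gradings. -/

section Modules

variable {V : Type*} [AddCommGroup V] [Module ℂ V] {A : VertexOperatorAlgebra V}
  {W : Type*} [AddCommGroup W] [Module ℂ W] {g : Module.End ℂ V}
  {YW : V →ₗ[ℂ] W →ₗ[ℂ] LogSeries W} {gW : Module.End ℂ W} {gr : ℂ → CmodZ → Submodule ℂ W}

/-- Take residues of the Jacobi identity in $x_0$ and $x_1$. As $g(u)=u$, $\mathcal L_gu=0$, so the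
ratio factor acts trivially on $u$ and only $j=0$ remains. -/
theorem IsTwistedModule.zeroMode_coeffOp (hW : IsTwistedModule A g YW gW gr)
    (hg : A.IsAutomorphism g) {u : V} (hgu : g u = u) (n : ℂ) (k : ℕ) (v : V) (w : W) :
    zeroMode YW u (coeffOp YW v n k w) =
      coeffOp YW (A.mode u 0 v) n k w + coeffOp YW v n k (zeroMode YW u w) := by
  have e := hW.jacobi u v w 0 (-1) 0 n k
  have h1 : u ∈ g.maxGenEigenspace 1 :=
    (Module.End.mem_maxGenEigenspace _ _ _).2 ⟨1, by simp [hgu]⟩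
  have hN := logNilpotent_apply_of_apply_eq hg.isSumOfGenEigenspaces hg.bijective.injective hgu
  rw [hg.jacobiIter_apply YW h1 v w 0 (-1) 0 n k (c := 0) (by ring), if_pos (by simp),
    finsum_eq_single _ 0, jacobiProd, jacobiProdOpp, finsum_eq_single _ 0, finsum_eq_single _ 0,
    Finset.sum_eq_single (0, k)] at e
  · simp [dpow_zero, binomOp_zero] at e
    rw [← e, zeroMode]
    abel
  · rintro ⟨i, j⟩ hij hne
    rcases i with _ | i
    · exact absurd (by simpa using Finset.HasAntidiagonal.mem_antidiagonal.1 hij)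
        (fun h : j = k => hne (by rw [h]))
    · simp [dpow_zero, dpow_succ_apply_of_apply_eq_zero hN, A.mode_zero]
  · intro hn
    simp at hn
  · intro j hj
    obtain ⟨j, rfl⟩ := Nat.exists_eq_succ_of_ne_zero hj
    simp
  · intro j hj
    obtain ⟨j, rfl⟩ := Nat.exists_eq_succ_of_ne_zero hj
    simp
  · intro j hj
    obtain ⟨j, rfl⟩ := Nat.exists_eq_succ_of_ne_zero hj
    refine Finset.sum_eq_zero ?_
    rintro ⟨i, l⟩ -
    rcases i with _ | i
    · have h0 : binomOp ((0 : ℂ) • 1 + logNilpotent g) (j + 1) u = 0 := by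
        rw [binomOp_apply_of_apply_eq (c := 0) (by simp [hN])]
        simpa using LinearMap.congr_fun (binomOp_natCast (V := V) 0 (j + 1)) u
      simp only [dpow_zero, Module.End.one_apply, h0, A.mode_zero]
      simp
    · simp [dpow_zero, dpow_succ_apply_of_apply_eq_zero hN, A.mode_zero]

theorem IsTwistedModule.commute_zeroMode_LZero (hW : IsTwistedModule A g YW gW gr)
    (hg : A.IsAutomorphism g) {u : V} (hgu : g u = u) {μ : ℂ} (h : A.IsPrimaryCurrent u μ) :
    Commute (zeroMode YW u) (LZero A YW) :=
  LinearMap.ext fun w => by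
    rw [Module.End.mul_apply, LZero, hW.zeroMode_coeffOp hg hgu, h.mode_zero_conformal]
    simp

theorem IsTwistedModule.commute_act_LZero (hW : IsTwistedModule A g YW gW gr)
    (hg : A.IsAutomorphism g) : Commute gW (LZero A YW) :=
  LinearMap.ext fun w => by
    rw [Module.End.mul_apply, LZero, hW.act_compat, hg.map_conformal, Module.End.mul_apply]

theorem IsTwistedModule.commute_act_zeroMode (hW : IsTwistedModule A g YW gW gr) {u : V}
    (hgu : g u = u) : Commute gW (zeroMode YW u) :=
  LinearMap.ext fun w => by
    rw [Module.End.mul_apply, zeroMode, hW.act_compat, hgu, Module.End.mul_apply]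

variable {u : V} {μ : ℂ}

/-- Read off the $x^{-2}$-coefficient for $\Delta(x)\omega=\omega-ux^{-1}+\frac{\mu}{2}x^{-2}\mathbf
1$. -/
theorem LZero_deltaTwist (h : A.IsPrimaryCurrent u μ) (hW : IsTwistedModule A g YW gW gr) :
    LZero A (deltaTwist A u YW) =
      LZero A YW - zeroMode YW u + algebraMap ℂ (Module.End ℂ W) (μ / 2) := by
  have h0 : A.conformal ∈ (A.mode u 0).maxGenEigenspace 0 :=
    (Module.End.mem_maxGenEigenspace _ _ _).2 ⟨1, by simp [h.mode_zero_conformal]⟩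
  have h1 : coeffOp YW A.vacuum 0 0 = 1 := LinearMap.ext fun w => by
    rw [hW.identity]; simp
  rw [LZero, h.coeffOp_deltaTwist YW h0 (R := 3) fun r hr => h.deltaExpCoeff_conformal_eq_zero hr]
  simp only [Finset.sum_range_succ, Finset.sum_range_zero, Finset.Nat.antidiagonal_zero,
    Finset.sum_singleton, dpow_zero, Module.End.one_apply, VertexOperatorAlgebra.deltaExpCoeff_zero,
    h.deltaExpCoeff_one_conformal, h.deltaExpCoeff_two_conformal, coeffOp_neg, coeffOp_smul]
  norm_num
  rw [h1, zeroMode, LZero, Algebra.algebraMap_eq_smul_one, sub_eq_add_neg]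

/-- The automorphism $gg_u$ commutes with all $u_m$, $m\ge0$, hence with $\Delta(x)$; what remains
is compatibility with $Y_W$, where $(Y_W)_0(u)$ and $u_0$ are exponentiated through the Leibniz
rule. -/
theorem deltaTwist_act_compat (h : A.IsPrimaryCurrent u μ) (hg : A.IsAutomorphism g)
    (hgu : g u = u) (hW : IsTwistedModule A g YW gW gr)
    (hsum : IsSumOfGenEigenspaces (zeroMode YW u)) (v : V) (w : W) (n : ℂ) (k : ℕ) :
    (gW * innerAct u YW) (coeffOp (deltaTwist A u YW) v n k w) =
      coeffOp (deltaTwist A u YW) ((g * A.innerAut u) v) n k ((gW * innerAct u YW) w) := by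
  have hS := h.isSumOfGenEigenspaces
  have hτ := Complex.two_pi_I_ne_zero
  have e1 : ∀ v n k w, (gW * innerAct u YW) (coeffOp YW v n k w) =
      coeffOp YW ((g * A.innerAut u) v) n k ((gW * innerAct u YW) w) := by
    intro v n k w
    have e := expOp_smul_apply_apply (B := coeffHom YW n k) hS hsum hsum
      (fun v w => hW.zeroMode_coeffOp hg hgu n k v w) hτ v w
    simp only [coeffHom_apply] at e
    rw [Module.End.mul_apply, innerAct, e, hW.act_compat]
    rfl
  have hc : ∀ m : ℕ, Commute (g * A.innerAut u) (A.mode u m) := fun m =>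
    (hg.commute_mode hgu m).mul_left
      (commute_expOp_smul hS hτ (h.commute_mode (Int.natCast_nonneg m) le_rfl)).symm
  have hN : Commute (g * A.innerAut u) (-nilPart (A.mode u 0)) :=
    (commute_nilPart hS (hc 0)).neg_right
  refine hS.induction (p := fun v => (gW * innerAct u YW) (coeffOp (deltaTwist A u YW) v n k w) =
      coeffOp (deltaTwist A u YW) ((g * A.innerAut u) v) n k ((gW * innerAct u YW) w))
    (fun β v hv => ?_) (fun v v' hv hv' => ?_) v
  · obtain ⟨R, hR⟩ := h.exists_deltaExpCoeff_eq_zero v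
    have hE : ∀ r, (A.deltaExpCoeff u r) ((g * A.innerAut u) v) =
        (g * A.innerAut u) (A.deltaExpCoeff u r v) := fun r =>
      (LinearMap.congr_fun (h.commute_deltaExpCoeff (fun m _ => hc m) r).eq v).symm
    rw [h.coeffOp_deltaTwist YW hv hR,
      h.coeffOp_deltaTwist YW (mem_maxGenEigenspace_of_commute (hc 0) hv)
        (R := R) (fun r hr => by rw [hE, hR r hr, map_zero])]
    simp only [LinearMap.sum_apply, map_sum, e1, hE]
    refine Finset.sum_congr rfl fun r _ => Finset.sum_congr rfl fun i _ => ?_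
    have e2 : (g * A.innerAut u) (dpow (-nilPart (A.mode u 0)) i.1 (A.deltaExpCoeff u r v)) =
        dpow (-nilPart (A.mode u 0)) i.1 ((g * A.innerAut u) (A.deltaExpCoeff u r v)) :=
      LinearMap.congr_fun (commute_dpow hN i.1).eq _
    rw [e2]
  · simp only [map_add, coeffOp_add, LinearMap.add_apply] at hv hv' ⊢
    rw [hv, hv']

theorem deltaTwist_identity (h : A.IsPrimaryCurrent u μ) (hW : IsTwistedModule A g YW gW gr)
    (w : W) (n : ℂ) (k : ℕ) :
    coeffOp (deltaTwist A u YW) A.vacuum n k w = if n = 0 ∧ k = 0 then w else 0 := by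
  have h00 : A.mode u 0 A.vacuum = 0 := A.mode_apply_vacuum_of_nonneg u le_rfl
  have h0 : A.vacuum ∈ (A.mode u 0).maxGenEigenspace 0 :=
    (Module.End.mem_maxGenEigenspace _ _ _).2 ⟨1, by simp [h00]⟩
  have hN : (-nilPart (A.mode u 0)) A.vacuum = 0 := by
    simp [nilPart_apply_of_mem h.isSumOfGenEigenspaces h0, h00]
  rw [h.coeffOp_deltaTwist YW h0 (R := 1) fun r hr => h.deltaExpCoeff_vacuum hr,
    Finset.sum_range_one, Finset.sum_eq_single (0, k)]
  · simp [dpow_zero, VertexOperatorAlgebra.deltaExpCoeff_zero, hW.identity]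
  · rintro ⟨i, j⟩ hij hne
    rcases i with _ | i
    · exact absurd (by simpa using Finset.HasAntidiagonal.mem_antidiagonal.1 hij)
        (fun h : j = k => hne (by rw [h]))
    · simp [VertexOperatorAlgebra.deltaExpCoeff_zero, dpow_succ_apply_of_apply_eq_zero hN]
  · intro hn
    simp at hn

/-- In filter form, finitely many truncation bounds combine without naming a maximum. -/
theorem exists_re_bound_iff {p : ℂ → Prop} :
    (∃ B : ℝ, ∀ n : ℂ, n.re < B → p n) ↔ ∀ᶠ n in Filter.comap Complex.re Filter.atBot, p n := by
  rw [Filter.eventually_comap, Filter.eventually_atBot]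
  constructor
  · rintro ⟨B, hB⟩
    exact ⟨B - 1, fun b hb n hn => hB n (by linarith)⟩
  · rintro ⟨B, hB⟩
    exact ⟨B, fun n hn => hB n.re hn.le n rfl⟩

theorem deltaTwist_lowerTruncation (h : A.IsPrimaryCurrent u μ)
    (hW : IsTwistedModule A g YW gW gr) (v : V) (w : W) :
    ∃ B : ℝ, ∀ n : ℂ, n.re < B → ∀ k : ℕ, coeffOp (deltaTwist A u YW) v n k w = 0 := by
  rw [exists_re_bound_iff]
  refine h.isSumOfGenEigenspaces.induction (p := fun v => ∀ᶠ n in Filter.comap Complex.re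
    Filter.atBot, ∀ k : ℕ, coeffOp (deltaTwist A u YW) v n k w = 0)
    (fun β v hv => ?_) (fun v v' hv hv' => ?_) v
  · obtain ⟨R, hR⟩ := h.exists_deltaExpCoeff_eq_zero v
    have hN := (isLocNil_nilPart h.isSumOfGenEigenspaces).neg
    have key : ∀ x : V, ∀ s : ℂ, ∀ᶠ n in Filter.comap Complex.re Filter.atBot,
        ∀ k : ℕ, coeffOp YW x (n + s) k w = 0 := fun x s => by
      obtain ⟨B, hB⟩ := hW.lowerTruncation x w
      exact exists_re_bound_iff.1 ⟨B - s.re, fun n hn k => hB _ (by simp; linarith) k⟩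
    have : ∀ r ∈ Finset.range R, ∀ᶠ n in Filter.comap Complex.re Filter.atBot, ∀ i k : ℕ,
        coeffOp YW (dpow (-nilPart (A.mode u 0)) i (A.deltaExpCoeff u r v)) (n + (β + r)) k w
          = 0 := by
      intro r _
      obtain ⟨K, hK⟩ := hN (A.deltaExpCoeff u r v)
      have h2 := (Filter.eventually_all_finset (Finset.range K)).2 fun i _ =>
        key (dpow (-nilPart (A.mode u 0)) i (A.deltaExpCoeff u r v)) (β + r)
      filter_upwards [h2] with n hn i k
      by_cases hi : i < K
      · exact hn i (Finset.mem_range.2 hi) k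
      · rw [dpow_apply_eq_zero hK (by omega)]; simp
    filter_upwards [(Filter.eventually_all_finset _).2 this] with n hn k
    rw [h.coeffOp_deltaTwist YW hv hR, LinearMap.sum_apply]
    refine Finset.sum_eq_zero fun r hr => ?_
    rw [LinearMap.sum_apply]
    refine Finset.sum_eq_zero fun i _ => ?_
    rw [add_assoc]
    exact hn r hr i.1 i.2
  · filter_upwards [hv, hv'] with n h1 h2 k
    rw [coeffOp_add, LinearMap.add_apply, h1, h2, add_zero]

/-- By the product rule, differentiating $\Delta(x)$ cancels the terms by which $\Delta(x)L(-1)$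
differs from $L(-1)\Delta(x)$. The scalar part of $u_0$ appears from powers of $x$, its nilpotent
part from powers of $\log x$. -/
theorem deltaTwist_derivative (h : A.IsPrimaryCurrent u μ) (hW : IsTwistedModule A g YW gW gr)
    (v : V) (w : W) (n : ℂ) (k : ℕ) :
    (n + 1) • coeffOp (deltaTwist A u YW) v (n + 1) k w +
      ((k : ℂ) + 1) • coeffOp (deltaTwist A u YW) v (n + 1) (k + 1) w =
      coeffOp (deltaTwist A u YW) (A.L (-1) v) n k w := by
  have hS := h.isSumOfGenEigenspaces
  refine hS.induction (p := fun v => (n + 1) • coeffOp (deltaTwist A u YW) v (n + 1) k w +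
      ((k : ℂ) + 1) • coeffOp (deltaTwist A u YW) v (n + 1) (k + 1) w =
      coeffOp (deltaTwist A u YW) (A.L (-1) v) n k w)
    (fun β v hv => ?_) (fun v v' hv hv' => ?_) v
  · obtain ⟨R, hR⟩ := h.exists_deltaExpCoeff_eq_zero v
    have hL := (h.commute_mode_zero_L (-1)).symm
    set N := -nilPart (A.mode u 0) with hN
    have hLN : Commute (A.L (-1)) N := (commute_nilPart hS hL).neg_right
    -- Applying $L(-1)$ raises the degree of $E(X)v$ by at most one, so one more coefficient may be
    -- needed.
    have hR' : ∀ r, R + 1 ≤ r → A.deltaExpCoeff u r (A.L (-1) v) = 0 := by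
      intro r hr
      obtain ⟨r, rfl⟩ := Nat.exists_eq_add_of_le' (show 1 ≤ r by omega)
      rw [h.deltaExpCoeff_L_neg_one, hR _ (by omega), hR r (by omega)]
      simp
    have hNu : ∀ x ∈ (A.mode u 0).maxGenEigenspace β, A.mode u 0 x = β • x - N x := by
      intro x hx
      rw [hN, LinearMap.neg_apply, nilPart_apply_of_mem hS hx]
      abel
    rw [h.coeffOp_deltaTwist YW hv hR, h.coeffOp_deltaTwist YW hv hR,
      h.coeffOp_deltaTwist YW (mem_maxGenEigenspace_of_commute hL hv) hR']
    simp only [LinearMap.sum_apply, Finset.smul_sum]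
    -- the `(log x)`-derivative
    have hlog : ∀ r : ℕ, ∑ i ∈ antidiagonal (k + 1), ((k : ℂ) + 1) •
        coeffOp YW (dpow N i.1 (A.deltaExpCoeff u r v)) (n + 1 + β + r) i.2 w =
        ∑ i ∈ antidiagonal k,
          (coeffOp YW (N (dpow N i.1 (A.deltaExpCoeff u r v))) (n + 1 + β + r) i.2 w +
          ((i.2 : ℂ) + 1) •
            coeffOp YW (dpow N i.1 (A.deltaExpCoeff u r v)) (n + 1 + β + r) (i.2 + 1) w) := by
      intro r
      have e1 : ∀ i ∈ antidiagonal (k + 1), ((k : ℂ) + 1) •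
          coeffOp YW (dpow N i.1 (A.deltaExpCoeff u r v)) (n + 1 + β + r) i.2 w =
          (i.1 : ℂ) • coeffOp YW (dpow N i.1 (A.deltaExpCoeff u r v)) (n + 1 + β + r) i.2 w +
          (i.2 : ℂ) • coeffOp YW (dpow N i.1 (A.deltaExpCoeff u r v)) (n + 1 + β + r) i.2 w := by
        intro i hi
        rw [← add_smul]
        congr 1
        exact_mod_cast (Finset.HasAntidiagonal.mem_antidiagonal.1 hi).symm
      rw [Finset.sum_congr rfl e1, Finset.sum_add_distrib, Finset.sum_add_distrib]
      congr 1
      · rw [Finset.Nat.sum_antidiagonal_succ]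
        simp only [Nat.cast_zero, zero_smul, zero_add, Nat.cast_add, Nat.cast_one]
        refine Finset.sum_congr rfl fun i _ => ?_
        rw [← LinearMap.smul_apply, ← coeffOp_smul]
        congr 2
        exact LinearMap.congr_fun (succ_smul_dpow N i.1) _
      · rw [Finset.Nat.sum_antidiagonal_succ']
        simp only [Nat.cast_zero, zero_smul, zero_add, Nat.cast_add, Nat.cast_one]
    have hterm : ∀ r : ℕ, ∑ i ∈ antidiagonal k, (n + 1) •
        coeffOp YW (dpow N i.1 (A.deltaExpCoeff u r v)) (n + 1 + β + r) i.2 w +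
        ∑ i ∈ antidiagonal (k + 1), ((k : ℂ) + 1) •
        coeffOp YW (dpow N i.1 (A.deltaExpCoeff u r v)) (n + 1 + β + r) i.2 w =
        ∑ i ∈ antidiagonal k,
          coeffOp YW (dpow N i.1 (A.L (-1) (A.deltaExpCoeff u r v))) (n + β + r) i.2 w -
        ∑ i ∈ antidiagonal k,
          coeffOp YW (dpow N i.1 (A.mode u 0 (A.deltaExpCoeff u r v) +
            (r : ℂ) • A.deltaExpCoeff u r v)) (n + β + (r + 1)) i.2 w := by
      intro r
      rw [hlog r, ← Finset.sum_add_distrib, ← Finset.sum_sub_distrib]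
      refine Finset.sum_congr rfl fun i _ => ?_
      have hEv : A.deltaExpCoeff u r v ∈ (A.mode u 0).maxGenEigenspace β :=
        mem_maxGenEigenspace_of_commute (h.commute_mode_zero_deltaExpCoeff r).symm hv
      have e2 := hW.derivative (dpow N i.1 (A.deltaExpCoeff u r v)) w (n + β + r) i.2
      have e3 : A.L (-1) (dpow N i.1 (A.deltaExpCoeff u r v)) =
          dpow N i.1 (A.L (-1) (A.deltaExpCoeff u r v)) :=
        LinearMap.congr_fun (commute_dpow hLN i.1).eq _
      have e4 : N (dpow N i.1 (A.deltaExpCoeff u r v)) = dpow N i.1 (N (A.deltaExpCoeff u r v)) :=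
        LinearMap.congr_fun (commute_dpow (Commute.refl N) i.1).eq _
      have e5 : n + β + r + 1 = n + 1 + β + r := by ring
      have e6 : n + β + ((r : ℂ) + 1) = n + 1 + β + r := by ring
      rw [e3, e5] at e2
      rw [← e2, e4, hNu _ hEv, e6]
      simp only [map_add, map_sub, map_smul, coeffOp_add, coeffOp_sub, coeffOp_smul,
        LinearMap.add_apply, LinearMap.sub_apply, LinearMap.smul_apply]
      module
    rw [← Finset.sum_add_distrib, Finset.sum_congr rfl fun r _ => hterm r,
      Finset.sum_sub_distrib, Finset.sum_range_succ']
    -- Since $E_Rv=0$, the sum over $r<R$ can be written as the $r=0$ term plus a shifted sum,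
    -- aligning $L(-1)E_{r+1}$ with the terms in $E_r$.
    have hsum := Finset.sum_range_succ' (fun r : ℕ => ∑ i ∈ antidiagonal k,
      coeffOp YW (dpow N i.1 (A.L (-1) (A.deltaExpCoeff u r v))) (n + β + r) i.2 w) R
    rw [Finset.sum_range_succ, hR R le_rfl] at hsum
    simp only [map_zero, coeffOp_zero, LinearMap.zero_apply, Finset.sum_const_zero,
      add_zero] at hsum
    rw [hsum, add_sub_right_comm, ← Finset.sum_sub_distrib]
    congr 1
    · refine Finset.sum_congr rfl fun r _ => ?_
      rw [← Finset.sum_sub_distrib]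
      refine Finset.sum_congr rfl fun i _ => ?_
      rw [h.deltaExpCoeff_L_neg_one, sub_sub, map_sub, coeffOp_sub, LinearMap.sub_apply]
      push_cast
      rfl
    · simp only [VertexOperatorAlgebra.deltaExpCoeff_zero, Module.End.one_apply]
      rfl
  · simp only [map_add, coeffOp_add, LinearMap.add_apply] at hv hv' ⊢
    rw [← hv, ← hv']
    module

/-! ### Equivariance -/

variable (W) in
/-- The value of a branch as a linear map. -/
def branchHom (p : ℤ) (z n : ℂ) : LogSeries W →ₗ[ℂ] W :=
  Finsupp.lsum ℂ fun k => (Complex.exp (n * logBranch p z) * logBranch p z ^ k) • LinearMap.proj n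

theorem branchHom_apply (p : ℤ) (z n : ℂ) (f : LogSeries W) :
    branchHom W p z n f = f.branchTerm p z n := rfl

theorem branchHom_shift (p : ℤ) (z n s : ℂ) (t : ℕ) (f : LogSeries W) :
    branchHom W p z n (LogSeries.shift (W := W) s t f) =
      (Complex.exp (s * logBranch p z) * logBranch p z ^ t) • branchHom W p z (n - s) f := by
  induction f using Finsupp.induction_linear with
  | zero => simp
  | add f f' hf hf' => simp only [map_add, hf, hf', smul_add]
  | single k c =>
    have e : LogSeries.shift (W := W) s t (Finsupp.single k c) =
        Finsupp.single (k + t) fun n => c (n - s) := by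
      rw [LogSeries.shift, LinearMap.comp_apply, Finsupp.mapRange.linearMap_apply,
        Finsupp.mapRange_single, Finsupp.lmapDomain_apply, Finsupp.mapDomain_single]
      rfl
    rw [e, branchHom, branchHom, Finsupp.lsum_single, Finsupp.lsum_single]
    simp only [LinearMap.smul_apply, LinearMap.proj_apply, smul_smul]
    congr 1
    rw [pow_add, show n * logBranch p z = s * logBranch p z + (n - s) * logBranch p z by ring,
      Complex.exp_add]
    ring

variable (YW) in
-- Once $\log x$ is a number, the sum over its powers assembles into the exponential of $-\log x$
-- times the nilpotent part of $u_0$.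
theorem branchHom_deltaTwist (h : A.IsPrimaryCurrent u μ) {β : ℂ} {v : V}
    (hv : v ∈ (A.mode u 0).maxGenEigenspace β) {R : ℕ}
    (hR : ∀ r, R ≤ r → A.deltaExpCoeff u r v = 0) (w : W) (p : ℤ) (z n : ℂ) :
    branchHom W p z n (deltaTwist A u YW v w) = ∑ r ∈ Finset.range R,
      Complex.exp ((-β - (r : ℂ)) * logBranch p z) • branchHom W p z (n - (-β - (r : ℂ)))
        (YW (expNil ((-logBranch p z) • nilPart (A.mode u 0)) (A.deltaExpCoeff u r v)) w) := by
  have hl := isLocNil_nilPart h.isSumOfGenEigenspaces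
  obtain ⟨K, hK⟩ := hl v
  rw [h.deltaTwist_apply YW hv hR hK, map_sum]
  refine Finset.sum_congr rfl fun r _ => ?_
  have hc : Commute (A.deltaExpCoeff u r) (nilPart (A.mode u 0)) :=
    commute_nilPart h.isSumOfGenEigenspaces (h.commute_mode_zero_deltaExpCoeff r).symm
  have hK' : (((-logBranch p z) • nilPart (A.mode u 0)) ^ K) (A.deltaExpCoeff u r v) = 0 := by
    rw [smul_pow, LinearMap.smul_apply, ← Module.End.mul_apply, ← (hc.pow_right K).eq,
      Module.End.mul_apply, hK, map_zero, smul_zero]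
  rw [expNil_apply (hl.smul _) hK']
  simp only [map_sum, LinearMap.sum_apply, Finset.smul_sum, branchHom_shift]
  refine Finset.sum_congr rfl fun t _ => ?_
  rw [dpow_smul, ← neg_one_smul ℂ (nilPart (A.mode u 0)), dpow_smul, neg_pow (logBranch p z)]
  simp only [LinearMap.smul_apply, map_smul, smul_smul]
  congr 1
  ring

/-- Passing from branch $p$ to $p+1$ multiplies $x^{-u_0}$ by $e^{-2\pi iu_0}$, which cancels $g_u$;
the factor $E(x^{-1})$ has integral powers, and $g$ is handled by the equivariance of $Y_W$. -/
theorem deltaTwist_equivariance (h : A.IsPrimaryCurrent u μ) (hg : A.IsAutomorphism g)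
    (hgu : g u = u) (hW : IsTwistedModule A g YW gW gr) (p : ℤ) {z : ℂ} (hz : z ≠ 0) (v : V)
    (w : W) (n : ℂ) : (deltaTwist A u YW ((g * A.innerAut u) v) w).branchTerm (p + 1) z n =
      (deltaTwist A u YW v w).branchTerm p z n := by
  have hS := h.isSumOfGenEigenspaces
  have hτ := Complex.two_pi_I_ne_zero
  have hc : ∀ m : ℕ, Commute (g * A.innerAut u) (A.mode u m) := fun m =>
    (hg.commute_mode hgu m).mul_left
      (commute_expOp_smul hS hτ (h.commute_mode (Int.natCast_nonneg m) le_rfl)).symm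
  refine hS.induction (p := fun v =>
    branchHom W (p + 1) z n (deltaTwist A u YW ((g * A.innerAut u) v) w) =
      branchHom W p z n (deltaTwist A u YW v w)) (fun β v hv => ?_) (fun v v' hv hv' => ?_) v
  · obtain ⟨R, hR⟩ := h.exists_deltaExpCoeff_eq_zero v
    have hE : ∀ r, (A.deltaExpCoeff u r) ((g * A.innerAut u) v) =
        (g * A.innerAut u) (A.deltaExpCoeff u r v) := fun r =>
      (LinearMap.congr_fun (h.commute_deltaExpCoeff (fun m _ => hc m) r).eq v).symm
    rw [branchHom_deltaTwist YW h hv hR, branchHom_deltaTwist YW h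
      (mem_maxGenEigenspace_of_commute (hc 0) hv) (R := R)
      (fun r hr => by rw [hE, hR r hr, map_zero])]
    refine Finset.sum_congr rfl fun r _ => ?_
    have hl := isLocNil_nilPart hS
    set N := nilPart (A.mode u 0)
    set x := A.deltaExpCoeff u r v with hx
    have hxm : x ∈ (A.mode u 0).maxGenEigenspace β :=
      mem_maxGenEigenspace_of_commute (h.commute_mode_zero_deltaExpCoeff r).symm hv
    have hcg : Commute g (expNil ((-logBranch (p + 1) z) • N)) :=
      commute_expNil (hl.smul _) ((commute_nilPart hS (hg.commute_mode hgu 0)).smul_right _)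
    have e1 : expNil ((-logBranch (p + 1) z) • N) ((g * A.innerAut u) x) =
        Complex.exp (2 * Real.pi * Complex.I * β) • g (expNil ((-logBranch p z) • N) x) := by
      rw [Module.End.mul_apply, VertexOperatorAlgebra.innerAut, expOp_smul_apply hS hτ hxm,
        map_smul, map_smul, ← Module.End.mul_apply, ← hcg.eq, Module.End.mul_apply]
      congr 2
      rw [← Module.End.mul_apply, ← expNil_add (hl.smul _) (hl.smul _)
        (((Commute.refl N).smul_left _).smul_right _), ← add_smul, logBranch_succ]
      congr 3
      ring
    rw [hE, e1]
    simp only [map_smul, LinearMap.smul_apply]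
    rw [branchHom_apply, branchHom_apply, hW.equivariance p z hz, smul_smul, ← Complex.exp_add]
    congr 1
    rw [Complex.exp_eq_exp_iff_exists_int]
    -- The exponents differ by $-2\pi ir$, the trivial monodromy of $x^{-r}$.
    refine ⟨-r, ?_⟩
    rw [logBranch_succ]
    push_cast
    ring
  · simp only [map_add, LinearMap.add_apply] at hv hv' ⊢
    rw [hv, hv']

end Modules

/-! ### Rearrangement of multiple sums. -/

section Combinatorics

variable {M : Type*} [AddCommMonoid M]

theorem sum_antidiagonal_comm (s : ℕ) (F : ℕ → ℕ → ℕ → M) :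
    ∑ x ∈ antidiagonal s, ∑ y ∈ antidiagonal x.2, F x.1 y.1 y.2 =
      ∑ x ∈ antidiagonal s, ∑ y ∈ antidiagonal x.2, F y.1 x.1 y.2 := by
  rw [← sum_antidiagonal_assoc, ← sum_antidiagonal_assoc s fun a b c => F b a c]
  refine Finset.sum_congr rfl fun x _ => ?_
  rw [← Finset.Nat.sum_antidiagonal_swap]
  rfl

theorem sum_antidiagonal_rearrange (l : ℕ) (F : ℕ → ℕ → ℕ → ℕ → M) :
    ∑ i ∈ antidiagonal l, ∑ t ∈ antidiagonal i.2, ∑ s ∈ antidiagonal t.1, F i.1 s.1 s.2 t.2 =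
      ∑ s ∈ antidiagonal l, ∑ t ∈ antidiagonal s.2, ∑ p ∈ antidiagonal t.1,
        F p.1 p.2 s.1 t.2 := by
  have e1 : ∀ i : ℕ × ℕ, ∑ t ∈ antidiagonal i.2, ∑ s ∈ antidiagonal t.1, F i.1 s.1 s.2 t.2 =
      ∑ t ∈ antidiagonal i.2, ∑ s ∈ antidiagonal t.2, F i.1 s.1 t.1 s.2 := fun i => by
    rw [sum_antidiagonal_assoc i.2 fun a b c => F i.1 a b c,
      sum_antidiagonal_comm i.2 fun a b c => F i.1 a b c]
  simp only [e1]
  rw [sum_antidiagonal_comm l fun a b c => ∑ s ∈ antidiagonal c, F a s.1 b s.2]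
  refine Finset.sum_congr rfl fun s _ => ?_
  exact (sum_antidiagonal_assoc s.2 fun a b c => F a b s.1 c).symm

/-- Both sides run over all quadruples with nonzero term. The left grouping is the one delivered by
the Jacobi identity of $Y_W$, the right one by the conjugation formula. -/
theorem sum_range_antidiagonal_eq (B : ℕ) (F : ℕ → ℕ → ℕ → ℕ → M)
    (h : ∀ a b c d, B ≤ a + b + c + d → F a b c d = 0) :
    ∑ a ∈ Finset.range B, ∑ c ∈ Finset.range B, ∑ n ∈ Finset.range B, ∑ q ∈ antidiagonal n,
        F a q.1 c q.2 =
      ∑ d ∈ Finset.range B, ∑ r ∈ Finset.range B, ∑ p ∈ antidiagonal r, ∑ q ∈ antidiagonal p.1,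
        F q.1 q.2 p.2 d := by
  have e1 : ∀ a c, ∑ n ∈ Finset.range B, ∑ q ∈ antidiagonal n, F a q.1 c q.2 =
      ∑ b ∈ Finset.range B, ∑ d ∈ Finset.range B, F a b c d := fun a c =>
    (sum_range_sum_range_eq_sum_antidiagonal B (fun b d => F a b c d)
      fun b d hbd => h _ _ _ _ (by omega)).symm
  have e2 : ∀ d, ∑ r ∈ Finset.range B, ∑ p ∈ antidiagonal r, ∑ q ∈ antidiagonal p.1,
      F q.1 q.2 p.2 d =
      ∑ s ∈ Finset.range B, ∑ c ∈ Finset.range B, ∑ q ∈ antidiagonal s, F q.1 q.2 c d := fun d =>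
    (sum_range_sum_range_eq_sum_antidiagonal B
      (fun s c => ∑ q ∈ antidiagonal s, F q.1 q.2 c d) fun s c hs =>
      Finset.sum_eq_zero fun q hq => h _ _ _ _ (by
        have := Finset.HasAntidiagonal.mem_antidiagonal.1 hq
        omega)).symm
  have e3 : ∀ c d, ∑ s ∈ Finset.range B, ∑ q ∈ antidiagonal s, F q.1 q.2 c d =
      ∑ a ∈ Finset.range B, ∑ b ∈ Finset.range B, F a b c d := fun c d =>
    (sum_range_sum_range_eq_sum_antidiagonal B (fun a b => F a b c d)
      fun a b hab => h _ _ _ _ (by omega)).symm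
  simp only [e1, e2]
  have e4 : ∀ d, ∑ s ∈ Finset.range B, ∑ c ∈ Finset.range B, ∑ q ∈ antidiagonal s,
      F q.1 q.2 c d =
      ∑ c ∈ Finset.range B, ∑ a ∈ Finset.range B, ∑ b ∈ Finset.range B, F a b c d := fun d => by
    rw [Finset.sum_comm]
    exact Finset.sum_congr rfl fun c _ => e3 c d
  simp only [e4]
  rw [Finset.sum_comm, Finset.sum_comm (s := Finset.range B) (t := Finset.range B)
    (f := fun d c => ∑ a ∈ Finset.range B, ∑ b ∈ Finset.range B, F a b c d)]
  refine Finset.sum_congr rfl fun c _ => ?_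
  rw [Finset.sum_comm (s := Finset.range B) (t := Finset.range B)
    (f := fun d a => ∑ b ∈ Finset.range B, F a b c d)]
  refine Finset.sum_congr rfl fun a _ => ?_
  rw [Finset.sum_comm]

theorem sum_sum_sum_comm {ι κ : Type*} {σ : ι → Type*} (s : Finset ι) (t : ∀ i, Finset (σ i))
    (p : Finset κ) (f : ∀ i, σ i → κ → M) :
    ∑ i ∈ s, ∑ j ∈ t i, ∑ k ∈ p, f i j k = ∑ k ∈ p, ∑ i ∈ s, ∑ j ∈ t i, f i j k := by
  rw [Finset.sum_comm]
  exact Finset.sum_congr rfl fun i _ => Finset.sum_comm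

end Combinatorics

/-! ### The iterate side of the Jacobi identity for the twist. -/

section Iterate

variable {V : Type*} [AddCommGroup V] [Module ℂ V] (A : VertexOperatorAlgebra V)
  {W : Type*} [AddCommGroup W] [Module ℂ W] (g : Module.End ℂ V) (u : V)
  (YW : V →ₗ[ℂ] W →ₗ[ℂ] LogSeries W) (w : W)

/-- The coefficients of `Y_W(Y(x, x₀) y, x₂) w` as bilinear maps in `x` and `y`. -/
def iterHom (n : ℤ) (b : ℂ) (k : ℕ) : V →ₗ[ℂ] V →ₗ[ℂ] W :=
  (A.modeHom n).compr₂ (LinearMap.applyₗ w ∘ₗ coeffHom YW b k)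

theorem iterHom_apply (n : ℤ) (b : ℂ) (k : ℕ) (x y : V) :
    iterHom A YW w n b k x y = coeffOp YW (A.mode x n y) b k w := rfl

/-- The common term of both sides of the Jacobi identity for the twist by `Δ_V^{(u)}`. -/
def iterTerm (m : ℤ) (l : ℕ) (c b : ℂ) (x y : V) (r₁ i r₂ j : ℕ) : W :=
  ∑ s ∈ antidiagonal l, ∑ t ∈ antidiagonal s.2,
    iterHom A YW w (m + (i + j)) (b + (r₁ + r₂ + i + j)) t.2
      (binomOp (-A.mode u 0 - (r₁ : ℂ) • 1) i
        (binomOp (c • 1 + (logNilpotent g + nilPart (A.mode u 0))) j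
          (dpow (logNilpotent g) t.1 (A.deltaExpCoeff u r₁ x))))
      (dpow (-nilPart (A.mode u 0)) s.1 (A.deltaExpCoeff u r₂ y))

variable {A g u YW w} {μ : ℂ}

theorem VertexOperatorAlgebra.IsAutomorphism.commute_logNilpotent (hg : A.IsAutomorphism g)
    {X : Module.End ℂ V} (h : Commute X g) : Commute X (logNilpotent g) :=
  TwistedVOA.commute_logNilpotent hg.isSumOfGenEigenspaces hg.bijective.injective h

/-- The inner vector has weight $d_1+d_2-r_1-r_2-m-i-j-1$, which is negative under the bound. -/
theorem iterTerm_eq_zero (h : A.IsPrimaryCurrent u μ) (hg : A.IsAutomorphism g)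
    {d₁ d₂ : ℤ} {x y : V} (hx : x ∈ A.weight d₁) (hy : y ∈ A.weight d₂)
    {m : ℤ} {r₁ i r₂ j : ℕ} (hB : d₁ + d₂ - m ≤ r₁ + i + r₂ + j) (l : ℕ) (c b : ℂ) :
    iterTerm A g u YW w m l c b x y r₁ i r₂ j = 0 := by
  have hN : Commute (nilPart (A.mode u 0)) (A.L 0) :=
    (commute_nilPart h.isSumOfGenEigenspaces (h.commute_mode_zero_L 0).symm).symm
  have hM : Commute (logNilpotent g) (A.L 0) := (hg.commute_logNilpotent (hg.commute_L 0).symm).symm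
  have h1 : ∀ c : ℂ, Commute (c • (1 : Module.End ℂ V)) (A.L 0) := fun c =>
    (Commute.one_left _).smul_left c
  refine Finset.sum_eq_zero fun s _ => Finset.sum_eq_zero fun t _ => ?_
  have hx1 := A.mem_weight_of_commute (commute_dpow hM.symm t.1).symm
    (h.deltaExpCoeff_mem_weight r₁ hx)
  have hx2 := A.mem_weight_of_commute (commute_binomOp ((h1 c).add_left (hM.add_left hN)).symm
    j).symm hx1
  have hx3 := A.mem_weight_of_commute (commute_binomOp
    (((h.commute_mode_zero_L 0).neg_left).sub_left (h1 r₁)).symm i).symm hx2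
  have hy1 := A.mem_weight_of_commute (commute_dpow hN.symm.neg_right s.1).symm
    (h.deltaExpCoeff_mem_weight r₂ hy)
  rw [iterHom_apply, VertexOperatorAlgebra.eq_zero_of_mem_weight_neg h.weight_neg (by omega)
    (A.mode_mem_weight hx3 hy1 _), coeffOp_zero, LinearMap.zero_apply]

theorem commute_logNilpotent_deltaExpCoeff (h : A.IsPrimaryCurrent u μ) (hg : A.IsAutomorphism g)
    (hgu : g u = u) (r : ℕ) : Commute (logNilpotent g) (A.deltaExpCoeff u r) :=
  (hg.commute_logNilpotent (h.commute_deltaExpCoeff (fun m _ => hg.commute_mode hgu m) r).symm).symm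

theorem commute_nilPart_deltaExpCoeff (h : A.IsPrimaryCurrent u μ) (r : ℕ) :
    Commute (nilPart (A.mode u 0)) (A.deltaExpCoeff u r) :=
  (commute_nilPart h.isSumOfGenEigenspaces (h.commute_mode_zero_deltaExpCoeff r).symm).symm

theorem commute_logNilpotent_mode_zero (hg : A.IsAutomorphism g) (hgu : g u = u) :
    Commute (logNilpotent g) (A.mode u 0) :=
  (hg.commute_logNilpotent (hg.commute_mode hgu 0).symm).symm

theorem commute_logNilpotent_nilPart (h : A.IsPrimaryCurrent u μ) (hg : A.IsAutomorphism g)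
    (hgu : g u = u) : Commute (logNilpotent g) (nilPart (A.mode u 0)) :=
  commute_nilPart h.isSumOfGenEigenspaces (commute_logNilpotent_mode_zero hg hgu)

/-- The right-hand side of the Jacobi identity for the twist, in terms of `iterTerm`. -/
theorem coeffOp_deltaTwist_iterate (h : A.IsPrimaryCurrent u μ) (hg : A.IsAutomorphism g)
    (hgu : g u = u) {β₁ β₂ : ℂ} {x y : V} (hx : x ∈ (A.mode u 0).maxGenEigenspace β₁)
    (hy : y ∈ (A.mode u 0).maxGenEigenspace β₂) {d₁ d₂ : ℤ} (hxd : x ∈ A.weight d₁)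
    (hyd : y ∈ A.weight d₂) {m : ℤ} {B : ℕ} (hB : d₁ + d₂ - m ≤ B) (l : ℕ) (c b : ℂ) (j : ℕ) :
    ∑ i ∈ antidiagonal l, coeffOp (deltaTwist A u YW)
      (A.mode (binomOp (c • 1 + (logNilpotent g + nilPart (A.mode u 0))) j
        (dpow (logNilpotent g + nilPart (A.mode u 0)) i.1 x)) (m + j) y)
        (b - (c - j)) i.2 w =
      ∑ r ∈ Finset.range B, ∑ p ∈ antidiagonal r, ∑ q ∈ antidiagonal p.1,
        iterTerm A g u YW w m l c (b - c + β₁ + β₂) x y q.1 q.2 p.2 j := by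
  have hS := h.isSumOfGenEigenspaces
  have cMN := commute_logNilpotent_nilPart h hg hgu
  have cMu := commute_logNilpotent_mode_zero hg hgu
  have cNu : Commute (nilPart (A.mode u 0)) (A.mode u 0) :=
    (commute_nilPart hS (Commute.refl _)).symm
  have cME := commute_logNilpotent_deltaExpCoeff h hg hgu
  have cNE := commute_nilPart_deltaExpCoeff h
  have cML : Commute (logNilpotent g) (A.L 0) :=
    (hg.commute_logNilpotent (hg.commute_L 0).symm).symm
  have cNL : Commute (nilPart (A.mode u 0)) (A.L 0) :=
    (commute_nilPart hS (h.commute_mode_zero_L 0).symm).symm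
  have hdN := fun k (x y : V) (n : ℤ) => dpow_nilPart_apply_apply (B := A.modeHom n) hS hS hS
    (fun v w => A.mode_zero_leibniz u v w n) (-1) k x y
  simp only [VertexOperatorAlgebra.modeHom_apply, neg_one_smul] at hdN
  set N := nilPart (A.mode u 0) with hN
  set M := logNilpotent g with hM
  have cHE : ∀ r, Commute (M + N) (A.deltaExpCoeff u r) := fun r => (cME r).add_left (cNE r)
  have cHu : Commute (M + N) (A.mode u 0) := cMu.add_left cNu
  have cHL : Commute (M + N) (A.L 0) := cML.add_left cNL
  have cNH : Commute (-N) (M + N) := (cMN.symm.add_right (Commute.refl N)).neg_left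
  have c1 : ∀ (X : Module.End ℂ V) (z : ℂ), Commute X (z • (1 : Module.End ℂ V)) := fun X z =>
    (Commute.one_right X).smul_right z
  set H := M + N with hH
  set K := binomOp (c • 1 + H) j with hK
  have cXK : ∀ {X : Module.End ℂ V}, Commute X H → Commute X K := fun hX =>
    commute_binomOp ((c1 _ c).add_right hX) j
  -- the arguments of the twisted vertex operator
  have hz : ∀ i : ℕ × ℕ, A.mode (K (dpow H i.1 x)) (m + j) y ∈
      (A.mode u 0).maxGenEigenspace (β₁ + β₂) := fun i =>
    apply_apply_mem_maxGenEigenspace (B := A.modeHom (m + j))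
      (fun v w => A.mode_zero_leibniz u v w _) (mem_maxGenEigenspace_of_commute (cXK cHu.symm).symm
        (mem_maxGenEigenspace_of_commute (commute_dpow cHu.symm i.1).symm hx)) hy
  have hzE : ∀ i : ℕ × ℕ, ∀ r, B ≤ r →
      A.deltaExpCoeff u r (A.mode (K (dpow H i.1 x)) (m + j) y) = 0 := fun i r hr => by
    refine h.deltaExpCoeff_eq_zero (A.mode_mem_weight (A.mem_weight_of_commute
      (cXK cHL.symm).symm (A.mem_weight_of_commute (commute_dpow cHL.symm i.1).symm hxd)) hyd
      (m + j)) ?_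
    omega
  -- Conjugation moves $E_r$ inside the mode, and the Leibniz rule distributes $e^{-N\log x_2}$ over
  -- both arguments; the remaining work is to commute the operators on the first argument into a
  -- fixed order.
  have e1 : ∀ i : ℕ × ℕ, ∀ r : ℕ, ∀ t : ℕ × ℕ, ∀ n : ℂ,
      coeffOp YW (dpow (-N) t.1 (A.deltaExpCoeff u r (A.mode (K (dpow H i.1 x)) (m + j) y)))
        n t.2 w =
      ∑ p ∈ antidiagonal r, ∑ q ∈ antidiagonal p.1, ∑ s ∈ antidiagonal t.1,
        iterHom A YW w (m + j + q.2) n t.2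
          (binomOp (-A.mode u 0 - (q.1 : ℂ) • 1) q.2 (K (dpow (-N) s.1 (dpow H i.1
            (A.deltaExpCoeff u q.1 x))))) (dpow (-N) s.2 (A.deltaExpCoeff u p.2 y)) := by
    intro i r t n
    simp only [h.deltaExpCoeff_mode, map_sum, hdN, coeffOp_sum, LinearMap.sum_apply, iterHom_apply]
    refine Finset.sum_congr rfl fun p _ => Finset.sum_congr rfl fun q _ =>
      Finset.sum_congr rfl fun s _ => ?_
    have cNb : Commute (dpow (-N) s.1) (binomOp (-A.mode u 0 - (q.1 : ℂ) • 1) q.2) :=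
      (commute_dpow (commute_binomOp ((cNu.neg_right.sub_right (c1 N _)).neg_left) q.2).symm
        s.1).symm
    have a1 : dpow (-N) s.1 (binomOp (-A.mode u 0 - (q.1 : ℂ) • 1) q.2
        (A.deltaExpCoeff u q.1 (K (dpow H i.1 x)))) =
        binomOp (-A.mode u 0 - (q.1 : ℂ) • 1) q.2 (dpow (-N) s.1
        (A.deltaExpCoeff u q.1 (K (dpow H i.1 x)))) := LinearMap.congr_fun cNb.eq _
    have a2 : A.deltaExpCoeff u q.1 (K (dpow H i.1 x)) =
        K (A.deltaExpCoeff u q.1 (dpow H i.1 x)) :=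
      LinearMap.congr_fun (cXK (cHE q.1).symm).eq _
    have a3 : A.deltaExpCoeff u q.1 (dpow H i.1 x) = dpow H i.1 (A.deltaExpCoeff u q.1 x) :=
      LinearMap.congr_fun (commute_dpow (cHE q.1).symm i.1).eq _
    have a4 : ∀ z, dpow (-N) s.1 (K z) = K (dpow (-N) s.1 z) := fun z =>
      LinearMap.congr_fun (commute_dpow (cXK cNH).symm s.1).symm.eq z
    rw [a1, a2, a3, a4]
  have e2 : ∀ i : ℕ × ℕ, coeffOp (deltaTwist A u YW) (A.mode (K (dpow H i.1 x)) (m + j) y)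
      (b - (c - j)) i.2 w = ∑ r ∈ Finset.range B, ∑ t ∈ antidiagonal i.2,
      ∑ p ∈ antidiagonal r, ∑ q ∈ antidiagonal p.1, ∑ s ∈ antidiagonal t.1,
        iterHom A YW w (m + j + q.2) (b - (c - j) + (β₁ + β₂) + r) t.2
          (binomOp (-A.mode u 0 - (q.1 : ℂ) • 1) q.2 (K (dpow (-N) s.1 (dpow H i.1
            (A.deltaExpCoeff u q.1 x))))) (dpow (-N) s.2 (A.deltaExpCoeff u p.2 y)) := by
    intro i
    rw [h.coeffOp_deltaTwist YW (hz i) (hzE i), LinearMap.sum_apply]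
    refine Finset.sum_congr rfl fun r _ => ?_
    rw [LinearMap.sum_apply]
    exact Finset.sum_congr rfl fun t _ => e1 i r t _
  simp only [e2]
  rw [Finset.sum_comm]
  refine Finset.sum_congr rfl fun r _ => ?_
  rw [sum_sum_sum_comm (antidiagonal l) (fun i => antidiagonal i.2) (antidiagonal r)]
  refine Finset.sum_congr rfl fun p hp => ?_
  rw [sum_sum_sum_comm (antidiagonal l) (fun i => antidiagonal i.2) (antidiagonal p.1)]
  refine Finset.sum_congr rfl fun q hq => ?_
  rw [sum_antidiagonal_rearrange l fun a₁ a₂ a₃ a₄ =>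
    iterHom A YW w (m + j + q.2) (b - (c - j) + (β₁ + β₂) + r) a₄
          (binomOp (-A.mode u 0 - (q.1 : ℂ) • 1) q.2 (K (dpow (-N) a₂ (dpow H a₁
            (A.deltaExpCoeff u q.1 x))))) (dpow (-N) a₃ (A.deltaExpCoeff u p.2 y)), iterTerm]
  refine Finset.sum_congr rfl fun s _ => Finset.sum_congr rfl fun t _ => ?_
  have hp' := Finset.HasAntidiagonal.mem_antidiagonal.1 hp
  have hq' := Finset.HasAntidiagonal.mem_antidiagonal.1 hq
  -- The power of $\log x_2$ attached to $\mathcal N_{gg_u}=M+N$ and the one from $\Delta(x_2)$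
  -- attached to $-N$ combine on the first argument to that of $M=\mathcal N_g$.
  have e3 : dpow M t.1 (A.deltaExpCoeff u q.1 x) = ∑ p ∈ antidiagonal t.1,
      dpow (-N) p.2 (dpow H p.1 (A.deltaExpCoeff u q.1 x)) := by
    rw [show M = -N + H by rw [hH]; abel, dpow_add cNH, LinearMap.sum_apply,
      ← Finset.Nat.sum_antidiagonal_swap]
    rfl
  have e4 : m + j + (q.2 : ℤ) = m + (q.2 + j) := by ring
  have e5 : b - (c - j) + (β₁ + β₂) + r = b - c + β₁ + β₂ + (q.1 + p.2 + q.2 + j) := by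
    rw [← hp', ← hq']; push_cast; ring
  rw [← hN, ← hM, ← hH, ← hK, e3, e4, e5]
  simp only [map_sum, LinearMap.sum_apply]

end Iterate

/-! ### Comparison with the iterates given by the module. -/

section Iterate

variable {V : Type*} [AddCommGroup V] [Module ℂ V] {A : VertexOperatorAlgebra V}
  {W : Type*} [AddCommGroup W] [Module ℂ W] {g : Module.End ℂ V} {u : V} {μ : ℂ}
  {YW : V →ₗ[ℂ] W →ₗ[ℂ] LogSeries W} {w : W}

/-- Chu-Vandermonde on a generalized eigenspace of `u₀`. -/
theorem binomOp_logNilpotent_apply (h : A.IsPrimaryCurrent u μ) (hg : A.IsAutomorphism g)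
    (hgu : g u = u) {β : ℂ} {x : V} (hx : x ∈ (A.mode u 0).maxGenEigenspace β) (c : ℂ)
    (r J : ℕ) :
    binomOp ((c - β - r) • 1 + logNilpotent g) J x = ∑ q ∈ antidiagonal J,
      binomOp (-A.mode u 0 - (r : ℂ) • 1) q.1
        (binomOp (c • 1 + (logNilpotent g + nilPart (A.mode u 0))) q.2 x) := by
  have hS := h.isSumOfGenEigenspaces
  have cMu := commute_logNilpotent_mode_zero hg hgu
  have cNu : Commute (nilPart (A.mode u 0)) (A.mode u 0) :=
    (commute_nilPart hS (Commute.refl _)).symm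
  have c1 : ∀ (X : Module.End ℂ V) (z : ℂ), Commute (z • (1 : Module.End ℂ V)) X := fun X z =>
    (Commute.one_left X).smul_left z
  have hc : Commute (-A.mode u 0 - (r : ℂ) • 1)
      (c • 1 + (logNilpotent g + nilPart (A.mode u 0))) :=
    ((c1 _ c).symm.add_right (cMu.symm.add_right cNu.symm).neg_left).sub_left (c1 _ _)
  -- On this eigenspace $u_0=\beta+N$, so $c-\beta-r+\mathcal N_g=(-u_0-r)+(c+\mathcal N_g+N)$.
  rw [binomOp_apply_congr (q := (A.mode u 0).maxGenEigenspace β)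
    (T := (-A.mode u 0 - (r : ℂ) • 1) + (c • 1 + (logNilpotent g + nilPart (A.mode u 0))))
    (fun v hv => ?_) (fun v hv => ?_) J hx, binomOp_add hc, LinearMap.sum_apply]
  · rfl
  · exact mem_maxGenEigenspace_of_commute ((c1 _ _).add_left cMu) hv
  · simp only [LinearMap.add_apply, LinearMap.sub_apply, LinearMap.neg_apply,
      LinearMap.smul_apply, Module.End.one_apply, nilPart_apply_of_mem hS hv]
    module

/-- The powers of $\log x_1$ from $\Delta(x_1)$ and from $x_1^{-\mathcal L_g}$ combine to that of
$-\mathcal N_{gg_u}$, and Chu–Vandermonde splits the binomial in the form produced by conjugation.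
-/
theorem sum_jacobiIter (h : A.IsPrimaryCurrent u μ) (hg : A.IsAutomorphism g)
    (hgu : g u = u) {e β₁ β₂ : ℂ} {x y : V} (hxg : x ∈ g.maxGenEigenspace e)
    (hx : x ∈ (A.mode u 0).maxGenEigenspace β₁) {d₁ d₂ : ℤ} (hxd : x ∈ A.weight d₁)
    (hyd : y ∈ A.weight d₂) {m : ℤ} {B : ℕ} (hB : d₁ + d₂ - m ≤ B) (k l : ℕ) {a c : ℂ}
    (hca : c = -(a + 1)) (he : e = Complex.exp (2 * Real.pi * Complex.I * (c - β₁))) (b : ℂ)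
    (r₁ r₂ : ℕ) :
    ∑ i ∈ antidiagonal k, ∑ i' ∈ antidiagonal l,
      jacobiIter A g YW (dpow (-nilPart (A.mode u 0)) i.1 (A.deltaExpCoeff u r₁ x))
        (dpow (-nilPart (A.mode u 0)) i'.1 (A.deltaExpCoeff u r₂ y)) w m (a + β₁ + r₁) i.2
        (b + β₂ + r₂) i'.2 =
      ∑ J ∈ Finset.range B, ∑ q ∈ antidiagonal J,
        iterTerm A g u YW w m l c (b - c + β₁ + β₂)
          (dpow (-(logNilpotent g + nilPart (A.mode u 0))) k x) y r₁ q.1 r₂ q.2 := by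
  have hS := h.isSumOfGenEigenspaces
  have cMN := commute_logNilpotent_nilPart h hg hgu
  have cMu := commute_logNilpotent_mode_zero hg hgu
  have cNu : Commute (nilPart (A.mode u 0)) (A.mode u 0) :=
    (commute_nilPart hS (Commute.refl _)).symm
  have cME := commute_logNilpotent_deltaExpCoeff h hg hgu
  have cNE := commute_nilPart_deltaExpCoeff h
  have cML : Commute (logNilpotent g) (A.L 0) :=
    (hg.commute_logNilpotent (hg.commute_L 0).symm).symm
  have cNL : Commute (nilPart (A.mode u 0)) (A.L 0) :=
    (commute_nilPart hS (h.commute_mode_zero_L 0).symm).symm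
  have cgN : Commute g (nilPart (A.mode u 0)) := commute_nilPart hS (hg.commute_mode hgu 0)
  have cgE : Commute g (A.deltaExpCoeff u r₁) :=
    h.commute_deltaExpCoeff (fun m _ => hg.commute_mode hgu m) r₁
  have c1 : ∀ (X : Module.End ℂ V) (z : ℂ), Commute (z • (1 : Module.End ℂ V)) X := fun X z =>
    (Commute.one_left X).smul_left z
  -- The exponent of $E$ shifts the eigenvalue by an integer, invisible to $e^{2\pi i\,\cdot}$.
  have he' : e = Complex.exp (2 * Real.pi * Complex.I * (c - β₁ - r₁)) := by
    rw [he, Complex.exp_eq_exp_iff_exists_int]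
    exact ⟨r₁, by push_cast; ring⟩
  have hterm := fun (z : V) (hz : z ∈ (A.mode u 0).maxGenEigenspace β₁) =>
    binomOp_logNilpotent_apply h hg hgu hz c r₁
  set N := nilPart (A.mode u 0) with hN
  set M := logNilpotent g with hM
  set c' := c - β₁ - r₁ with hc'
  set n : ℕ → ℂ := fun J => b + β₂ + r₂ - (c' - J)
  have e1 : ∀ i i' : ℕ × ℕ,
      jacobiIter A g YW (dpow (-N) i.1 (A.deltaExpCoeff u r₁ x))
        (dpow (-N) i'.1 (A.deltaExpCoeff u r₂ y)) w m (a + β₁ + r₁) i.2 (b + β₂ + r₂) i'.2 =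
      ∑ J ∈ Finset.range B, ∑ s ∈ antidiagonal i'.2, iterHom A YW w (m + J) (n J) s.2
        (binomOp (c' • 1 + M) J (dpow M s.1 (dpow (-M) i.2
          (dpow (-N) i.1 (A.deltaExpCoeff u r₁ x)))))
        (dpow (-N) i'.1 (A.deltaExpCoeff u r₂ y)) := by
    intro i i'
    have hxg' : dpow (-N) i.1 (A.deltaExpCoeff u r₁ x) ∈ g.maxGenEigenspace e :=
      mem_maxGenEigenspace_of_commute (commute_dpow cgN.neg_right i.1).symm
        (mem_maxGenEigenspace_of_commute cgE.symm hxg)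
    rw [hg.jacobiIter_apply YW hxg' _ w m _ _ _ _ (c := c') (by rw [hc', hca]; ring),
      if_pos he']
    refine finsum_eq_sum_of_support_subset _ fun J hJ => ?_
    by_contra hn
    refine hJ (Finset.sum_eq_zero fun s _ => ?_)
    have hy1 := A.mem_weight_of_commute (commute_dpow cNL.symm.neg_right i'.1).symm
      (h.deltaExpCoeff_mem_weight r₂ hyd)
    have hx1 := A.mem_weight_of_commute (commute_dpow cNL.symm.neg_right i.1).symm
      (h.deltaExpCoeff_mem_weight r₁ hxd)
    have hx2 := A.mem_weight_of_commute (commute_dpow cML.symm s.1).symm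
      (A.mem_weight_of_commute (commute_dpow cML.symm.neg_right i.2).symm hx1)
    have hx3 := A.mem_weight_of_commute (commute_binomOp ((c1 _ c').add_left cML).symm J).symm hx2
    have hJ' : B ≤ J := by simpa using hn
    rw [VertexOperatorAlgebra.eq_zero_of_mem_weight_neg h.weight_neg (by omega)
      (A.mode_mem_weight hx3 hy1 _), coeffOp_zero, LinearMap.zero_apply]
  simp only [e1]
  -- sum over the powers of `log x₁`
  have e2 : A.deltaExpCoeff u r₁ (dpow (-(M + N)) k x) =
      ∑ i ∈ antidiagonal k, dpow (-M) i.2 (dpow (-N) i.1 (A.deltaExpCoeff u r₁ x)) := by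
    have : A.deltaExpCoeff u r₁ (dpow (-(M + N)) k x) =
        dpow (-(M + N)) k (A.deltaExpCoeff u r₁ x) :=
      LinearMap.congr_fun (commute_dpow ((cME r₁).add_left (cNE r₁)).symm.neg_right k).eq x
    rw [this, show -(M + N) = -M + -N by abel, dpow_add cMN.neg_left.neg_right,
      LinearMap.sum_apply, ← Finset.Nat.sum_antidiagonal_swap]
    rfl
  have hz : A.deltaExpCoeff u r₁ (dpow (-(M + N)) k x) ∈ (A.mode u 0).maxGenEigenspace β₁ :=
    h.deltaExpCoeff_mem (mem_maxGenEigenspace_of_commute (commute_dpow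
      (cMu.add_left cNu).symm.neg_right k).symm hx) r₁
  have e3 : ∑ i ∈ antidiagonal k, ∑ i' ∈ antidiagonal l, ∑ J ∈ Finset.range B,
      ∑ s ∈ antidiagonal i'.2, iterHom A YW w (m + J) (n J) s.2
        (binomOp (c' • 1 + M) J (dpow M s.1 (dpow (-M) i.2
          (dpow (-N) i.1 (A.deltaExpCoeff u r₁ x)))))
        (dpow (-N) i'.1 (A.deltaExpCoeff u r₂ y)) =
      ∑ i' ∈ antidiagonal l, ∑ J ∈ Finset.range B,
      ∑ s ∈ antidiagonal i'.2, iterHom A YW w (m + J) (n J) s.2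
        (binomOp (c' • 1 + M) J (dpow M s.1 (A.deltaExpCoeff u r₁ (dpow (-(M + N)) k x))))
        (dpow (-N) i'.1 (A.deltaExpCoeff u r₂ y)) := by
    rw [Finset.sum_comm]
    refine Finset.sum_congr rfl fun i' _ => ?_
    rw [Finset.sum_comm]
    refine Finset.sum_congr rfl fun J _ => ?_
    rw [Finset.sum_comm]
    refine Finset.sum_congr rfl fun s _ => ?_
    rw [e2]
    simp only [map_sum, LinearMap.sum_apply]
  rw [e3, Finset.sum_comm]
  refine Finset.sum_congr rfl fun J _ => ?_
  set z := A.deltaExpCoeff u r₁ (dpow (-(M + N)) k x) with hzdef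
  -- Chu–Vandermonde applies because the vector stays in the $\beta_1$-eigenspace of $u_0$.
  have e4 : ∀ s : ℕ, binomOp (c' • 1 + M) J (dpow M s z) = ∑ q ∈ antidiagonal J,
      binomOp (-A.mode u 0 - (r₁ : ℂ) • 1) q.1 (binomOp (c • 1 + (M + N)) q.2 (dpow M s z)) :=
    fun s => hterm _ (mem_maxGenEigenspace_of_commute (commute_dpow cMu.symm s).symm hz) J
  simp only [e4, map_sum, LinearMap.sum_apply]
  rw [sum_sum_sum_comm (antidiagonal l) (fun i => antidiagonal i.2) (antidiagonal J)]
  refine Finset.sum_congr rfl fun q hq => ?_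
  have hq' := Finset.HasAntidiagonal.mem_antidiagonal.1 hq
  have e5 : m + (J : ℤ) = m + (q.1 + q.2) := by rw [← hq']; push_cast; ring
  have e6 : n J = b - c + β₁ + β₂ + (r₁ + r₂ + q.1 + q.2) := by
    simp only [n, hc']
    rw [← hq']; push_cast; ring
  rw [e5, e6]
  rfl

/-- Both sides are supported on the same values of $a$, as the $gg_u$-eigenvalue of $x$ is $e\cdot
e^{2\pi i\beta_1}$; there they are two groupings of the same family of `iterTerm`. -/
theorem jacobi_iterTerm (h : A.IsPrimaryCurrent u μ) (hg : A.IsAutomorphism g)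
    (hgu : g u = u) {e β₁ β₂ : ℂ} {x y : V} (hxg : x ∈ g.maxGenEigenspace e)
    (hx : x ∈ (A.mode u 0).maxGenEigenspace β₁) (hy : y ∈ (A.mode u 0).maxGenEigenspace β₂)
    {d₁ d₂ : ℤ} (hxd : x ∈ A.weight d₁)
    (hyd : y ∈ A.weight d₂) {m : ℤ} {B : ℕ} (hB : d₁ + d₂ - m ≤ B) (k l : ℕ) (a b : ℂ) :
    ∑ r₁ ∈ Finset.range B, ∑ r₂ ∈ Finset.range B,
    ∑ i ∈ antidiagonal k, ∑ i' ∈ antidiagonal l,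
      jacobiIter A g YW (dpow (-nilPart (A.mode u 0)) i.1 (A.deltaExpCoeff u r₁ x))
        (dpow (-nilPart (A.mode u 0)) i'.1 (A.deltaExpCoeff u r₂ y)) w m (a + β₁ + r₁) i.2
        (b + β₂ + r₂) i'.2 =
    jacobiIter A (g * A.innerAut u) (deltaTwist A u YW) x y w m a k b l := by
  have hS := h.isSumOfGenEigenspaces
  have hτ := Complex.two_pi_I_ne_zero
  have cMu := commute_logNilpotent_mode_zero hg hgu
  have cNu : Commute (nilPart (A.mode u 0)) (A.mode u 0) :=
    (commute_nilPart hS (Commute.refl _)).symm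
  have cML : Commute (logNilpotent g) (A.L 0) :=
    (hg.commute_logNilpotent (hg.commute_L 0).symm).symm
  have cNL : Commute (nilPart (A.mode u 0)) (A.L 0) :=
    (commute_nilPart hS (h.commute_mode_zero_L 0).symm).symm
  have cHL := cML.add_left cNL
  have c1 : ∀ (X : Module.End ℂ V) (z : ℂ), Commute (z • (1 : Module.End ℂ V)) X := fun X z =>
    (Commute.one_left X).smul_left z
  have hxh : x ∈ (g * A.innerAut u).maxGenEigenspace
      (e * Complex.exp (2 * Real.pi * Complex.I * β₁)) :=
    mem_maxGenEigenspace_mul (commute_expOp_smul hS hτ (hg.commute_mode hgu 0)) hxg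
      (mem_maxGenEigenspace_expOp_smul hS hτ hx)
  rw [(hg.mul h.isAutomorphism_innerAut).jacobiIter_apply _ hxh y w m a k b l rfl,
    h.logNilpotent_mul_innerAut hg hgu]
  set c := -(a + 1) with hc
  have hiff : e * Complex.exp (2 * Real.pi * Complex.I * β₁) =
      Complex.exp (2 * Real.pi * Complex.I * c) ↔
      e = Complex.exp (2 * Real.pi * Complex.I * (c - β₁)) := by
    rw [mul_sub, Complex.exp_sub, eq_div_iff (Complex.exp_ne_zero _)]
  split_ifs with he
  · simp only [sum_jacobiIter h hg hgu hxg hx hxd hyd hB k l hc (hiff.1 he)]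
    have hxH : dpow (-(logNilpotent g + nilPart (A.mode u 0))) k x ∈ A.weight d₁ :=
      A.mem_weight_of_commute (commute_dpow cHL.symm.neg_right k).symm hxd
    rw [sum_range_antidiagonal_eq B (fun a₁ a₂ a₃ a₄ => iterTerm A g u YW w m l c
      (b - c + β₁ + β₂) (dpow (-(logNilpotent g + nilPart (A.mode u 0))) k x) y a₁ a₂ a₃ a₄)]
    · rw [finsum_eq_sum_of_support_subset (s := Finset.range B)]
      · refine Finset.sum_congr rfl fun j _ => ?_
        refine (coeffOp_deltaTwist_iterate h hg hgu (mem_maxGenEigenspace_of_commute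
          (commute_dpow (cMu.add_left cNu).symm.neg_right k).symm hx) hy hxH hyd hB l c b j).symm
      · intro J hJ
        by_contra hn
        have hJ' : B ≤ J := by simpa using hn
        refine hJ (Finset.sum_eq_zero fun s _ => ?_)
        have hx2 := A.mem_weight_of_commute (commute_binomOp ((c1 _ c).add_left cHL).symm J).symm
          (A.mem_weight_of_commute (commute_dpow cHL.symm s.1).symm hxH)
        rw [VertexOperatorAlgebra.eq_zero_of_mem_weight_neg h.weight_neg (by omega)
          (A.mode_mem_weight hx2 hyd _), coeffOp_zero, LinearMap.zero_apply]
    · intro a₁ a₂ a₃ a₄ ha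
      exact iterTerm_eq_zero h hg hxH hyd (by omega) _ _ _
  -- If the eigenvalue condition fails for $gg_u$, it fails for $g$ at every shift $\beta_1+r_1$,
  -- because $r_1$ is an integer.
  · refine Finset.sum_eq_zero fun r₁ _ => Finset.sum_eq_zero fun r₂ _ =>
      Finset.sum_eq_zero fun i _ => Finset.sum_eq_zero fun i' _ => ?_
    have cgN : Commute g (nilPart (A.mode u 0)) := commute_nilPart hS (hg.commute_mode hgu 0)
    have cgE : Commute g (A.deltaExpCoeff u r₁) :=
      h.commute_deltaExpCoeff (fun m _ => hg.commute_mode hgu m) r₁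
    have hxg' : dpow (-nilPart (A.mode u 0)) i.1 (A.deltaExpCoeff u r₁ x) ∈
        g.maxGenEigenspace e :=
      mem_maxGenEigenspace_of_commute (commute_dpow cgN.neg_right i.1).symm
        (mem_maxGenEigenspace_of_commute cgE.symm hxg)
    rw [hg.jacobiIter_apply YW hxg' _ w m _ _ _ _ (c := c - β₁ - r₁) (by rw [hc]; ring), if_neg]
    intro he2
    refine he (hiff.2 (he2.trans ?_))
    rw [Complex.exp_eq_exp_iff_exists_int]
    exact ⟨-r₁, by push_cast; ring⟩

end Iterate

/-! ### Expansion of the products -/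

theorem finsum_sum_sum_sum_sum_comm {M ι κ ι' κ' : Type*} [AddCommMonoid M] (s : Finset ι)
    (t : Finset κ) (s' : Finset ι') (t' : Finset κ') (f : ι → κ → ι' → κ' → ℕ → M)
    (hf : ∀ a b c d, (Function.support (f a b c d)).Finite) :
    ∑ᶠ j, ∑ a ∈ s, ∑ b ∈ t, ∑ c ∈ s', ∑ d ∈ t', f a b c d j =
      ∑ a ∈ s, ∑ b ∈ t, ∑ c ∈ s', ∑ d ∈ t', ∑ᶠ j, f a b c d j := by
  simp only [← Finset.sum_product']
  exact finsum_sum_comm _ _ fun p _ => hf _ _ _ _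

theorem sum_sum_apply_sum_sum {W ι κ ι' κ' : Type*} [AddCommGroup W] [Module ℂ W] (s : Finset ι)
    (t : Finset κ) (s' : Finset ι') (t' : Finset κ') (f : ι → ι' → Module.End ℂ W)
    (x : κ → κ' → W) :
    (∑ a ∈ s, ∑ c ∈ s', f a c) (∑ b ∈ t, ∑ d ∈ t', x b d) =
      ∑ a ∈ s, ∑ b ∈ t, ∑ c ∈ s', ∑ d ∈ t', f a c (x b d) := by
  simp only [LinearMap.sum_apply]
  refine Finset.sum_congr rfl fun a _ => ?_
  simp only [map_sum]
  rw [Finset.sum_comm]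

theorem sum_sum_sum_sum_swap {M ι κ ι' κ' : Type*} [AddCommMonoid M] (s : Finset ι)
    (t : Finset κ) (s' : Finset ι') (t' : Finset κ') (f : ι → κ → ι' → κ' → M) :
    ∑ b ∈ t, ∑ a ∈ s, ∑ d ∈ t', ∑ c ∈ s', f a b c d =
      ∑ a ∈ s, ∑ b ∈ t, ∑ c ∈ s', ∑ d ∈ t', f a b c d := by
  rw [Finset.sum_comm]
  exact Finset.sum_congr rfl fun a _ => Finset.sum_congr rfl fun b _ => Finset.sum_comm

section Products

variable {V : Type*} [AddCommGroup V] [Module ℂ V] {A : VertexOperatorAlgebra V}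
  {W : Type*} [AddCommGroup W] [Module ℂ W] {u : V} {μ : ℂ}
  {YW : V →ₗ[ℂ] W →ₗ[ℂ] LogSeries W}

theorem finite_support_coeffOp_sub
    (ht : ∀ (v : V) (w : W), ∃ B : ℝ, ∀ n : ℂ, n.re < B → ∀ k : ℕ, coeffOp YW v n k w = 0)
    (v : V) (b : ℂ) (l : ℕ) (w : W) :
    (Function.support fun j : ℕ => coeffOp YW v (b - j) l w).Finite := by
  obtain ⟨B, hB⟩ := ht v w
  obtain ⟨J, hJ⟩ := exists_nat_gt (b.re - B)
  refine (Finset.range J).finite_toSet.subset fun j hj => ?_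
  by_contra hn
  refine hj (hB _ ?_ l)
  have : (J : ℝ) ≤ j := by simpa using hn
  simp
  linarith

theorem finite_support_jacobiProd
    (ht : ∀ (v : V) (w : W), ∃ B : ℝ, ∀ n : ℂ, n.re < B → ∀ k : ℕ, coeffOp YW v n k w = 0)
    (x y : V) (w : W) (m : ℤ) (a : ℂ) (k : ℕ) (b : ℂ) (l : ℕ) :
    (Function.support fun j : ℕ => ((-1 : ℂ) ^ j * (Ring.choose m j : ℤ)) •
      coeffOp YW x (a - m + j) k (coeffOp YW y (b - j) l w)).Finite :=
  (finite_support_coeffOp_sub ht y b l w).subset fun j hj e => hj (by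
    simp only at e
    simp only [e, map_zero, smul_zero])

theorem finite_support_jacobiProdOpp
    (ht : ∀ (v : V) (w : W), ∃ B : ℝ, ∀ n : ℂ, n.re < B → ∀ k : ℕ, coeffOp YW v n k w = 0)
    (x y : V) (w : W) (m : ℤ) (a : ℂ) (k : ℕ) (b : ℂ) (l : ℕ) :
    (Function.support fun j : ℕ => ((-1 : ℂ) ^ (m - j) * (Ring.choose m j : ℤ)) •
      coeffOp YW y (b - m + j) l (coeffOp YW x (a - j) k w)).Finite :=
  (finite_support_coeffOp_sub ht x a k w).subset fun j hj e => hj (by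
    simp only at e
    simp only [e, map_zero, smul_zero])

/-- Each factor $\Delta(x_i)$ only shifts the exponents and logarithmic degree in its own variable,
so it passes through the binomial expansion of the delta function. -/
theorem jacobiProd_deltaTwist (h : A.IsPrimaryCurrent u μ)
    (ht : ∀ (v : V) (w : W), ∃ B : ℝ, ∀ n : ℂ, n.re < B → ∀ k : ℕ, coeffOp YW v n k w = 0)
    {β₁ β₂ : ℂ} {x y : V} (hx : x ∈ (A.mode u 0).maxGenEigenspace β₁)
    (hy : y ∈ (A.mode u 0).maxGenEigenspace β₂) {B : ℕ}
    (hxB : ∀ r, B ≤ r → A.deltaExpCoeff u r x = 0) (hyB : ∀ r, B ≤ r → A.deltaExpCoeff u r y = 0)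
    (w : W) (m : ℤ) (a : ℂ) (k : ℕ) (b : ℂ) (l : ℕ) :
    jacobiProd (deltaTwist A u YW) x y w m a k b l =
      ∑ r₁ ∈ Finset.range B, ∑ r₂ ∈ Finset.range B, ∑ i ∈ antidiagonal k, ∑ i' ∈ antidiagonal l,
        jacobiProd YW (dpow (-nilPart (A.mode u 0)) i.1 (A.deltaExpCoeff u r₁ x))
        (dpow (-nilPart (A.mode u 0)) i'.1 (A.deltaExpCoeff u r₂ y)) w m (a + β₁ + r₁) i.2
        (b + β₂ + r₂) i'.2 := by
  simp only [jacobiProd]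
  rw [← finsum_sum_sum_sum_sum_comm _ _ _ _ _ fun _ _ _ _ =>
    finite_support_jacobiProd ht _ _ w m _ _ _ _]
  refine finsum_congr fun j => ?_
  rw [h.coeffOp_deltaTwist YW hx hxB, h.coeffOp_deltaTwist YW hy hyB]
  simp only [LinearMap.sum_apply (f := fun r₂ : ℕ => ∑ i' ∈ antidiagonal l, coeffOp YW (dpow
    (-nilPart (A.mode u 0)) i'.1 (A.deltaExpCoeff u r₂ y)) (b - j + β₂ + r₂) i'.2)]
  simp only [LinearMap.sum_apply (t := antidiagonal l)]
  rw [sum_sum_apply_sum_sum]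
  simp only [Finset.smul_sum]
  refine Finset.sum_congr rfl fun r₁ _ => Finset.sum_congr rfl fun r₂ _ =>
    Finset.sum_congr rfl fun i _ => Finset.sum_congr rfl fun i' _ => ?_
  rw [show a - m + j + β₁ + r₁ = a + β₁ + r₁ - m + j by ring,
    show b - j + β₂ + r₂ = b + β₂ + r₂ - j by ring]

theorem jacobiProdOpp_deltaTwist (h : A.IsPrimaryCurrent u μ)
    (ht : ∀ (v : V) (w : W), ∃ B : ℝ, ∀ n : ℂ, n.re < B → ∀ k : ℕ, coeffOp YW v n k w = 0)
    {β₁ β₂ : ℂ} {x y : V} (hx : x ∈ (A.mode u 0).maxGenEigenspace β₁)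
    (hy : y ∈ (A.mode u 0).maxGenEigenspace β₂) {B : ℕ}
    (hxB : ∀ r, B ≤ r → A.deltaExpCoeff u r x = 0) (hyB : ∀ r, B ≤ r → A.deltaExpCoeff u r y = 0)
    (w : W) (m : ℤ) (a : ℂ) (k : ℕ) (b : ℂ) (l : ℕ) :
    jacobiProdOpp (deltaTwist A u YW) x y w m a k b l =
      ∑ r₁ ∈ Finset.range B, ∑ r₂ ∈ Finset.range B, ∑ i ∈ antidiagonal k, ∑ i' ∈ antidiagonal l,
        jacobiProdOpp YW (dpow (-nilPart (A.mode u 0)) i.1 (A.deltaExpCoeff u r₁ x))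
        (dpow (-nilPart (A.mode u 0)) i'.1 (A.deltaExpCoeff u r₂ y)) w m (a + β₁ + r₁) i.2
        (b + β₂ + r₂) i'.2 := by
  simp only [jacobiProdOpp]
  rw [← finsum_sum_sum_sum_sum_comm _ _ _ _ _ fun _ _ _ _ =>
    finite_support_jacobiProdOpp ht _ _ w m _ _ _ _]
  refine finsum_congr fun j => ?_
  rw [h.coeffOp_deltaTwist YW hx hxB, h.coeffOp_deltaTwist YW hy hyB]
  simp only [LinearMap.sum_apply (f := fun r₁ : ℕ => ∑ i ∈ antidiagonal k, coeffOp YW (dpow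
    (-nilPart (A.mode u 0)) i.1 (A.deltaExpCoeff u r₁ x)) (a - j + β₁ + r₁) i.2)]
  simp only [LinearMap.sum_apply (t := antidiagonal k)]
  rw [sum_sum_apply_sum_sum, sum_sum_sum_sum_swap]
  simp only [Finset.smul_sum]
  refine Finset.sum_congr rfl fun r₁ _ => Finset.sum_congr rfl fun r₂ _ =>
    Finset.sum_congr rfl fun i _ => Finset.sum_congr rfl fun i' _ => ?_
  rw [show b - m + j + β₂ + r₂ = b + β₂ + r₂ - m + j by ring,
    show a - j + β₁ + r₁ = a + β₁ + r₁ - j by ring]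

end Products

variable {V : Type*} [AddCommGroup V] [Module ℂ V] {A : VertexOperatorAlgebra V}
  {W : Type*} [AddCommGroup W] [Module ℂ W] {g : Module.End ℂ V} {u : V} {μ : ℂ}

/-! ### Additivity of the three terms of the Jacobi identity. -/

section Linearity

variable {YW : V →ₗ[ℂ] W →ₗ[ℂ] LogSeries W}

theorem jacobiProd_add_left
    (ht : ∀ (v : V) (w : W), ∃ B : ℝ, ∀ n : ℂ, n.re < B → ∀ k : ℕ, coeffOp YW v n k w = 0)
    (x x' y : V) (w : W) (m : ℤ) (a : ℂ) (k : ℕ) (b : ℂ) (l : ℕ) :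
    jacobiProd YW (x + x') y w m a k b l =
      jacobiProd YW x y w m a k b l + jacobiProd YW x' y w m a k b l := by
  rw [jacobiProd, jacobiProd, jacobiProd, ← finsum_add_distrib
    (finite_support_jacobiProd ht x y w m a k b l) (finite_support_jacobiProd ht x' y w m a k b l)]
  simp only [coeffOp_add, LinearMap.add_apply, smul_add]

theorem jacobiProd_add_right
    (ht : ∀ (v : V) (w : W), ∃ B : ℝ, ∀ n : ℂ, n.re < B → ∀ k : ℕ, coeffOp YW v n k w = 0)
    (x y y' : V) (w : W) (m : ℤ) (a : ℂ) (k : ℕ) (b : ℂ) (l : ℕ) :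
    jacobiProd YW x (y + y') w m a k b l =
      jacobiProd YW x y w m a k b l + jacobiProd YW x y' w m a k b l := by
  rw [jacobiProd, jacobiProd, jacobiProd, ← finsum_add_distrib
    (finite_support_jacobiProd ht x y w m a k b l) (finite_support_jacobiProd ht x y' w m a k b l)]
  simp only [coeffOp_add, LinearMap.add_apply, map_add, smul_add]

theorem jacobiProdOpp_add_left
    (ht : ∀ (v : V) (w : W), ∃ B : ℝ, ∀ n : ℂ, n.re < B → ∀ k : ℕ, coeffOp YW v n k w = 0)
    (x x' y : V) (w : W) (m : ℤ) (a : ℂ) (k : ℕ) (b : ℂ) (l : ℕ) :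
    jacobiProdOpp YW (x + x') y w m a k b l =
      jacobiProdOpp YW x y w m a k b l + jacobiProdOpp YW x' y w m a k b l := by
  rw [jacobiProdOpp, jacobiProdOpp, jacobiProdOpp, ← finsum_add_distrib
    (finite_support_jacobiProdOpp ht x y w m a k b l)
    (finite_support_jacobiProdOpp ht x' y w m a k b l)]
  simp only [coeffOp_add, LinearMap.add_apply, map_add, smul_add]

theorem jacobiProdOpp_add_right
    (ht : ∀ (v : V) (w : W), ∃ B : ℝ, ∀ n : ℂ, n.re < B → ∀ k : ℕ, coeffOp YW v n k w = 0)
    (x y y' : V) (w : W) (m : ℤ) (a : ℂ) (k : ℕ) (b : ℂ) (l : ℕ) :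
    jacobiProdOpp YW x (y + y') w m a k b l =
      jacobiProdOpp YW x y w m a k b l + jacobiProdOpp YW x y' w m a k b l := by
  rw [jacobiProdOpp, jacobiProdOpp, jacobiProdOpp, ← finsum_add_distrib
    (finite_support_jacobiProdOpp ht x y w m a k b l)
    (finite_support_jacobiProdOpp ht x y' w m a k b l)]
  simp only [coeffOp_add, LinearMap.add_apply, smul_add]

variable (A g YW) in
/-- The terms of the sum defining `jacobiIter`. -/
def jacobiIterSummand (x y : V) (w : W) (m : ℤ) (a : ℂ) (k : ℕ) (b : ℂ) (l : ℕ) (p : ℤ × ℕ) : W :=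
  ∑ i ∈ antidiagonal l,
    coeffOp YW
      (A.mode (ratioPowCoeff ((p.1 : Module.End ℂ V) + logOp g) (-(a + 1)) p.2 k i.1 x)
        (m + p.2) y) (b - (-(a + 1) - p.2)) i.2 w

theorem jacobiIterSummand_add_left (x x' y : V) (w : W) (m : ℤ) (a : ℂ) (k : ℕ) (b : ℂ) (l : ℕ)
    (p : ℤ × ℕ) : jacobiIterSummand A g YW (x + x') y w m a k b l p =
      jacobiIterSummand A g YW x y w m a k b l p + jacobiIterSummand A g YW x' y w m a k b l p := by
  simp only [jacobiIterSummand, map_add, A.mode_add, LinearMap.add_apply, coeffOp_add,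
    Finset.sum_add_distrib]

theorem jacobiIterSummand_add_right (x y y' : V) (w : W) (m : ℤ) (a : ℂ) (k : ℕ) (b : ℂ) (l : ℕ)
    (p : ℤ × ℕ) : jacobiIterSummand A g YW x (y + y') w m a k b l p =
      jacobiIterSummand A g YW x y w m a k b l p + jacobiIterSummand A g YW x y' w m a k b l p := by
  simp only [jacobiIterSummand, map_add, LinearMap.add_apply, coeffOp_add,
    Finset.sum_add_distrib]

/-- For homogeneous arguments at most one $q$ matches the exponent and the weight bounds $j$.
Finiteness is needed since infinite formal sums are additive only on families of finite support. -/
theorem finite_support_jacobiIterSummand (hneg : ∀ n < 0, A.weight n = ⊥)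
    (hg : A.IsAutomorphism g) (x y : V) (w : W) (m : ℤ) (a : ℂ) (k : ℕ) (b : ℂ) (l : ℕ) :
    (Function.support (jacobiIterSummand A g YW x y w m a k b l)).Finite := by
  refine A.weight_induction (p := fun y =>
    (Function.support (jacobiIterSummand A g YW x y w m a k b l)).Finite) (fun d₂ y hy => ?_)
    (fun y y' hy hy' => ?_) y
  swap
  · rw [show jacobiIterSummand A g YW x (y + y') w m a k b l = _ from
      funext (jacobiIterSummand_add_right x y y' w m a k b l)]
    exact (hy.union hy').subset (Function.support_add _ _)
  have hadd : ∀ x x', (Function.support (jacobiIterSummand A g YW x y w m a k b l)).Finite →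
      (Function.support (jacobiIterSummand A g YW x' y w m a k b l)).Finite →
      (Function.support (jacobiIterSummand A g YW (x + x') y w m a k b l)).Finite := by
    intro x x' hx hx'
    rw [show jacobiIterSummand A g YW (x + x') y w m a k b l = _ from
      funext (jacobiIterSummand_add_left x x' y w m a k b l)]
    exact (hx.union hx').subset (Function.support_add _ _)
  refine A.weight_induction (p := fun x =>
    (Function.support (jacobiIterSummand A g YW x y w m a k b l)).Finite) (fun d₁ x hx => ?_)
    hadd x
  refine hg.isSumOfGenEigenspaces.induction_of_stable (q := A.weight d₁) (p := fun x =>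
    (Function.support (jacobiIterSummand A g YW x y w m a k b l)).Finite)
    (fun c v hv => A.mem_weight_of_commute
      (commute_eigenProj hg.isSumOfGenEigenspaces (hg.commute_L 0).symm c).symm hv)
    (fun e x hx hxe => ?_) hadd hx
  set α := logBranch 0 e / (2 * Real.pi * Complex.I)
  have hQ : {q : ℤ | -(a + 1) = q + α}.Finite := by
    refine Set.Subsingleton.finite fun q hq q' hq' => ?_
    have : (q : ℂ) + α = q' + α := hq.symm.trans hq'
    exact_mod_cast add_right_cancel this
  refine (hQ.prod (Finset.range (d₁ + d₂ - m).toNat).finite_toSet).subset fun p hp => ?_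
  by_contra hn
  refine hp (Finset.sum_eq_zero fun i _ => ?_)
  rw [hg.ratioPowCoeff_apply hxe]
  split_ifs with hs
  · have hp2 : d₁ + d₂ - m ≤ p.2 := by
      by_contra hlt
      exact hn ⟨hs, by simp; omega⟩
    have cML : Commute (logNilpotent g) (A.L 0) :=
      (hg.commute_logNilpotent (hg.commute_L 0).symm).symm
    have hx1 := A.mem_weight_of_commute (commute_dpow cML.symm i.1).symm
      (A.mem_weight_of_commute (commute_dpow cML.symm.neg_right k).symm hx)
    have hx2 := A.mem_weight_of_commute (commute_binomOp
      ((((Commute.one_left _).smul_left (-(a + 1))).add_left cML)).symm p.2).symm hx1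
    rw [VertexOperatorAlgebra.eq_zero_of_mem_weight_neg hneg (by omega)
      (A.mode_mem_weight hx2 hy _), coeffOp_zero, LinearMap.zero_apply]
  · rw [A.mode_zero, LinearMap.zero_apply, coeffOp_zero, LinearMap.zero_apply]

theorem jacobiIter_eq_finsum (hneg : ∀ n < 0, A.weight n = ⊥)
    (hg : A.IsAutomorphism g) (x y : V) (w : W) (m : ℤ) (a : ℂ) (k : ℕ) (b : ℂ) (l : ℕ) :
    jacobiIter A g YW x y w m a k b l = ∑ᶠ p, jacobiIterSummand A g YW x y w m a k b l p :=
  (finsum_curry _ (finite_support_jacobiIterSummand hneg hg x y w m a k b l)).symm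

theorem jacobiIter_add_left (hneg : ∀ n < 0, A.weight n = ⊥)
    (hg : A.IsAutomorphism g) (x x' y : V) (w : W) (m : ℤ) (a : ℂ) (k : ℕ) (b : ℂ) (l : ℕ) :
    jacobiIter A g YW (x + x') y w m a k b l =
      jacobiIter A g YW x y w m a k b l + jacobiIter A g YW x' y w m a k b l := by
  simp only [jacobiIter_eq_finsum hneg hg, jacobiIterSummand_add_left]
  exact finsum_add_distrib (finite_support_jacobiIterSummand hneg hg x y w m a k b l)
    (finite_support_jacobiIterSummand hneg hg x' y w m a k b l)

theorem jacobiIter_add_right (hneg : ∀ n < 0, A.weight n = ⊥)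
    (hg : A.IsAutomorphism g) (x y y' : V) (w : W) (m : ℤ) (a : ℂ) (k : ℕ) (b : ℂ) (l : ℕ) :
    jacobiIter A g YW x (y + y') w m a k b l =
      jacobiIter A g YW x y w m a k b l + jacobiIter A g YW x y' w m a k b l := by
  simp only [jacobiIter_eq_finsum hneg hg, jacobiIterSummand_add_right]
  exact finsum_add_distrib (finite_support_jacobiIterSummand hneg hg x y w m a k b l)
    (finite_support_jacobiIterSummand hneg hg x y' w m a k b l)

end Linearity

/-! ### The Jacobi identity for the twist. -/

variable {YW : V →ₗ[ℂ] W →ₗ[ℂ] LogSeries W} {gW : Module.End ℂ W}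
  {gr : ℂ → CmodZ → Submodule ℂ W}

/-- `V` is spanned by the joint generalized eigenvectors of `L(0)`, `g` and `u₀`. -/
theorem homogeneous_induction (h : A.IsPrimaryCurrent u μ) (hg : A.IsAutomorphism g)
    (hgu : g u = u) {p : V → Prop}
    (gen : ∀ (d : ℤ) (e β : ℂ) (v : V), v ∈ A.weight d → v ∈ g.maxGenEigenspace e →
      v ∈ (A.mode u 0).maxGenEigenspace β → p v)
    (add : ∀ v v', p v → p v' → p (v + v')) (v : V) : p v := by
  have hS := h.isSumOfGenEigenspaces
  have hT := hg.isSumOfGenEigenspaces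
  refine A.weight_induction (fun d v hv => ?_) add v
  refine hT.induction_of_stable (q := A.weight d) (fun c v hv => A.mem_weight_of_commute
      (commute_eigenProj hT (hg.commute_L 0).symm c).symm hv) (fun e v hv hve => ?_) add hv
  refine hS.induction_of_stable (q := A.weight d ⊓ g.maxGenEigenspace e)
    (fun c v hv => ⟨A.mem_weight_of_commute
      (commute_eigenProj hS (h.commute_mode_zero_L 0).symm c).symm hv.1,
      mem_maxGenEigenspace_of_commute (commute_eigenProj hS (hg.commute_mode hgu 0) c).symm hv.2⟩)
    (fun β v hv hvβ => gen d e β v hv.1 hv.2 hvβ) add ⟨hv, hve⟩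

theorem deltaTwist_jacobi (h : A.IsPrimaryCurrent u μ) (hg : A.IsAutomorphism g)
    (hgu : g u = u) (hW : IsTwistedModule A g YW gW gr) (x y : V) (w : W) (m : ℤ) (a : ℂ) (k : ℕ)
    (b : ℂ) (l : ℕ) :
    jacobiProd (deltaTwist A u YW) x y w m a k b l -
      jacobiProdOpp (deltaTwist A u YW) x y w m a k b l =
      jacobiIter A (g * A.innerAut u) (deltaTwist A u YW) x y w m a k b l := by
  have ht := deltaTwist_lowerTruncation h hW
  have hg' := hg.mul h.isAutomorphism_innerAut
  refine homogeneous_induction h hg hgu (p := fun x =>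
    jacobiProd (deltaTwist A u YW) x y w m a k b l -
      jacobiProdOpp (deltaTwist A u YW) x y w m a k b l =
      jacobiIter A (g * A.innerAut u) (deltaTwist A u YW) x y w m a k b l)
    (fun d₁ e β₁ x hxd hxg hx => ?_) (fun x x' hx hx' => ?_) x
  · refine homogeneous_induction h hg hgu (p := fun y =>
      jacobiProd (deltaTwist A u YW) x y w m a k b l -
        jacobiProdOpp (deltaTwist A u YW) x y w m a k b l =
        jacobiIter A (g * A.innerAut u) (deltaTwist A u YW) x y w m a k b l)
      (fun d₂ _ β₂ y hyd _ hy => ?_) (fun y y' hy hy' => ?_) y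
    -- One bound truncates the iterates and both polynomials $E(X)x$, $E(X)y$.
    · obtain ⟨B, hB₁, hB₂, hB₃⟩ : ∃ B : ℕ, d₁ + d₂ - m ≤ B ∧ d₁ < B ∧ d₂ < B :=
        ⟨(d₁ + d₂ - m).toNat + d₁.toNat + d₂.toNat + 1, by omega, by omega, by omega⟩
      have hxB : ∀ r, B ≤ r → A.deltaExpCoeff u r x = 0 := fun r hr =>
        h.deltaExpCoeff_eq_zero hxd (by omega)
      have hyB : ∀ r, B ≤ r → A.deltaExpCoeff u r y = 0 := fun r hr =>
        h.deltaExpCoeff_eq_zero hyd (by omega)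
      rw [jacobiProd_deltaTwist h hW.lowerTruncation hx hy hxB hyB,
        jacobiProdOpp_deltaTwist h hW.lowerTruncation hx hy hxB hyB,
        ← jacobi_iterTerm h hg hgu hxg hx hy hxd hyd hB₁]
      simp only [← Finset.sum_sub_distrib, hW.jacobi]
    · rw [jacobiProd_add_right ht, jacobiProdOpp_add_right ht,
        jacobiIter_add_right h.weight_neg hg', ← hy, ← hy']
      abel
  · rw [jacobiProd_add_left ht, jacobiProdOpp_add_left ht,
      jacobiIter_add_left h.weight_neg hg', ← hx, ← hx']
    abel

/-! ### Gradings as joint generalized eigenspaces. -/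

theorem coe_cmodZ_eq_iff {α β : ℂ} : (α : CmodZ) = β ↔
    Complex.exp (2 * Real.pi * Complex.I * α) = Complex.exp (2 * Real.pi * Complex.I * β) := by
  rw [QuotientAddGroup.eq_iff_sub_mem, AddSubgroup.mem_zmultiples_iff,
    Complex.exp_eq_exp_iff_exists_int]
  refine exists_congr fun k => ?_
  have := Complex.two_pi_I_ne_zero
  rw [zsmul_eq_mul, mul_one]
  constructor
  · intro e
    rw [e]; ring
  · intro e
    have : 2 * Real.pi * Complex.I * (k - (α - β)) = 0 := by linear_combination -e
    simpa [sub_eq_zero, Complex.two_pi_I_ne_zero] using this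

/-- The map `ℂ / ℤ → ℂ`, `α ↦ e ^ (2 π i α)`. -/
def cmodZExp (γ : CmodZ) : ℂ := Complex.exp (2 * Real.pi * Complex.I * γ.out)

theorem cmodZExp_coe (α : ℂ) :
    cmodZExp (α : CmodZ) = Complex.exp (2 * Real.pi * Complex.I * α) :=
  coe_cmodZ_eq_iff.1 (QuotientAddGroup.out_eq' _)

theorem cmodZExp_injective : Function.Injective cmodZExp := by
  intro γ δ e
  induction γ using QuotientAddGroup.induction_on with | _ γ =>
  induction δ using QuotientAddGroup.induction_on with | _ δ =>
  rw [cmodZExp_coe, cmodZExp_coe] at e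
  exact coe_cmodZ_eq_iff.2 e

theorem prodMk_cmodZExp_injective :
    Function.Injective fun p : ℂ × CmodZ => (p.1, cmodZExp p.2) := fun p q e => by
  rw [Prod.mk.injEq] at e
  exact Prod.ext e.1 (cmodZExp_injective e.2)

section Operators

variable {W : Type*} [AddCommGroup W] [Module ℂ W]

theorem iSupIndep_maxGenEigenspace_inf {S T : Module.End ℂ W} (h : Commute S T) :
    iSupIndep fun p : ℂ × ℂ => S.maxGenEigenspace p.1 ⊓ T.maxGenEigenspace p.2 := by
  have h1 := Module.End.independent_iInf_maxGenEigenspace_of_forall_mapsTo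
    (f := fun i : Bool => bif i then S else T) fun i j φ =>
      Module.End.mapsTo_maxGenEigenspace_of_comm (by
        cases i <;> cases j
        exacts [Commute.refl _, h, h.symm, Commute.refl _]) φ
  have h2 : Function.Injective fun (p : ℂ × ℂ) (i : Bool) => bif i then p.1 else p.2 :=
    fun p q e => Prod.ext (congrFun e true) (congrFun e false)
  convert h1.comp h2 using 2 with p
  simp [iInf_bool_eq]

theorem iSupIndep_maxGenEigenspace_inf_cmodZExp {S T : Module.End ℂ W} (h : Commute S T) :
    iSupIndep fun p : ℂ × CmodZ =>
      S.maxGenEigenspace p.1 ⊓ T.maxGenEigenspace (cmodZExp p.2) := by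
  have := (iSupIndep_maxGenEigenspace_inf h).comp prodMk_cmodZExp_injective
  exact this

theorem mem_maxGenEigenspace_add {S T : Module.End ℂ W} (h : Commute S T) {s t : ℂ} {w : W}
    (hs : w ∈ S.maxGenEigenspace s) (ht : w ∈ T.maxGenEigenspace t) :
    w ∈ (S + T).maxGenEigenspace (s + t) := by
  have := Module.End.genEigenspace_inf_le_add S T s t ⊤ ⊤ h ⟨hs, ht⟩
  rwa [top_add] at this

theorem mem_maxGenEigenspace_sub_add {S T : Module.End ℂ W} (h : Commute S T) {s t : ℂ} {w : W}
    (hs : w ∈ S.maxGenEigenspace s) (ht : w ∈ T.maxGenEigenspace t) (c : ℂ) :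
    w ∈ (S - T + algebraMap ℂ (Module.End ℂ W) c).maxGenEigenspace (s - t + c) := by
  have h1 : w ∈ (-T).maxGenEigenspace (-t) := by
    have := maxGenEigenspace_smul T (neg_ne_zero.2 one_ne_zero) t (z := -1)
    rw [neg_one_smul, neg_one_mul] at this
    rwa [this]
  have h2 : w ∈ (algebraMap ℂ (Module.End ℂ W) c).maxGenEigenspace c :=
    (Module.End.mem_maxGenEigenspace _ _ _).2
      ⟨1, by simp [Algebra.algebraMap_eq_smul_one]⟩
  rw [sub_eq_add_neg, sub_eq_add_neg]
  exact mem_maxGenEigenspace_add (Algebra.commute_algebraMap_right c _)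
    (mem_maxGenEigenspace_add h.neg_right hs h1) h2

theorem exists_pow_sub_algebraMap_apply_eq_zero {T : Module.End ℂ W} {c : ℂ} {w : W} :
    (∃ K : ℕ, ((T - algebraMap ℂ (Module.End ℂ W) c) ^ K) w = 0) ↔ w ∈ T.maxGenEigenspace c := by
  rw [Module.End.mem_maxGenEigenspace, Algebra.algebraMap_eq_smul_one]

end Operators

variable {V : Type*} [AddCommGroup V] [Module ℂ V] {A : VertexOperatorAlgebra V}
  {W : Type*} [AddCommGroup W] [Module ℂ W] {g : Module.End ℂ V} {u : V} {μ : ℂ}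
  {YW : V →ₗ[ℂ] W →ₗ[ℂ] LogSeries W} {gW : Module.End ℂ W}
  {gr : ℂ → CmodZ → Submodule ℂ W}

/-- The axioms give one inclusion. The homogeneous subspaces span $W$ and the joint eigenspaces of
the commuting operators $L_W(0)$ and $g$ are independent, so nothing more fits in. -/
theorem IsTwistedModule.grading_eq (hW : IsTwistedModule A g YW gW gr) (hg : A.IsAutomorphism g)
    (n : ℂ) (α : CmodZ) :
    gr n α = (LZero A YW).maxGenEigenspace n ⊓ gW.maxGenEigenspace (cmodZExp α) := by
  have hle : ∀ p : ℂ × CmodZ, gr p.1 p.2 ≤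
      (LZero A YW).maxGenEigenspace p.1 ⊓ gW.maxGenEigenspace (cmodZExp p.2) := by
    rintro ⟨n, α⟩ w hw
    refine ⟨exists_pow_sub_algebraMap_apply_eq_zero.1
      (hW.gradingLZero n w (Submodule.mem_iSup_of_mem α hw)), ?_⟩
    induction α using QuotientAddGroup.induction_on with | _ α =>
    rw [cmodZExp_coe]
    exact exists_pow_sub_algebraMap_apply_eq_zero.1
      (hW.gradingAct α w (Submodule.mem_iSup_of_mem n hw))
  have hind := iSupIndep_maxGenEigenspace_inf_cmodZExp (hW.commute_act_LZero hg).symm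
  exact le_antisymm (hle (n, α))
    (le_of_iSupIndep_of_iSup_eq_top hle hind hW.isInternal.submodule_iSup_eq_top (n, α))

/-- Eigenvalues of commuting operators combine: $(n+\beta-\frac12\mu)-\beta+\frac12\mu=n$ and
$e^{2\pi i\alpha}e^{2\pi i\beta}=e^{2\pi i\gamma}$. -/
theorem deltaGrading_le (h : A.IsPrimaryCurrent u μ) (hW : IsTwistedModule A g YW gW gr)
    (hg : A.IsAutomorphism g) (hgu : g u = u) (hsum : IsSumOfGenEigenspaces (zeroMode YW u))
    (n : ℂ) (γ : CmodZ) :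
    deltaGrading u YW gr μ n γ ≤
      (LZero A YW - zeroMode YW u + algebraMap ℂ (Module.End ℂ W) (μ / 2)).maxGenEigenspace n ⊓
        (gW * innerAct u YW).maxGenEigenspace (cmodZExp γ) := by
  refine iSup_le fun α => iSup_le fun β => iSup_le fun e => ?_
  rintro w ⟨hw, hwβ⟩
  rw [hW.grading_eq hg] at hw
  have hτ := Complex.two_pi_I_ne_zero
  constructor
  · have := mem_maxGenEigenspace_sub_add (hW.commute_zeroMode_LZero hg hgu h).symm hw.1 hwβ (μ / 2)
    rwa [show n + β - μ / 2 - β + μ / 2 = n by ring] at this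
  · have := mem_maxGenEigenspace_mul (commute_expOp_smul hsum hτ (hW.commute_act_zeroMode hgu))
      hw.2 (mem_maxGenEigenspace_expOp_smul hsum hτ hwβ)
    convert this using 1
    subst e
    induction α using QuotientAddGroup.induction_on with | _ α =>
    rw [← QuotientAddGroup.mk_add, cmodZExp_coe, cmodZExp_coe, mul_add, Complex.exp_add]
    exact Iff.rfl

theorem iSup_deltaGrading (h : A.IsPrimaryCurrent u μ) (hW : IsTwistedModule A g YW gW gr)
    (hg : A.IsAutomorphism g) (hgu : g u = u) (hsum : IsSumOfGenEigenspaces (zeroMode YW u)) :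
    ⨆ p : ℂ × CmodZ, deltaGrading u YW gr μ p.1 p.2 = ⊤ := by
  rw [eq_top_iff, ← hW.isInternal.submodule_iSup_eq_top]
  refine iSup_le ?_
  rintro ⟨n, α⟩ w hw
  refine hsum.induction_of_stable (q := gr n α)
    (p := fun w => w ∈ ⨆ p : ℂ × CmodZ, deltaGrading u YW gr μ p.1 p.2) (fun c v hv => ?_)
    (fun β w hw hwβ => ?_) (fun w w' => Submodule.add_mem _) hw
  · rw [hW.grading_eq hg] at hv ⊢
    exact ⟨mem_maxGenEigenspace_of_commute
      (commute_eigenProj hsum (hW.commute_zeroMode_LZero hg hgu h).symm c).symm hv.1,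
      mem_maxGenEigenspace_of_commute
      (commute_eigenProj hsum (hW.commute_act_zeroMode hgu) c).symm hv.2⟩
  -- The new degree is obtained by solving $n'+\beta-\frac12\mu=n$ for $n'$.
  · refine Submodule.mem_iSup_of_mem (n - β + μ / 2, α + (β : CmodZ)) ?_
    refine Submodule.mem_iSup_of_mem α (Submodule.mem_iSup_of_mem β
      (Submodule.mem_iSup_of_mem rfl ⟨?_, hwβ⟩))
    rwa [show n - β + μ / 2 + β - μ / 2 = n by ring]

theorem deltaGrading_isInternal (h : A.IsPrimaryCurrent u μ) (hW : IsTwistedModule A g YW gW gr)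
    (hg : A.IsAutomorphism g) (hgu : g u = u) (hsum : IsSumOfGenEigenspaces (zeroMode YW u)) :
    DirectSum.IsInternal fun p : ℂ × CmodZ => deltaGrading u YW gr μ p.1 p.2 := by
  refine DirectSum.isInternal_submodule_of_iSupIndep_of_iSup_eq_top ?_
    (iSup_deltaGrading h hW hg hgu hsum)
  have hτ := Complex.two_pi_I_ne_zero
  have cLZ := (hW.commute_zeroMode_LZero hg hgu h).symm
  have cgZ := hW.commute_act_zeroMode hgu
  have cgL := hW.commute_act_LZero hg
  have c : Commute (LZero A YW - zeroMode YW u + algebraMap ℂ (Module.End ℂ W) (μ / 2))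
      (gW * innerAct u YW) :=
    ((cgL.symm.sub_left cgZ.symm).add_left (Algebra.commute_algebraMap_left _ _)).mul_right
      (commute_expOp_smul hsum hτ
        ((cLZ.sub_left (Commute.refl _)).add_left (Algebra.commute_algebraMap_left _ _)))
  exact (iSupIndep_maxGenEigenspace_inf_cmodZExp c).mono
    fun p => deltaGrading_le h hW hg hgu hsum p.1 p.2

/-- The new pieces span $W$ and lie in independent generalized eigenspaces, so they exhaust them. -/
theorem iSup_deltaGrading_eq (h : A.IsPrimaryCurrent u μ) (hW : IsTwistedModule A g YW gW gr)
    (hg : A.IsAutomorphism g) (hgu : g u = u) (hsum : IsSumOfGenEigenspaces (zeroMode YW u))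
    (n : ℂ) :
    ⨆ γ, deltaGrading u YW gr μ n γ =
      (LZero A YW - zeroMode YW u + algebraMap ℂ (Module.End ℂ W) (μ / 2)).maxGenEigenspace n := by
  have hle : ∀ n, ⨆ γ, deltaGrading u YW gr μ n γ ≤
      (LZero A YW - zeroMode YW u + algebraMap ℂ (Module.End ℂ W) (μ / 2)).maxGenEigenspace n :=
    fun n => iSup_le fun γ => (deltaGrading_le h hW hg hgu hsum n γ).trans inf_le_left
  refine le_antisymm (hle n) (le_of_iSupIndep_of_iSup_eq_top hle
    (Module.End.independent_maxGenEigenspace _) ?_ n)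
  rw [← iSup_deltaGrading h hW hg hgu hsum, iSup_prod]

theorem isTwistedModule_deltaTwist (h : A.IsPrimaryCurrent u μ)
    (hW : IsTwistedModule A g YW gW gr) (hg : A.IsAutomorphism g) (hgu : g u = u)
    (hsum : IsSumOfGenEigenspaces (zeroMode YW u)) :
    IsTwistedModule A (g * A.innerAut u) (deltaTwist A u YW) (gW * innerAct u YW)
      (deltaGrading u YW gr μ) where
  isInternal := deltaGrading_isInternal h hW hg hgu hsum
  act_bijective := hW.act_bijective.comp (bijective_expOp_smul hsum Complex.two_pi_I_ne_zero)
  act_compat := deltaTwist_act_compat h hg hgu hW hsum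
  equivariance p _ hz := deltaTwist_equivariance h hg hgu hW p hz
  identity := deltaTwist_identity h hW
  lowerTruncation := deltaTwist_lowerTruncation h hW
  jacobi := deltaTwist_jacobi h hg hgu hW
  gradingLZero n w hw := by
    rw [LZero_deltaTwist h hW]
    rw [iSup_deltaGrading_eq h hW hg hgu hsum] at hw
    exact exists_pow_sub_algebraMap_apply_eq_zero.2 hw
  gradingAct α w hw := by
    rw [exists_pow_sub_algebraMap_apply_eq_zero, ← cmodZExp_coe]
    exact iSup_le (fun n => (deltaGrading_le h hW hg hgu hsum n α).trans inf_le_right) hw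
  derivative := deltaTwist_derivative h hW

end TwistedVOA

end

theorem theorem4p3 {V : Type*} [AddCommGroup V] [Module ℂ V]
    {W : Type*} [AddCommGroup W] [Module ℂ W]
    (A : TwistedVOA.VertexOperatorAlgebra V)
    (hV0 : A.weight 0 = Submodule.span ℂ {A.vacuum})
    (hVneg : ∀ n < 0, A.weight n = ⊥)
    (g : Module.End ℂ V) (hg : A.IsAutomorphism g)
    (u : V) (hu : u ∈ A.weight 1) (hL1u : A.L 1 u = 0) (hgu : g u = u)
    (YW : V →ₗ[ℂ] W →ₗ[ℂ] TwistedVOA.LogSeries W) (gW : Module.End ℂ W)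
    (gr : ℂ → TwistedVOA.CmodZ → Submodule ℂ W)
    (hW : TwistedVOA.IsTwistedModule A g YW gW gr)
    (hsum : TwistedVOA.IsSumOfGenEigenspaces (TwistedVOA.zeroMode YW u)) :
    A.IsAutomorphism (g * A.innerAut u) ∧
    ∃ μ : ℂ, A.mode u 1 u = μ • A.vacuum ∧
      TwistedVOA.IsTwistedModule A (g * A.innerAut u) (TwistedVOA.deltaTwist A u YW)
        (gW * TwistedVOA.innerAct u YW) (TwistedVOA.deltaGrading u YW gr μ) ∧
      TwistedVOA.LZero A (TwistedVOA.deltaTwist A u YW) =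
        TwistedVOA.LZero A YW - TwistedVOA.zeroMode YW u +
          algebraMap ℂ (Module.End ℂ W) (μ / 2) ∧
      ∀ n : ℂ, (⨆ γ, TwistedVOA.deltaGrading u YW gr μ n γ) =
        (TwistedVOA.LZero A YW - TwistedVOA.zeroMode YW u +
          algebraMap ℂ (Module.End ℂ W) (μ / 2)).maxGenEigenspace n := by
  obtain ⟨μ, h⟩ := A.exists_isPrimaryCurrent hV0 hVneg hu hL1u
  exact ⟨hg.mul h.isAutomorphism_innerAut, μ, h.mode_one_self,
    TwistedVOA.isTwistedModule_deltaTwist h hW hg hgu hsum, TwistedVOA.LZero_deltaTwist h hW,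
    TwistedVOA.iSup_deltaGrading_eq h hW hg hgu hsum⟩
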